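/- Let $k$ be a field, $R=k[x,y]$, $A=k[T_1,\dots,T_r]$ (standard gradings), and let $f_1,\dots,f_r\in R$ be homogeneous polynomials of the same degree $d\ge 1$ without common factor, so that they define a morphism $\psi=(f_1:\cdots:f_r):\mathbb P^1_k\to\mathbb P^{r-1}_k$. Let $\mathcal C$ be its image and $I_{\mathcal C}=\{F\in A : F(f_1,\dots,f_r)=0\}$ the defining ideal of $\mathcal C$. The syzygy degrees of $f_1,\dots,f_r$ are the integers $\mu_1,\dots,\mu_{r-1}\ge 0$ for which the syzygy module $\{(a_1,\dots,a_r)\in R^r:\sum_i a_if_i=0\}$ has an $R$-basis $\Phi_1,\dots,\Phi_{r-1}$ such that all coordinates of $\Phi_j$ are homogeneous of degree $\mu_j$. For a finitely generated graded $A$-module $M$ let $$\operatorname{reg}(M)=\sup\{m+i : H^i_{(T_1,\dots,T_r)}(M)_m\neq 0\}$$ be its Castelnuovo–Mumford regularity, where $H^i_{(T_1,\dots,T_r)}$ is local cohomology and $\operatorname{reg}(0)=-\infty$. Suppose that $\psi$ is birational onto its image, i.e. induces an isomorphism $k(\mathcal C)\to k(\mathbb P^1)$ of function fields. Then syzygy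 degrees $\mu_1,\dots,\mu_{r-1}$ exist, and for any such $\mu_1,\dots,\mu_{r-1}$ we have $\sum_{i=1}^{r-1}\mu_i=d$ and $$\operatorname{reg}(I_{\mathcal C})\le\max_{i\ne j}\{\mu_i+\mu_j\}$$ (for $r=2$, where $I_{\mathcal C}=0$, the maximum of the empty set is $-\infty$). Moreover, if $f_1,\dots,f_r$ are linearly independent over $k$ (i.e. $\mathcal C$ lies in no hyperplane), then $$\operatorname{reg}(A/I_{\mathcal C})\le\deg(\mathcal C)-\operatorname{codim}(\mathcal C),$$ where $\operatorname{codim}(\mathcal C)=(r-1)-\dim\mathcal C$, and $\deg(\mathcal C)=(\dim\mathcal C)!$ times the leading coefficient of the Hilbert polynomial of $A/I_{\mathcal C}$. -/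

import Mathlib

open MvPolynomial

namespace RationalCurve

noncomputable section

/-! ### Local cohomology with support in the irrelevant ideal, and regularity

`A = k[T_1, …, T_r]` is `MvPolynomial (Fin r) k`, graded by the total degree. A graded `A`-module is
an `A`-module `M` with its family of graded pieces `ℳ n`, `n : ℕ`. -/

section Cech

variable {k : Type*} [Field k] {r : ℕ}

/-- The multiplicative set of the monomials in the variables `T_i`, `i ∈ σ`. Localizing at it is
the same as inverting the product of these variables. -/
def varMonoid (k : Type*) [Field k] {r : ℕ} (σ : Finset (Fin r)) :
    Submonoid (MvPolynomial (Fin r) k) :=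
  Submonoid.closure (X '' (σ : Set (Fin r)))

theorem varMonoid_mono {σ τ : Finset (Fin r)} (h : σ ⊆ τ) : varMonoid k σ ≤ varMonoid k τ :=
  Submonoid.closure_mono (Set.image_mono (Finset.coe_subset.mpr h))

variable (k) in
/-- All cochains of the Čech complex of `M` with respect to `T_1, …, T_r`: the product, over the
subsets `σ` of the set of variables, of the localizations `M_{T_σ}` with `T_σ = ∏ i ∈ σ, T_i`. -/
abbrev CechCochain (r : ℕ) (M : Type*) [AddCommGroup M] [Module (MvPolynomial (Fin r) k) M] :
    Type _ :=
  (σ : Finset (Fin r)) → LocalizedModule (varMonoid k σ) M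

variable {M : Type*} [AddCommGroup M] [Module (MvPolynomial (Fin r) k) M]

/-- The localization map `M_{T_σ} → M_{T_τ}` for `σ ⊆ τ`. -/
def cechRes {σ τ : Finset (Fin r)} (h : σ ⊆ τ) :
    LocalizedModule (varMonoid k σ) M →ₗ[MvPolynomial (Fin r) k]
      LocalizedModule (varMonoid k τ) M :=
  LocalizedModule.liftOfLE (varMonoid k σ) (varMonoid k τ) (varMonoid_mono h)

/-- The Čech differential. The component at `τ = {i_0 < ⋯ < i_p}` is
`∑_s (-1)^s c (τ \ {i_s})`, restricted to `M_{T_τ}`. -/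
def cechD : CechCochain k r M →ₗ[MvPolynomial (Fin r) k] CechCochain k r M where
  toFun c τ := ∑ i ∈ τ, (-1 : MvPolynomial (Fin r) k) ^ (τ.filter (· < i)).card •
    cechRes (Finset.erase_subset i τ) (c (τ.erase i))
  map_add' c c' := by
    funext τ
    simp only [Pi.add_apply, map_add, smul_add, Finset.sum_add_distrib]
  map_smul' a c := by
    funext τ
    simp only [Pi.smul_apply, map_smul, RingHom.id_apply, Finset.smul_sum, smul_comm a]

theorem cechRes_comp {σ τ υ : Finset (Fin r)} (h : σ ⊆ τ) (h' : τ ⊆ υ)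
    (z : LocalizedModule (varMonoid k σ) M) :
    cechRes h' (cechRes h z) = cechRes (h.trans h') z := by
  have : (cechRes h').comp (cechRes (k := k) (M := M) h) = cechRes (h.trans h') := by
    apply IsLocalizedModule.ext (varMonoid k σ) (LocalizedModule.mkLinearMap (varMonoid k σ) M)
    · intro x
      exact IsLocalizedModule.map_units (LocalizedModule.mkLinearMap (varMonoid k υ) M) ⟨x.1, varMonoid_mono (h.trans h') x.2⟩
    · apply LinearMap.ext
      intro x
      have e : ∀ {σ τ : Finset (Fin r)} (h : σ ⊆ τ),
          cechRes h (LocalizedModule.mkLinearMap (varMonoid k σ) M x) =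
            LocalizedModule.mkLinearMap (varMonoid k τ) M x := fun h =>
        IsLocalizedModule.liftOfLE_apply _ _ (varMonoid_mono h) _ _ x
      simp only [LinearMap.comp_apply, e]
  exact LinearMap.congr_fun this z

/-- The Čech differential squares to zero. -/
theorem cechD_cechD (c : CechCochain k r M) : cechD (cechD c) = 0 := by
  funext τ
  have key : ∀ (σ σ' : Finset (Fin r)) (h : σ ⊆ τ) (h' : σ' ⊆ τ), σ = σ' →
      cechRes h (c σ) = cechRes h' (c σ') := by
    rintro σ _ h h' rfl; rfl
  simp only [cechD, LinearMap.coe_mk, AddHom.coe_mk, map_sum, map_smul, cechRes_comp,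
    Finset.smul_sum, smul_smul, Pi.zero_apply]
  rw [Finset.sum_sigma']
  refine Finset.sum_involution (fun x _ => ⟨x.2, x.1⟩) ?_ ?_ ?_ ?_
  · rintro ⟨i, j⟩ hx
    simp only [Finset.mem_sigma, Finset.mem_erase] at hx
    obtain ⟨hi, hji, hj⟩ := hx
    rw [key _ ((τ.erase j).erase i) _ (((τ.erase j).erase_subset i).trans (τ.erase_subset j))
      Finset.erase_right_comm, ← add_smul]
    refine (congrArg (· • _) ?_).trans (zero_smul (MvPolynomial (Fin r) k) _)
    have e : ∀ a b : Fin r, b < a → b ∈ τ → (τ.filter (· < a)).card = ((τ.erase b).filter (· < a)).card + 1 := by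
      intro a b hab hb
      rw [Finset.filter_erase, Finset.card_erase_add_one (by simp [hb, hab])]
    have e' : ∀ a b : Fin r, a < b → (τ.filter (· < a)).card = ((τ.erase b).filter (· < a)).card := by
      intro a b hab
      rw [Finset.filter_erase, Finset.erase_eq_of_notMem (by simp [hab.le])]
    rcases lt_or_gt_of_ne hji with h | h
    · rw [e i j h hj, e' j i h]; ring
    · rw [e j i h hi, e' i j h]; ring
  · rintro ⟨i, j⟩ hx _ h
    simp only [Finset.mem_sigma, Finset.mem_erase] at hx
    simp only [Sigma.mk.injEq, heq_eq_eq] at h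
    exact hx.2.1 h.1
  · rintro ⟨i, j⟩ hx
    simp only [Finset.mem_sigma, Finset.mem_erase] at hx ⊢
    tauto
  · rintro ⟨i, j⟩ hx; rfl

/-- The elements of degree `m` of the localization `M_{T_σ}` of a graded module: (sums of)
fractions `u / s` with `u` homogeneous of degree `a`, `s` of degree `b`, and `a - b = m`. -/
def locDegree (ℳ : ℕ → AddSubgroup M) (σ : Finset (Fin r)) (m : ℤ) :
    AddSubgroup (LocalizedModule (varMonoid k σ) M) :=
  AddSubgroup.closure {z | ∃ (a b : ℕ) (u : M) (s : varMonoid k σ), u ∈ ℳ a ∧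
    (s : MvPolynomial (Fin r) k).IsHomogeneous b ∧ (a : ℤ) - b = m ∧ z = LocalizedModule.mk u s}

/-- The `p`-cochains of degree `m`: those that live on the subsets `σ` with `p` elements and whose
components have degree `m`. -/
def cechHomogeneous (ℳ : ℕ → AddSubgroup M) (p : ℕ) (m : ℤ) : AddSubgroup (CechCochain k r M) where
  carrier := {c | (∀ σ, σ.card ≠ p → c σ = 0) ∧ ∀ σ, c σ ∈ locDegree ℳ σ m}
  zero_mem' := ⟨fun _ _ => rfl, fun _ => zero_mem _⟩
  add_mem' := fun {a b} ha hb =>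
    ⟨fun σ hσ => by rw [Pi.add_apply, ha.1 σ hσ, hb.1 σ hσ, add_zero],
      fun σ => add_mem (ha.2 σ) (hb.2 σ)⟩
  neg_mem' := fun {a} ha =>
    ⟨fun σ hσ => by rw [Pi.neg_apply, ha.1 σ hσ, neg_zero], fun σ => neg_mem (ha.2 σ)⟩

/-- The `p`-cocycles of degree `m`. -/
def cechCocycles (ℳ : ℕ → AddSubgroup M) (p : ℕ) (m : ℤ) : AddSubgroup (CechCochain k r M) :=
  cechHomogeneous ℳ p m ⊓ (cechD (k := k) (r := r) (M := M)).toAddMonoidHom.ker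

/-- The `p`-coboundaries of degree `m`: the images of the `(p-1)`-cochains of degree `m`
(only `0` if `p = 0`). -/
def cechCoboundaries (ℳ : ℕ → AddSubgroup M) (p : ℕ) (m : ℤ) : AddSubgroup (CechCochain k r M) :=
  ⨆ (q : ℕ) (_ : q + 1 = p),
    (cechHomogeneous ℳ q m).map (cechD (k := k) (r := r) (M := M)).toAddMonoidHom

/-- The degree `m` part of the local cohomology module `H^p(M)` with support in the irrelevant
ideal `(T_1, …, T_r)`, computed by the Čech complex. -/
abbrev LocalCohomology (ℳ : ℕ → AddSubgroup M) (p : ℕ) (m : ℤ) : Type _ :=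
  cechCocycles (k := k) (r := r) ℳ p m ⧸
    (cechCoboundaries (k := k) (r := r) ℳ p m).addSubgroupOf
      (cechCocycles (k := k) (r := r) ℳ p m)

variable (k r) in
/-- The Castelnuovo–Mumford regularity: the supremum of all `m + p` such that the degree `m` part
of the `p`-th local cohomology of `M` is nonzero. It is `-∞` for `M = 0`. -/
def regularity (ℳ : ℕ → AddSubgroup M) : EReal :=
  ⨆ (p : ℕ) (m : ℤ) (_ : Nontrivial (LocalCohomology (k := k) (r := r) ℳ p m)),
    (((m + p : ℤ) : ℝ) : EReal)

end Cech

/-! ### Homogeneous ideals of `A` and the closed subschemes of `ℙ^(r-1)` they define -/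

section Ideals

variable {k : Type*} [Field k] {r : ℕ}

/-- The grading of an ideal of `A` by the degree of polynomials. -/
def idealPiece (I : Ideal (MvPolynomial (Fin r) k)) (n : ℕ) : AddSubgroup I :=
  (homogeneousSubmodule (Fin r) k n).toAddSubgroup.comap I.subtype.toAddMonoidHom

/-- The degree `n` part of `A ⧸ I`, as a `k`-vector space. -/
def quotientPiece (I : Ideal (MvPolynomial (Fin r) k)) (n : ℕ) :
    Submodule k (MvPolynomial (Fin r) k ⧸ I) :=
  (homogeneousSubmodule (Fin r) k n).map (Ideal.Quotient.mkₐ k I).toLinearMap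

/-- `reg I` for a homogeneous ideal `I` of `A`. -/
def regIdeal (I : Ideal (MvPolynomial (Fin r) k)) : EReal :=
  regularity k r (idealPiece I)

/-- `reg (A ⧸ I)` for a homogeneous ideal `I` of `A`. -/
def regQuotient (I : Ideal (MvPolynomial (Fin r) k)) : EReal :=
  regularity k r (fun n => (quotientPiece I n).toAddSubgroup)

/-- The subscheme of `ℙ^(r-1)` defined by `I` has dimension `δ`. -/
def HasProjDim (I : Ideal (MvPolynomial (Fin r) k)) (δ : ℕ) : Prop :=
  ringKrullDim (MvPolynomial (Fin r) k ⧸ I) = ((δ + 1 : ℕ) : WithBot ℕ∞)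

/-- `P` is the Hilbert polynomial of `A ⧸ I`. -/
def IsHilbertPolynomial (I : Ideal (MvPolynomial (Fin r) k)) (P : Polynomial ℚ) : Prop :=
  ∀ᶠ n : ℕ in Filter.atTop, (Module.finrank k (quotientPiece I n) : ℚ) = P.eval (n : ℚ)

/-- The subscheme of `ℙ^(r-1)` defined by `I` has degree `e`: its Hilbert polynomial, of degree `δ`,
has leading coefficient `e / δ!`. -/
def HasProjDegree (I : Ideal (MvPolynomial (Fin r) k)) (e : ℕ) : Prop :=
  ∃ P : Polynomial ℚ, IsHilbertPolynomial I P ∧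
    P.leadingCoeff * (P.natDegree.factorial : ℚ) = (e : ℚ)

end Ideals

/-! ### Parameterized curves

`R = k[x, y]` is `MvPolynomial (Fin 2) k`. -/

section Curves

variable {k : Type*} [Field k] {r : ℕ}

/-- The forms `f_1, …, f_r` of degree `d ≥ 1` have no common factor, so that
`(f_1 : ⋯ : f_r)` is a morphism `ℙ^1 → ℙ^(r-1)`. -/
structure IsParametrization (f : Fin r → MvPolynomial (Fin 2) k) (d : ℕ) : Prop where
  one_le : 1 ≤ d
  isHomogeneous : ∀ i, (f i).IsHomogeneous d
  no_common_factor : ∀ g : MvPolynomial (Fin 2) k, (∀ i, g ∣ f i) → IsUnit g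

/-- The defining ideal `I_C` of the image `C` of `(f_1 : ⋯ : f_r)`: the polynomials `F` in
`T_1, …, T_r` with `F(f_1, …, f_r) = 0`. -/
def imageIdeal (f : Fin r → MvPolynomial (Fin 2) k) : Ideal (MvPolynomial (Fin r) k) :=
  RingHom.ker (aeval f : MvPolynomial (Fin r) k →ₐ[k] MvPolynomial (Fin 2) k)

/-- `(f_1 : ⋯ : f_r)` is birational onto its image `C`: the induced homomorphism `k(C) → k(ℙ^1)`
of function fields, `F / G ↦ F(f) / G(f)`, is surjective (hence an isomorphism). The elements of
`k(ℙ^1)` are the fractions `p / q`, and those of `k(C)` the fractions `F / G`, with numerator and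
denominator homogeneous of the same degree. -/
def IsBirationalOntoImage (f : Fin r → MvPolynomial (Fin 2) k) : Prop :=
  ∀ (n : ℕ) (p q : MvPolynomial (Fin 2) k), p.IsHomogeneous n → q.IsHomogeneous n → q ≠ 0 →
    ∃ (m : ℕ) (F G : MvPolynomial (Fin r) k), F.IsHomogeneous m ∧ G.IsHomogeneous m ∧
      aeval f G ≠ 0 ∧
      (algebraMap _ (FractionRing (MvPolynomial (Fin 2) k)) p) / algebraMap _ _ q =
        algebraMap _ (FractionRing (MvPolynomial (Fin 2) k)) (aeval f F) /
          algebraMap _ _ (aeval f G)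

/-- The module of first syzygies of `f_1, …, f_r` over `R`. -/
def syzygies (f : Fin r → MvPolynomial (Fin 2) k) :
    Submodule (MvPolynomial (Fin 2) k) (Fin r → MvPolynomial (Fin 2) k) :=
  LinearMap.ker (Fintype.linearCombination (MvPolynomial (Fin 2) k) f)

/-- `μ_1, …, μ_(r-1)` are the syzygy degrees of `f_1, …, f_r`: the syzygy module has an `R`-basis
`Φ_1, …, Φ_(r-1)` such that all coordinates of `Φ_j` are homogeneous of degree `μ_j`. In other
words, `0 → ⨁ R(-d-μ_j) → R(-d)^r → (f_1, …, f_r) → 0` is exact with first map `Φ`. -/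
def IsSyzygyDegrees (f : Fin r → MvPolynomial (Fin 2) k) (μ : Fin (r - 1) → ℕ) : Prop :=
  ∃ Φ : Module.Basis (Fin (r - 1)) (MvPolynomial (Fin 2) k) (syzygies f),
    ∀ j i, ((Φ j : Fin r → MvPolynomial (Fin 2) k) i).IsHomogeneous (μ j)

end Curves

end

end RationalCurve

/-! Write B = A/I_C, which `T_i ↦ f_i` identifies with k[f_1, …, f_r] ⊂ R, and let b = max(μ_i +
μ_j) - 1 for r ≥ 3. Multiplication by y^b embeds B into M = ⨁_n R_(b+dn). Let N be the cokernel. The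
local cohomology of B is read off from 0 → B → M → N → 0.

The module M has only H^2, and H^2(M)_j = 0 when b + dj ≥ -1. This is a Koszul argument with two
coprime forms taken from k[f] (`IsParametrization.cohomologyVanishes_targetPiece`).

The module M is generated by the monomials of degree b, because a dimension count with the syzygy
degrees puts all binary forms of degree at least max μ_j + d - 1 into (f_1, …, f_r). The relations
between these generators are the equations of the Rees algebra of degree b in x, y. Where x or y is
inverted, the syzygy module splits off, so these equations are generated by the r - 1 linear forms
g_j = ∑ Φ_(j,i) T_i, which have only Koszul relations. Comparing the two charts leaves an
obstruction in the parts of degree b - μ_i - μ_j of H^2 of k[x, y], which vanish because μ_i + μ_j ≤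
b + 1 (`IsParametrization.exists_eq_sum_linearEquation`). Dropping the generator y^b, N becomes the
cokernel of a matrix of linear forms with b generators (`IsSyzygyDegrees.exists_presentation`).

Birationality provides a conductor: a form c, nonzero on the curve, that kills N. Hence N has
dimension at most one; concretely, a power of each T_i acts on N as a multiple of a single form
(`IsSyzygyDegrees.exists_conductor`, `IsSyzygyDegrees.exists_parameter`).

For such an N the method of Gruson, Lazarsfeld and Peskine applies. The relations are linear forms
in new variables w_1, …, w_b. Their Koszul complex over A[w], combined with the Čech complex in w
and restricted to w-degree one, consists of products of shifted copies of A, has N as cohomology in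
degree 0, and has all its cohomology supported in dimension at most one; it plays the role of a
Buchsbaum–Rim complex. A chase along it gives H^p(N)_j = 0 for p < 2 and j ≥ b - p
(`cohomologyVanishes_of_linear_presentation`). Therefore reg B ≤ b and reg I_C ≤ b + 1.

If the f_i are linearly independent, all μ_j are at least 1, and ∑ μ_j = d forces b ≤ d - r + 2. The
degree of C is d because dt + 1 minus the Hilbert function is bounded and eventually constant
(`IsSyzygyDegrees.hasProjDegree`).

Local cohomology is handled through the direct limit of the Koszul complexes of T_1^a, …, T_r^a:
`CohomologyVanishes` says that each class dies after enlarging a. Graded modules appear as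
subquotients Z/B, given by families of subgroups of one ambient module, so no quotients have to be
formed. `CohomologyVanishes.subsingleton` returns to the Čech complex. -/

namespace RationalCurve

noncomputable section

/-! ### Wedge and contraction operators on families indexed by finite sets -/

section CAR

variable {A ι M : Type*} [CommRing A] [LinearOrder ι] [AddCommGroup M] [Module A M]

/-- The sign of `i` with respect to a finite set. -/
def koszulSign (A : Type*) [CommRing A] {ι : Type*} [LinearOrder ι] (τ : Finset ι) (i : ι) : A :=
  (-1) ^ (τ.filter (· < i)).card

theorem koszulSign_erase (τ : Finset ι) (i j : ι) (hj : j ∈ τ) :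
    koszulSign A (τ.erase j) i = if j < i then - koszulSign A τ i else koszulSign A τ i := by
  unfold koszulSign
  split_ifs with h
  · have : (τ.filter (· < i)).card = ((τ.erase j).filter (· < i)).card + 1 := by
      rw [Finset.filter_erase, Finset.card_erase_add_one (by simp [h, hj])]
    rw [this]; ring
  · rw [Finset.filter_erase, Finset.erase_eq_of_notMem (by simp [h])]

theorem koszulSign_insert (τ : Finset ι) (i j : ι) (hj : j ∉ τ) :
    koszulSign A (insert j τ) i = if j < i then - koszulSign A τ i else koszulSign A τ i := by
  unfold koszulSign
  split_ifs with h
  · have : ((insert j τ).filter (· < i)).card = (τ.filter (· < i)).card + 1 := by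
      rw [Finset.filter_insert, if_pos h, Finset.card_insert_of_notMem (by simp [hj])]
    rw [this]; ring
  · rw [Finset.filter_insert, if_neg h]

theorem koszulSign_mul_self (τ : Finset ι) (i : ι) :
    koszulSign A τ i * koszulSign A τ i = 1 := by
  unfold koszulSign
  rw [← mul_pow]; simp

variable (A M) in
/-- Exterior multiplication by the `i`-th basis vector. -/
def wedge (i : ι) : Module.End A (Finset ι → M) where
  toFun u τ := if i ∈ τ then koszulSign A τ i • u (τ.erase i) else 0
  map_add' u v := by
    funext τ; dsimp only [Pi.add_apply]; split_ifs <;> simp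
  map_smul' a u := by
    funext τ; dsimp only [Pi.smul_apply, RingHom.id_apply]; split_ifs <;> simp [smul_comm a]

variable (A M) in
/-- Contraction with the `i`-th dual basis vector. -/
def contr (i : ι) : Module.End A (Finset ι → M) where
  toFun u τ := if i ∈ τ then 0 else koszulSign A τ i • u (insert i τ)
  map_add' u v := by
    funext τ; dsimp only [Pi.add_apply]; split_ifs <;> simp
  map_smul' a u := by
    funext τ; dsimp only [Pi.smul_apply, RingHom.id_apply]; split_ifs <;> simp [smul_comm a]

theorem wedge_apply (i : ι) (u : Finset ι → M) (τ : Finset ι) :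
    wedge A M i u τ = if i ∈ τ then koszulSign A τ i • u (τ.erase i) else 0 := rfl

theorem contr_apply (i : ι) (u : Finset ι → M) (τ : Finset ι) :
    contr A M i u τ = if i ∈ τ then 0 else koszulSign A τ i • u (insert i τ) := rfl

/-- The smaller of the two indices is counted in the sign of the larger one, so exactly one of the
two orders picks up a sign. All relations between wedges and contractions at distinct indices hold
for this reason. -/
theorem wedge_mul_wedge (i j : ι) :
    wedge A M i * wedge A M j = - (wedge A M j * wedge A M i) := by
  refine LinearMap.ext fun u => funext fun τ => ?_
  simp only [Module.End.mul_apply, LinearMap.neg_apply, Pi.neg_apply, wedge_apply,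
    Finset.mem_erase]
  rcases eq_or_ne i j with rfl | hij
  · simp
  by_cases hi : i ∈ τ <;> by_cases hj : j ∈ τ <;> simp [hi, hj, hij, hij.symm]
  rw [koszulSign_erase _ _ _ hi, koszulSign_erase _ _ _ hj, Finset.erase_right_comm, smul_smul,
    smul_smul, ← neg_smul]
  congr 1
  rcases lt_or_gt_of_ne hij with h | h <;> simp [h, h.not_gt] <;> ring

theorem wedge_mul_self (i : ι) : wedge A M i * wedge A M i = 0 := by
  refine LinearMap.ext fun u => funext fun τ => ?_
  simp [wedge_apply]

theorem contr_mul_self (i : ι) : contr A M i * contr A M i = 0 := by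
  refine LinearMap.ext fun u => funext fun τ => ?_
  simp [contr_apply]

theorem contr_mul_contr (i j : ι) :
    contr A M i * contr A M j = - (contr A M j * contr A M i) := by
  refine LinearMap.ext fun u => funext fun τ => ?_
  simp only [Module.End.mul_apply, LinearMap.neg_apply, Pi.neg_apply, contr_apply,
    Finset.mem_insert]
  rcases eq_or_ne i j with rfl | hij
  · simp
  by_cases hi : i ∈ τ <;> by_cases hj : j ∈ τ <;> simp [hi, hj, hij, hij.symm]
  rw [koszulSign_insert _ _ _ hi, koszulSign_insert _ _ _ hj, Finset.insert_comm, smul_smul,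
    smul_smul, ← neg_smul]
  congr 1
  rcases lt_or_gt_of_ne hij with h | h <;> simp [h, h.not_gt] <;> ring

theorem wedge_mul_contr_of_ne {i j : ι} (hij : i ≠ j) :
    wedge A M i * contr A M j = - (contr A M j * wedge A M i) := by
  refine LinearMap.ext fun u => funext fun τ => ?_
  simp only [Module.End.mul_apply, LinearMap.neg_apply, Pi.neg_apply, contr_apply, wedge_apply,
    Finset.mem_insert, Finset.mem_erase]
  by_cases hi : i ∈ τ <;> by_cases hj : j ∈ τ <;> simp [hi, hj, hij, hij.symm]
  rw [koszulSign_erase _ _ _ hi, koszulSign_insert _ _ _ hj, Finset.erase_insert_of_ne hij.symm,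
    smul_smul, smul_smul, ← neg_smul]
  congr 1
  rcases lt_or_gt_of_ne hij with h | h <;> simp [h, h.not_gt] <;> ring

theorem wedge_mul_contr_self_apply (i : ι) (u : Finset ι → M) (τ : Finset ι) :
    (wedge A M i * contr A M i) u τ = if i ∈ τ then u τ else 0 := by
  simp only [Module.End.mul_apply, contr_apply, wedge_apply]
  by_cases hi : i ∈ τ
  · simp [hi, koszulSign_erase _ _ _ hi, smul_smul, koszulSign_mul_self]
  · simp [hi]

theorem contr_mul_wedge_self_apply (i : ι) (u : Finset ι → M) (τ : Finset ι) :
    (contr A M i * wedge A M i) u τ = if i ∈ τ then 0 else u τ := by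
  simp only [Module.End.mul_apply, contr_apply, wedge_apply]
  by_cases hi : i ∈ τ
  · simp [hi]
  · simp [hi, koszulSign_insert _ _ _ hi, smul_smul, koszulSign_mul_self]

theorem wedge_mul_contr_self (i : ι) :
    wedge A M i * contr A M i = 1 - contr A M i * wedge A M i := by
  refine LinearMap.ext fun u => funext fun τ => ?_
  rw [LinearMap.sub_apply, Pi.sub_apply, wedge_mul_contr_self_apply, contr_mul_wedge_self_apply]
  by_cases hi : i ∈ τ <;> simp [hi]

/-- The remaining anticommutation relation; the Koszul and Čech homotopies below are all derived
from it. -/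
theorem wedge_mul_contr (i j : ι) :
    wedge A M i * contr A M j = (if i = j then 1 else 0) - contr A M j * wedge A M i := by
  split_ifs with h
  · subst h; exact wedge_mul_contr_self i
  · rw [wedge_mul_contr_of_ne h, zero_sub]

/-- Apply a linear endomorphism to all members of a family. -/
def pointwise (ι : Type*) (f : Module.End A M) : Module.End A (Finset ι → M) :=
  f.compLeft (Finset ι)

omit [LinearOrder ι] in
theorem pointwise_apply (f : Module.End A M) (u : Finset ι → M) (τ : Finset ι) :
    pointwise ι f u τ = f (u τ) := rfl

theorem wedge_mul_pointwise (i : ι) (f : Module.End A M) :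
    wedge A M i * pointwise ι f = pointwise ι f * wedge A M i := by
  refine LinearMap.ext fun u => funext fun τ => ?_
  simp only [Module.End.mul_apply, wedge_apply, pointwise_apply]
  split_ifs <;> simp

theorem contr_mul_pointwise (i : ι) (f : Module.End A M) :
    contr A M i * pointwise ι f = pointwise ι f * contr A M i := by
  refine LinearMap.ext fun u => funext fun τ => ?_
  simp only [Module.End.mul_apply, contr_apply, pointwise_apply]
  split_ifs <;> simp

omit [LinearOrder ι] in
theorem pointwise_mul (f g : Module.End A M) :
    pointwise ι (f * g) = pointwise ι f * pointwise ι g := rfl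

end CAR

/-! ### Local cohomology of graded subquotients through Koszul complexes of powers -/

section Koszul

variable {k : Type*} [Field k] {r : ℕ}
variable {M : Type*} [AddCommGroup M] [Module (MvPolynomial (Fin r) k) M]

local notation "𝔸" => MvPolynomial (Fin r) k

variable (k r M) in
/-- The differential of the Koszul complex of `T_1^a, …, T_r^a`. -/
def koszulD (a : ℕ) : Module.End 𝔸 (Finset (Fin r) → M) :=
  ∑ i, (X i ^ a : 𝔸) • wedge 𝔸 M i

variable (k r M) in
/-- The transition map from the Koszul complex of `T^a` to the one of `T^(a+b)`. -/
def koszulShift (b : ℕ) : Module.End 𝔸 (Finset (Fin r) → M) where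
  toFun u σ := ((∏ i ∈ σ, X i) ^ b : 𝔸) • u σ
  map_add' u v := by funext; simp
  map_smul' a u := by funext; simp [smul_comm a]

theorem koszulShift_apply (b : ℕ) (u : Finset (Fin r) → M) (σ : Finset (Fin r)) :
    koszulShift k r M b u σ = ((∏ i ∈ σ, X i) ^ b : 𝔸) • u σ := rfl

theorem koszulD_apply (a : ℕ) (u : Finset (Fin r) → M) (τ : Finset (Fin r)) :
    koszulD k r M a u τ = ∑ i ∈ τ, (X i ^ a : 𝔸) • koszulSign 𝔸 τ i • u (τ.erase i) := by
  simp only [koszulD, LinearMap.sum_apply, LinearMap.smul_apply, Finset.sum_apply, Pi.smul_apply,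
    wedge_apply, smul_ite, smul_zero]
  rw [← Finset.sum_filter, Finset.filter_mem_eq_inter, Finset.univ_inter]

theorem koszulD_koszulD (a : ℕ) (u : Finset (Fin r) → M) :
    koszulD k r M a (koszulD k r M a u) = 0 := by
  have h : koszulD k r M a * koszulD k r M a = 0 := by
    simp only [koszulD, Finset.sum_mul, Finset.mul_sum, smul_mul_smul_comm]
    rw [← Finset.sum_product']
    refine Finset.sum_involution (fun x _ => (x.2, x.1)) ?_ ?_ ?_ ?_
    · rintro ⟨i, j⟩ -
      rw [wedge_mul_wedge, smul_neg, mul_comm (X i ^ a), neg_add_cancel]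
    · rintro ⟨i, j⟩ - h e
      simp only [Prod.mk.injEq] at e
      rw [e.1, wedge_mul_self, smul_zero] at h
      exact h rfl
    · simp
    · simp
  exact LinearMap.congr_fun h u

/-- The factor T_σ^b is what makes this a chain map, since T_τ^b = T_i^b T_(τ∖i)^b. The limit over
these maps is the Čech complex. -/
theorem koszulD_koszulShift (a b : ℕ) (u : Finset (Fin r) → M) :
    koszulD k r M (a + b) (koszulShift k r M b u) = koszulShift k r M b (koszulD k r M a u) := by
  funext τ
  rw [koszulShift_apply, koszulD_apply, koszulD_apply, Finset.smul_sum]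
  refine Finset.sum_congr rfl fun i hi => ?_
  rw [koszulShift_apply]
  simp only [smul_smul]
  congr 1
  rw [← Finset.mul_prod_erase τ _ hi]
  ring

theorem koszulShift_add (b c : ℕ) (u : Finset (Fin r) → M) :
    koszulShift k r M (b + c) u = koszulShift k r M c (koszulShift k r M b u) := by
  funext τ
  simp only [koszulShift_apply, smul_smul]
  congr 1
  ring

theorem koszulShift_zero (u : Finset (Fin r) → M) : koszulShift k r M 0 u = u := by
  funext τ; simp [koszulShift_apply]

/-- The contraction operators are homotopies for multiplication by the powers of the variables. -/
theorem koszulD_mul_contr (a : ℕ) (i : Fin r) :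
    koszulD k r M a * contr 𝔸 M i = (X i ^ a : 𝔸) • 1 - contr 𝔸 M i * koszulD k r M a := by
  simp only [koszulD, Finset.sum_mul, Finset.mul_sum, smul_mul_assoc, mul_smul_comm,
    wedge_mul_contr, smul_sub, Finset.sum_sub_distrib, smul_ite, smul_zero, Finset.sum_ite_eq',
    Finset.mem_univ, if_true]

/-- The contraction with a linear combination `∑ γ i • e_i^*`. -/
theorem koszulD_sum_contr (a : ℕ) (γ : Fin r → 𝔸) (u : Finset (Fin r) → M) :
    koszulD k r M a (∑ i, γ i • contr 𝔸 M i u) =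
      (∑ i, γ i * X i ^ a) • u - ∑ i, γ i • contr 𝔸 M i (koszulD k r M a u) := by
  have h := fun i => LinearMap.congr_fun (koszulD_mul_contr (k := k) (M := M) a i) u
  simp only [Module.End.mul_apply, LinearMap.sub_apply, LinearMap.smul_apply,
    Module.End.one_apply] at h
  simp only [map_sum, map_smul, h, smul_sub, Finset.sum_sub_distrib, Finset.sum_smul, smul_smul]

variable (k r) in
/-- A family of subgroups which is stable under the graded action of the polynomial ring. -/
def IsGradedFamily (Z : ℤ → AddSubgroup M) : Prop :=
  ∀ (F : 𝔸) (e : ℕ) (n : ℤ) (x : M), F.IsHomogeneous e → x ∈ Z n → F • x ∈ Z (n + e)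

/-- The homogeneous `p`-cochains of degree `j` of the Koszul complex of `T^a`. -/
def koszulCochain (Z : ℤ → AddSubgroup M) (p j : ℤ) (a : ℕ) :
    AddSubgroup (Finset (Fin r) → M) where
  carrier := {u | ∀ σ, ((σ.card : ℤ) ≠ p → u σ = 0) ∧ u σ ∈ Z (j + a * σ.card)}
  zero_mem' := fun σ => ⟨fun _ => rfl, zero_mem _⟩
  add_mem' := fun {u v} hu hv σ =>
    ⟨fun h => by rw [Pi.add_apply, (hu σ).1 h, (hv σ).1 h, add_zero], add_mem (hu σ).2 (hv σ).2⟩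
  neg_mem' := fun {u} hu σ =>
    ⟨fun h => by rw [Pi.neg_apply, (hu σ).1 h, neg_zero], neg_mem (hu σ).2⟩

theorem koszulCochain_mono {Y Z : ℤ → AddSubgroup M} (h : ∀ n, Y n ≤ Z n) {p j : ℤ} {a : ℕ} :
    koszulCochain (r := r) Y p j a ≤ koszulCochain Z p j a :=
  fun _ hu σ => ⟨(hu σ).1, h _ (hu σ).2⟩

variable (k r) in
theorem koszulSign_smul_mem {ι : Type*} [LinearOrder ι] (H : AddSubgroup M) (τ : Finset ι) (i : ι)
    {x : M} (hx : x ∈ H) : koszulSign 𝔸 τ i • x ∈ H := by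
  unfold koszulSign
  rcases neg_one_pow_eq_or 𝔸 (τ.filter (· < i)).card with h | h <;> simp [h, hx]

theorem IsGradedFamily.smul_mem {Z : ℤ → AddSubgroup M} (hZ : IsGradedFamily k r Z) {F : 𝔸} {e : ℕ}
    {n m : ℤ} {x : M} (hF : F.IsHomogeneous e) (hx : x ∈ Z n) (hm : n + e = m) : F • x ∈ Z m :=
  hm ▸ hZ F e n x hF hx

theorem koszulD_mem {Z : ℤ → AddSubgroup M} (hZ : IsGradedFamily k r Z) {p q j : ℤ} {a : ℕ}
    {u : Finset (Fin r) → M} (hu : u ∈ koszulCochain Z p j a) (hq : p + 1 = q) :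
    koszulD k r M a u ∈ koszulCochain Z q j a := by
  intro τ
  rw [koszulD_apply]
  refine ⟨fun h => Finset.sum_eq_zero fun i hi => ?_, sum_mem fun i hi => ?_⟩
  · rw [(hu _).1, smul_zero, smul_zero]
    have := Finset.card_erase_add_one hi
    omega
  · refine hZ.smul_mem ((isHomogeneous_X k i).pow a)
      (koszulSign_smul_mem k r _ _ _ (hu (τ.erase i)).2) ?_
    rw [← Finset.card_erase_add_one hi]
    push_cast
    ring

theorem koszulShift_mem {Z : ℤ → AddSubgroup M} (hZ : IsGradedFamily k r Z) {p j : ℤ} {a b : ℕ}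
    {u : Finset (Fin r) → M} (hu : u ∈ koszulCochain Z p j a) :
    koszulShift k r M b u ∈ koszulCochain Z p j (a + b) := by
  intro τ
  rw [koszulShift_apply]
  refine ⟨fun h => by rw [(hu τ).1 h, smul_zero], ?_⟩
  have hX : (∏ i ∈ τ, X i : 𝔸).IsHomogeneous τ.card := by
    have := IsHomogeneous.prod (R := k) τ (fun i : Fin r => X i) (fun _ => 1)
      (fun i _ => isHomogeneous_X k i)
    simpa using this
  refine hZ.smul_mem (hX.pow b) (hu τ).2 ?_
  push_cast
  ring

theorem contr_mem {Z : ℤ → AddSubgroup M} {p q j j' : ℤ} {a : ℕ}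
    {u : Finset (Fin r) → M} (hu : u ∈ koszulCochain Z p j a) (i : Fin r) (hq : q + 1 = p)
    (hj : j + a = j') :
    contr 𝔸 M i u ∈ koszulCochain Z q j' a := by
  intro τ
  rw [contr_apply]
  split_ifs with h
  · exact ⟨fun _ => rfl, zero_mem _⟩
  · have hc := Finset.card_insert_of_notMem h
    refine ⟨fun h' => ?_, ?_⟩
    · rw [(hu _).1 (by omega), smul_zero]
    · have := koszulSign_smul_mem k r _ τ i (hu (insert i τ)).2
      rw [hc] at this
      convert this using 2
      rw [← hj]; push_cast; ring

theorem smul_mem_koszulCochain {Z : ℤ → AddSubgroup M} (hZ : IsGradedFamily k r Z) {p j j' : ℤ} {a : ℕ}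
    {F : 𝔸} {e : ℕ} (hF : F.IsHomogeneous e) {u : Finset (Fin r) → M}
    (hu : u ∈ koszulCochain Z p j a) (hj : j + e = j') : F • u ∈ koszulCochain Z p j' a := by
  intro τ
  refine ⟨fun h => by rw [Pi.smul_apply, (hu τ).1 h, smul_zero], ?_⟩
  exact hZ.smul_mem hF (hu τ).2 (by rw [← hj]; ring)

variable (k r) in
/-- The degree `j` part of the `p`-th local cohomology of the graded subquotient `Z ⧸ B`
vanishes. -/
def CohomologyVanishes (p j : ℤ) (Z B : ℤ → AddSubgroup M) : Prop :=
  ∀ (a : ℕ), ∀ u ∈ koszulCochain (r := r) Z p j a,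
    koszulD k r M a u ∈ koszulCochain B (p + 1) j a →
    ∃ b : ℕ, ∃ v ∈ koszulCochain (r := r) Z (p - 1) j (a + b),
      koszulD k r M (a + b) v - koszulShift k r M b u ∈ koszulCochain B p j (a + b)

end Koszul

/-- The linear map `g` induces isomorphisms `Z n ⧸ B n ≃ Z' n ⧸ B' n`. -/
structure InducesIso {A M M' : Type*} [Semiring A] [AddCommGroup M] [Module A M] [AddCommGroup M']
    [Module A M'] (g : M →ₗ[A] M') (Z B : ℤ → AddSubgroup M) (Z' B' : ℤ → AddSubgroup M') :
    Prop where
  map_mem : ∀ n, ∀ x ∈ Z n, g x ∈ Z' n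
  map_mem_sub : ∀ n, ∀ x ∈ B n, g x ∈ B' n
  surj : ∀ n, ∀ y ∈ Z' n, ∃ x ∈ Z n, y - g x ∈ B' n
  inj : ∀ n, ∀ x ∈ Z n, g x ∈ B' n → x ∈ B n

section Koszul

variable {k : Type*} [Field k] {r : ℕ}
variable {M : Type*} [AddCommGroup M] [Module (MvPolynomial (Fin r) k) M]

local notation "𝔸" => MvPolynomial (Fin r) k

theorem cohomologyVanishes_of_gt {p j : ℤ} (hp : (r : ℤ) < p) (Z B : ℤ → AddSubgroup M) :
    CohomologyVanishes k r p j Z B := by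
  intro a u hu _
  have h0 : u = 0 := by
    funext σ
    refine (hu σ).1 fun h => ?_
    have := Finset.card_le_univ σ
    rw [Fintype.card_fin] at this
    omega
  exact ⟨0, 0, zero_mem _, by simp [h0, zero_mem]⟩

/-! ### The long exact sequence of local cohomology for graded subquotients -/

section LongExact

variable {B Y Z : ℤ → AddSubgroup M} {p j : ℤ}

/-- Exactness of the long exact sequence of `0 → Y/B → Z/B → Z/Y → 0` in the middle. -/
theorem CohomologyVanishes.middle (hB : IsGradedFamily k r B)
    (hZ : IsGradedFamily k r Z) (hBY : ∀ n, B n ≤ Y n) (hYZ : ∀ n, Y n ≤ Z n)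
    (h₁ : CohomologyVanishes k r p j Y B) (h₂ : CohomologyVanishes k r p j Z Y) :
    CohomologyVanishes k r p j Z B := by
  intro a u hu hdu
  obtain ⟨b, v, hv, hvu⟩ := h₂ a u hu (koszulCochain_mono hBY hdu)
  obtain ⟨b', v', hv', hvu'⟩ := h₁ (a + b) _ (neg_mem hvu) (by
    rw [neg_sub, map_sub, koszulD_koszulD, sub_zero, koszulD_koszulShift]
    exact koszulShift_mem hB hdu)
  refine ⟨b + b', koszulShift k r M b' v + v', ?_, ?_⟩
  · rw [← add_assoc]
    exact add_mem (koszulShift_mem hZ hv) (koszulCochain_mono hYZ hv')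
  · rw [← add_assoc, map_add, koszulD_koszulShift, koszulShift_add]
    convert hvu' using 1
    rw [map_neg, map_sub]; abel

/-- Exactness of the long exact sequence of `0 → Y/B → Z/B → Z/Y → 0` at the quotient. -/
theorem CohomologyVanishes.quotient (hY : IsGradedFamily k r Y)
    (hZ : IsGradedFamily k r Z) (hBY : ∀ n, B n ≤ Y n) (hYZ : ∀ n, Y n ≤ Z n)
    (h₁ : CohomologyVanishes k r p j Z B) (h₂ : CohomologyVanishes k r (p + 1) j Y B) :
    CohomologyVanishes k r p j Z Y := by
  intro a u hu hdu
  obtain ⟨b, v, hv, hvu⟩ := h₂ a _ hdu (by rw [koszulD_koszulD]; exact zero_mem _)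
  rw [add_sub_cancel_right] at hv
  obtain ⟨b', v', hv', hvu'⟩ := h₁ (a + b) (koszulShift k r M b u - v)
    (sub_mem (koszulShift_mem hZ hu) (koszulCochain_mono hYZ hv)) (by
      rw [map_sub, koszulD_koszulShift, ← neg_sub]
      exact neg_mem hvu)
  refine ⟨b + b', v', by rwa [← add_assoc], ?_⟩
  rw [← add_assoc, koszulShift_add]
  have := sub_mem (koszulCochain_mono hBY hvu') (koszulShift_mem (b := b') hY hv)
  convert this using 1
  rw [map_sub]; abel

/-- Exactness of the long exact sequence of `0 → Y/B → Z/B → Z/Y → 0` at the submodule. -/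
theorem CohomologyVanishes.sub (hB : IsGradedFamily k r B) (hY : IsGradedFamily k r Y)
    (hBY : ∀ n, B n ≤ Y n) (hYZ : ∀ n, Y n ≤ Z n)
    (h₁ : CohomologyVanishes k r (p - 1) j Z Y) (h₂ : CohomologyVanishes k r p j Z B) :
    CohomologyVanishes k r p j Y B := by
  intro a u hu hdu
  obtain ⟨b, v, hv, hvu⟩ := h₂ a u (koszulCochain_mono hYZ hu) hdu
  -- Since `u` lies in Y, its primitive `v` is a cocycle modulo Y. The vanishing for Z/Y corrects it
  -- by a boundary to an element of Y.
  have hdv : koszulD k r M (a + b) v ∈ koszulCochain Y p j (a + b) := by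
    have := add_mem (koszulCochain_mono hBY hvu) (koszulShift_mem (b := b) hY hu)
    rwa [sub_add_cancel] at this
  obtain ⟨b', v', hv', hvu'⟩ := h₁ (a + b) v hv (by rwa [sub_add_cancel])
  refine ⟨b + b', koszulShift k r M b' v - koszulD k r M (a + b + b') v', ?_, ?_⟩
  · rw [← add_assoc]
    have := neg_mem hvu'
    rwa [neg_sub] at this
  · rw [← add_assoc, map_sub, koszulD_koszulD, sub_zero, koszulD_koszulShift, koszulShift_add,
      ← map_sub]
    exact koszulShift_mem hB hvu

end LongExact

/-! ### Invariance under maps that induce isomorphisms of subquotients -/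

section Transport

variable {M' : Type*} [AddCommGroup M'] [Module (MvPolynomial (Fin r) k) M']

theorem koszulD_map (g : M →ₗ[𝔸] M') (a : ℕ) (u : Finset (Fin r) → M) :
    koszulD k r M' a (fun σ => g (u σ)) = fun σ => g (koszulD k r M a u σ) := by
  funext τ
  simp only [koszulD_apply, map_sum, map_smul]

theorem koszulShift_map (g : M →ₗ[𝔸] M') (b : ℕ) (u : Finset (Fin r) → M) :
    koszulShift k r M' b (fun σ => g (u σ)) = fun σ => g (koszulShift k r M b u σ) := by
  funext τ
  simp only [koszulShift_apply, map_smul]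

variable {g : M →ₗ[MvPolynomial (Fin r) k] M'} {Z B : ℤ → AddSubgroup M} {Z' B' : ℤ → AddSubgroup M'} {p j : ℤ}

theorem map_mem_koszulCochain (h : ∀ n, ∀ x ∈ Z n, g x ∈ Z' n) {a : ℕ} {u : Finset (Fin r) → M}
    (hu : u ∈ koszulCochain Z p j a) : (fun σ => g (u σ)) ∈ koszulCochain Z' p j a :=
  fun σ => ⟨fun hσ => by simp [(hu σ).1 hσ], h _ _ (hu σ).2⟩

theorem InducesIso.exists_lift (h : InducesIso g Z B Z' B') {a : ℕ} {u : Finset (Fin r) → M'}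
    (hu : u ∈ koszulCochain Z' p j a) :
    ∃ v ∈ koszulCochain Z p j a, u - (fun σ => g (v σ)) ∈ koszulCochain B' p j a := by
  classical
  choose w hw hw' using fun σ => h.surj _ _ (hu σ).2
  -- The chosen lifts of zero need not be zero, so they are cut off outside the sets with `p`
  -- elements.
  refine ⟨fun σ => if (σ.card : ℤ) = p then w σ else 0, fun σ => ⟨fun hσ => if_neg hσ, ?_⟩,
    fun σ => ⟨fun hσ => ?_, ?_⟩⟩
  · dsimp only
    split_ifs
    exacts [hw σ, zero_mem _]
  · simp [(hu σ).1 hσ, hσ]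
  · rw [Pi.sub_apply]
    dsimp only
    split_ifs with hσ
    · exact hw' σ
    · rw [(hu σ).1 hσ, map_zero, sub_zero]; exact zero_mem _

theorem InducesIso.mem_of_map_mem (h : InducesIso g Z B Z' B') {a : ℕ} {u : Finset (Fin r) → M}
    (hu : u ∈ koszulCochain Z p j a) (hgu : (fun σ => g (u σ)) ∈ koszulCochain B' p j a) :
    u ∈ koszulCochain B p j a :=
  fun σ => ⟨(hu σ).1, h.inj _ _ (hu σ).2 (hgu σ).2⟩

theorem InducesIso.vanishes (h : InducesIso g Z B Z' B') (hB' : IsGradedFamily k r B')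
    (hZ : IsGradedFamily k r Z)
    (hv : CohomologyVanishes k r p j Z' B') : CohomologyVanishes k r p j Z B := by
  intro a u hu hdu
  obtain ⟨b, v, hv, hvu⟩ := hv a _ (map_mem_koszulCochain h.map_mem hu) (by
    rw [koszulD_map]; exact map_mem_koszulCochain h.map_mem_sub hdu)
  obtain ⟨w, hw, hwv⟩ := h.exists_lift hv
  refine ⟨b, w, hw, h.mem_of_map_mem
    (sub_mem (koszulD_mem hZ hw (by ring)) (koszulShift_mem hZ hu)) ?_⟩
  have e : (fun σ => g ((koszulD k r M (a + b) w - koszulShift k r M b u) σ)) =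
      koszulD k r M' (a + b) (fun σ => g (w σ)) - koszulShift k r M' b (fun σ => g (u σ)) := by
    rw [koszulD_map, koszulShift_map]
    funext σ
    simp
  rw [e]
  have := sub_mem hvu (koszulD_mem (q := p) hB' hwv (by ring))
  rw [map_sub] at this
  convert this using 1
  abel

theorem InducesIso.vanishes' (h : InducesIso g Z B Z' B') (hB' : IsGradedFamily k r B')
    (hZ : IsGradedFamily k r Z)
    (hv : CohomologyVanishes k r p j Z B) : CohomologyVanishes k r p j Z' B' := by
  intro a u hu hdu
  obtain ⟨w, hw, hwu⟩ := h.exists_lift hu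
  have hdw := koszulD_mem (q := p + 1) hB' hwu rfl
  obtain ⟨b, v, hv, hvw⟩ := hv a w hw (h.mem_of_map_mem (koszulD_mem hZ hw rfl) (by
    rw [map_sub, koszulD_map] at hdw
    have := sub_mem hdu hdw
    rwa [sub_sub_cancel] at this))
  refine ⟨b, _, map_mem_koszulCochain h.map_mem hv, ?_⟩
  have h1 := map_mem_koszulCochain h.map_mem_sub hvw
  have h2 := koszulShift_mem (b := b) hB' hwu
  rw [map_sub, koszulShift_map] at h2
  rw [koszulD_map]
  convert sub_mem h1 h2 using 1
  funext σ
  simp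

end Transport

/-! ### Subquotients of dimension at most one -/

section Torsion

theorem isHomogeneous_degree_eq {σ R : Type*} [CommSemiring R] {F : MvPolynomial σ R} {D : ℕ}
    (hF : F.IsHomogeneous D) {m : σ →₀ ℕ} (hm : F.coeff m ≠ 0) : m.degree = D := by
  by_contra h
  exact hm (hF.coeff_eq_zero h)

variable (k) in
theorem isHomogeneous_prod_X (σ : Finset (Fin r)) : (∏ i ∈ σ, X i : 𝔸).IsHomogeneous σ.card := by
  have := IsHomogeneous.prod (R := k) σ (fun i : Fin r => X i) (fun _ => 1)
    (fun i _ => isHomogeneous_X k i)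
  simpa using this

/-- Pigeonhole: a monomial of degree greater than ra has some exponent at least a. Assign each
monomial to one such variable. -/
theorem exists_eq_sum_mul_X_pow {D a δ : ℕ} {F : 𝔸} (hF : F.IsHomogeneous D) (hD : r * a < D)
    (hδ : δ + a = D) :
    ∃ γ : Fin r → 𝔸, (∀ i, (γ i).IsHomogeneous δ) ∧ F = ∑ i, γ i * X i ^ a := by
  classical
  have key : ∀ m ∈ F.support, ∃ i : Fin r, a ≤ m i := by
    intro m hm
    by_contra! h
    have h1 : ∑ i, m i = D := by
      rw [← Finsupp.degree_eq_sum]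
      exact isHomogeneous_degree_eq hF (mem_support_iff.mp hm)
    have h2 : ∑ i, m i ≤ ∑ _i : Fin r, a := Finset.sum_le_sum fun i _ => (h i).le
    simp at h2
    omega
  rcases F.support.eq_empty_or_nonempty with h0 | ⟨m₀, hm₀⟩
  · exact ⟨0, fun i => isHomogeneous_zero _ _ _, by simp [support_eq_empty.mp h0]⟩
  have : Nonempty (Fin r) := ⟨(key m₀ hm₀).choose⟩
  choose! c hc using key
  refine ⟨fun i => ∑ m ∈ F.support with c m = i,
    monomial (m - Finsupp.single i a) (F.coeff m), fun i => ?_, ?_⟩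
  · refine IsHomogeneous.sum _ _ _ fun m hm => isHomogeneous_monomial _ ?_
    obtain ⟨hm', rfl⟩ := Finset.mem_filter.mp hm
    have h1 := isHomogeneous_degree_eq hF (mem_support_iff.mp hm')
    have h2 : m = (m - Finsupp.single (c m) a) + Finsupp.single (c m) a :=
      (tsub_add_cancel_of_le (Finsupp.single_le_iff.mpr (hc m hm'))).symm
    rw [h2, map_add, Finsupp.degree_single] at h1
    simp only [Finsupp.degree_eq_sum] at h1 ⊢
    omega
  · conv_lhs => rw [F.as_sum]
    simp_rw [Finset.sum_mul]
    rw [← Finset.sum_fiberwise F.support c]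
    refine Finset.sum_congr rfl fun i _ => Finset.sum_congr rfl fun m hm => ?_
    obtain ⟨hm', rfl⟩ := Finset.mem_filter.mp hm
    rw [X_pow_eq_monomial, monomial_mul, mul_one,
      tsub_add_cancel_of_le (Finsupp.single_le_iff.mpr (hc m hm'))]

/-- A subquotient on which a power of each variable is a multiple of one form `ℓ` of positive degree
has no local cohomology above degree one. -/
theorem cohomologyVanishes_of_parameter {Z B : ℤ → AddSubgroup M} (hZ : IsGradedFamily k r Z)
    (hB : IsGradedFamily k r B) {ℓ : 𝔸} {e e' N : ℕ} (hℓ : ℓ.IsHomogeneous e) (he : 1 ≤ e)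
    {β : Fin r → 𝔸} (hβ : ∀ i, (β i).IsHomogeneous e') (hN : e' + e = N)
    (h : ∀ i n, ∀ z ∈ Z n, (X i ^ N - ℓ * β i) • z ∈ B (n + N)) {p j : ℤ} (hp : 2 ≤ p) :
    CohomologyVanishes k r p j Z B := by
  classical
  rcases lt_or_ge (r : ℤ) p with hr | hr
  · exact cohomologyVanishes_of_gt hr Z B
  intro a u hu hdu
  -- Large enough that ℓ^b, of degree eb > ra, lies in the ideal of the T_i^a, where contractions
  -- give a homotopy.
  set b := r * a + 1 with hb
  have hdb : ∀ i, X i ^ N - ℓ * β i ∣ X i ^ (N * b) - ℓ ^ b * β i ^ b := fun i => by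
    rw [pow_mul, ← mul_pow]; exact sub_dvd_pow_sub_pow _ _ _
  have hr1 : 1 ≤ r := by omega
  have hbe : r * a < e * b := by nlinarith
  obtain ⟨δ, hδ⟩ : ∃ δ, δ + a = e * b := ⟨e * b - a, by
    have : a ≤ r * a := Nat.le_mul_of_pos_left a hr1
    omega⟩
  obtain ⟨γ, hγ, hℓγ⟩ := exists_eq_sum_mul_X_pow (hℓ.pow b) hbe hδ
  -- powers of the variables act as multiples of `ℓ ^ b`
  have hpow : ∀ i n, ∀ z ∈ Z n,
      (X i ^ (N * b) : 𝔸) • z - (ℓ ^ b * β i ^ b) • z ∈ B (n + (N * b : ℕ)) := by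
    intro i n z hz
    obtain ⟨q, hq⟩ : X i ^ N - ℓ * β i ∣ X i ^ (N * b) - ℓ ^ b * β i ^ b := hdb i
    have hq' : ∃ q', q'.IsHomogeneous (N * (b - 1)) ∧
        X i ^ (N * b) - ℓ ^ b * β i ^ b = q' * (X i ^ N - ℓ * β i) := by
      refine ⟨∑ s ∈ Finset.range b, (X i ^ N) ^ s * (ℓ * β i) ^ (b - 1 - s), ?_, ?_⟩
      · refine IsHomogeneous.sum _ _ _ fun s hs => ?_
        have hℓβ : (ℓ * β i).IsHomogeneous N := by
          have := hℓ.mul (hβ i)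
          rwa [add_comm, hN] at this
        have hXN : (X i ^ N : 𝔸).IsHomogeneous N := by
          simpa using (isHomogeneous_X k i).pow N
        have := (hXN.pow s).mul (hℓβ.pow (b - 1 - s))
        convert this using 1
        rw [← Nat.mul_add]
        congr 1
        have := Finset.mem_range.mp hs
        omega
      · rw [(Commute.all _ _).geom_sum₂_mul, pow_mul, mul_pow]
    obtain ⟨q', hq'1, hq'2⟩ := hq'
    rw [← sub_smul, hq'2, mul_smul]
    refine hB.smul_mem hq'1 (h i n z hz) ?_
    rw [hb]; push_cast; ring
  -- first step: `ℓ ^ b • u` is a coboundary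
  set v : Finset (Fin r) → M := ∑ i, γ i • contr 𝔸 M i u with hv
  have hvmem : v ∈ koszulCochain Z (p - 1) (j + (e * b : ℕ)) a := by
    refine sum_mem fun i _ => smul_mem_koszulCochain hZ (hγ i)
      (contr_mem hu i (by ring) rfl) ?_
    rw [← hδ]; push_cast; ring
  have hdv : koszulD k r M a v - ℓ ^ b • u ∈ koszulCochain B p (j + (e * b : ℕ)) a := by
    rw [hv, koszulD_sum_contr, ← hℓγ, sub_sub_cancel_left]
    refine neg_mem (sum_mem fun i _ => smul_mem_koszulCochain hB (hγ i)
      (contr_mem hdu i rfl rfl) ?_)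
    rw [← hδ]; push_cast; ring
  -- second step: divide `v` by `ℓ ^ b`
  have hv' : ∀ σ : Finset (Fin r), ∃ x ∈ Z (j + (a + N * b : ℕ) * σ.card),
      ((σ.card : ℤ) ≠ p - 1 → x = 0) ∧
      koszulShift k r M (N * b) v σ - ℓ ^ b • x ∈
        B ((j + (e * b : ℕ)) + (a + N * b : ℕ) * σ.card) := by
    intro σ
    by_cases hσ : (σ.card : ℤ) = p - 1
    -- Here p ≥ 2 is needed: `σ` has p - 1 ≥ 1 elements, so one factor X_i^(Nb) of the shift can be
    -- traded for ℓ^b β_i^b.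
    · obtain ⟨i, hi⟩ : σ.Nonempty := Finset.card_pos.mp (by omega)
      have hP := isHomogeneous_prod_X k (σ.erase i)
      have hc := Finset.card_erase_add_one hi
      refine ⟨((∏ i ∈ σ.erase i, X i) ^ (N * b) * β i ^ b) • v σ, ?_, fun h => absurd hσ h, ?_⟩
      · refine hZ.smul_mem ((hP.pow _).mul ((hβ i).pow _)) (hvmem σ).2 ?_
        rw [← hc, ← hN]; push_cast; ring
      · rw [koszulShift_apply, ← Finset.mul_prod_erase σ _ hi, mul_pow, smul_smul, ← sub_smul]
        have := hB.smul_mem (hP.pow (N * b)) (hpow i _ _ (hvmem σ).2)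
          (m := (j + (e * b : ℕ)) + (a + N * b : ℕ) * σ.card)
          (by rw [← hc]; push_cast; ring)
        convert this using 1
        rw [smul_sub, smul_smul, smul_smul, ← sub_smul]
        ring_nf
    · refine ⟨0, zero_mem _, fun _ => rfl, ?_⟩
      rw [koszulShift_apply, (hvmem σ).1 hσ]
      simp [zero_mem]
  choose v' hv'1 hv'2 hv'3 using hv'
  have hv'mem : v' ∈ koszulCochain Z (p - 1) j (a + N * b) := fun σ => ⟨hv'2 σ, hv'1 σ⟩
  have hvv' : koszulShift k r M (N * b) v - ℓ ^ b • v' ∈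
      koszulCochain B (p - 1) (j + (e * b : ℕ)) (a + N * b) := by
    intro σ
    refine ⟨fun hσ => ?_, hv'3 σ⟩
    simp [koszulShift_apply, (hvmem σ).1 hσ, hv'2 σ hσ]
  -- third step: the difference is killed by `ℓ ^ b`, hence by powers of the variables
  set w := koszulShift k r M (N * b) u - koszulD k r M (a + N * b) v' with hw
  have hwmem : w ∈ koszulCochain Z p j (a + N * b) :=
    sub_mem (koszulShift_mem hZ hu) (koszulD_mem hZ hv'mem (by ring))
  have hℓw : ℓ ^ b • w ∈ koszulCochain B p (j + (e * b : ℕ)) (a + N * b) := by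
    have h1 := koszulShift_mem (b := N * b) hB hdv
    have h2 := koszulD_mem (q := p) hB hvv' (by ring)
    rw [map_sub, koszulD_koszulShift, map_smul] at h2
    rw [map_sub, map_smul] at h1
    have := sub_mem h2 h1
    convert this using 1
    rw [hw, smul_sub]; abel
  refine ⟨N * b + N * b, koszulShift k r M (N * b) v', ?_, ?_⟩
  · rw [← add_assoc]; exact koszulShift_mem hZ hv'mem
  · rw [← add_assoc, koszulD_koszulShift, koszulShift_add, ← map_sub, ← neg_sub, ← hw, map_neg]
    refine neg_mem fun σ => ⟨fun hσ => by rw [koszulShift_apply, (hwmem σ).1 hσ, smul_zero], ?_⟩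
    by_cases hσ : (σ.card : ℤ) = p
    · obtain ⟨i, hi⟩ : σ.Nonempty := Finset.card_pos.mp (by omega)
      have hP := isHomogeneous_prod_X k (σ.erase i)
      have hc := Finset.card_erase_add_one hi
      rw [koszulShift_apply, ← Finset.mul_prod_erase σ _ hi, mul_pow,
        mul_comm (X i ^ (N * b) : 𝔸), mul_smul]
      refine hB.smul_mem (hP.pow (N * b)) (n := (j + (a + N * b : ℕ) * σ.card) + (N * b : ℕ)) ?_
        (by rw [← hc]; push_cast; ring)
      have h1 := hpow i _ _ (hwmem σ).2
      have h2 := hB.smul_mem ((hβ i).pow b) (hℓw σ).2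
        (m := (j + (a + N * b : ℕ) * σ.card) + (N * b : ℕ)) (by rw [← hN]; push_cast; ring)
      have := add_mem h1 h2
      rwa [Pi.smul_apply, smul_smul, mul_comm (β i ^ b), sub_add_cancel] at this
    · rw [koszulShift_apply, (hwmem σ).1 hσ, smul_zero]; exact zero_mem _

end Torsion

/-! ### Local cohomology of modules with division operators -/

section Division

theorem map_koszulSign_smul {M' ι : Type*} [LinearOrder ι] [AddCommGroup M'] [Module 𝔸 M']
    (q : M →+ M') (τ : Finset ι) (i : ι) (x : M) :
    q (koszulSign 𝔸 τ i • x) = koszulSign 𝔸 τ i • q x := by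
  unfold koszulSign
  rcases neg_one_pow_eq_or 𝔸 (τ.filter (· < i)).card with h | h <;> simp [h]

/-- Vanishing of local cohomology of modules with compatible operators of division by the powers of
the variables, such as free modules. -/
theorem cohomologyVanishes_of_division {Z : ℤ → AddSubgroup M} (hZ : IsGradedFamily k r Z)
    (q : ℕ → Fin r → M →+ M) (h₁ : ∀ a l x, q a l ((X l ^ a : 𝔸) • x) = x)
    (h₂ : ∀ a l i x, i ≠ l → q a l ((X i ^ a : 𝔸) • x) = (X i ^ a : 𝔸) • q a l x)
    (h₃ : ∀ a l i x, q a l (q a i x) = q a i (q a l x))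
    (h₄ : ∀ (a : ℕ) l n, ∀ x ∈ Z n, q a l x ∈ Z (n - a)) {p j : ℤ}
    (htop : p < r ∨ ∀ a : ℕ, ∀ x ∈ Z (j + a * r), (∀ l, q a l x = 0) → x = 0) :
    CohomologyVanishes k r p j Z (fun _ => ⊥) := by
  classical
  intro a u hu hdu
  -- Contraction with l after division by X_l^a is a homotopy. It replaces a cocycle by its
  -- remainders modulo X_l^a at the sets containing l, and by zero at all other sets.
  have hcob : ∀ w ∈ koszulCochain Z p j a, koszulD k r M a w = 0 → ∀ l,
      ∃ v ∈ koszulCochain Z (p - 1) j a, koszulD k r M a v =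
        w - fun σ => if l ∈ σ then w σ - (X l ^ a : 𝔸) • q a l (w σ) else 0 := by
    intro w hw hdw l
    set w' : Finset (Fin r) → M := fun σ => q a l (w σ) with hw'
    have hw'm : w' ∈ koszulCochain Z p (j - a) a := fun σ =>
      ⟨fun hσ => by simp [hw', (hw σ).1 hσ], by
        have := h₄ a l _ _ (hw σ).2
        rwa [show j + a * (σ.card : ℤ) - a = j - a + a * σ.card by ring] at this⟩
    refine ⟨contr 𝔸 M l w', contr_mem hw'm l (by ring) (by ring), ?_⟩
    have h := LinearMap.congr_fun (koszulD_mul_contr (k := k) (M := M) a l) w'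
    simp only [Module.End.mul_apply, LinearMap.sub_apply, LinearMap.smul_apply,
      Module.End.one_apply] at h
    rw [h]
    funext σ
    simp only [Pi.sub_apply, Pi.smul_apply, contr_apply]
    split_ifs with hσ
    · simp [hw']
    · have h5 : q a l (koszulD k r M a w (insert l σ)) = 0 := by rw [hdw]; simp
      have h6 : ∀ i ∈ σ, q a l ((X i ^ a : 𝔸) • koszulSign 𝔸 (insert l σ) i •
          w ((insert l σ).erase i)) =
          (X i ^ a : 𝔸) • koszulSign 𝔸 (insert l σ) i • w' ((insert l σ).erase i) := by
        intro i hi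
        rw [h₂ _ _ _ _ (fun h : i = l => hσ (h ▸ hi)), map_koszulSign_smul]
      rw [koszulD_apply, map_sum, Finset.sum_insert hσ, h₁, Finset.erase_insert hσ,
        Finset.sum_congr rfl h6, add_comm] at h5
      rw [koszulD_apply, Finset.sum_insert hσ, Finset.erase_insert hσ, eq_neg_of_add_eq_zero_left h5,
        koszulSign_insert _ _ _ hσ, if_neg (lt_irrefl l), smul_add, smul_neg, smul_smul _ _ (w σ),
        koszulSign_mul_self, one_smul, smul_comm _ (X l ^ a : 𝔸), smul_smul _ _ (w' σ),
        koszulSign_mul_self, one_smul]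
      abel
  -- Different variables do not disturb each other because the division operators commute. With all
  -- variables treated, only the full set carries a nonzero value, all of whose quotients vanish.
  have hiter : ∀ S : Finset (Fin r), ∃ v ∈ koszulCochain Z (p - 1) j a,
      ∃ w ∈ koszulCochain Z p j a, koszulD k r M a v = u - w ∧
        (∀ l ∈ S, ∀ σ, (l ∉ σ → w σ = 0) ∧ q a l (w σ) = 0) := by
    intro S
    induction S using Finset.induction_on with
    | empty => exact ⟨0, zero_mem _, u, hu, by simp, by simp⟩
    | insert l S hl ih =>
      obtain ⟨v, hv, w, hw, hvw, hS⟩ := ih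
      have hdw : koszulD k r M a w = 0 := by
        have h := koszulD_koszulD (k := k) a v
        rw [hvw, map_sub, sub_eq_zero] at h
        rw [← h]
        funext τ
        exact AddSubgroup.mem_bot.mp (hdu τ).2
      obtain ⟨v', hv', hvw'⟩ := hcob w hw hdw l
      refine ⟨v + v', add_mem hv hv', w - koszulD k r M a v',
        sub_mem hw (koszulD_mem hZ hv' (by ring)), by rw [map_add, hvw]; abel, ?_⟩
      rw [hvw', sub_sub_cancel]
      intro i hi σ
      rcases Finset.mem_insert.mp hi with rfl | hi
      · refine ⟨fun h => if_neg h, ?_⟩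
        split_ifs
        · rw [map_sub, h₁, sub_self]
        · exact map_zero _
      · refine ⟨fun h => ?_, ?_⟩
        · rw [(hS i hi σ).1 h, map_zero, smul_zero, sub_zero, ite_self]
        · split_ifs
          · rw [map_sub, h₂ _ _ _ _ (fun h : l = i => hl (h ▸ hi)), h₃, (hS i hi σ).2, map_zero, smul_zero,
              sub_zero]
          · exact map_zero _
  obtain ⟨v, hv, w, hw, hvw, hS⟩ := hiter Finset.univ
  have hw0 : w = 0 := by
    funext σ
    by_cases hσ : σ = Finset.univ
    · subst hσ
      rcases htop with hp | htop
      · exact (hw _).1 (by simp; omega)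
      · refine htop a _ ?_ fun l => (hS l (Finset.mem_univ _) _).2
        have := (hw Finset.univ).2
        rwa [Finset.card_univ, Fintype.card_fin] at this
    · obtain ⟨l, hl⟩ : ∃ l, l ∉ σ := by
        by_contra! h
        exact hσ (Finset.eq_univ_of_forall h)
      exact (hS l (Finset.mem_univ _) σ).1 hl
  refine ⟨0, v, hv, ?_⟩
  rw [koszulShift_zero, add_zero, hvw, hw0, sub_zero, sub_self]
  exact zero_mem _

end Division
end Koszul

/-! ### The total complex of a linear presentation -/

section Pieces

variable {k : Type*} [CommRing k] {r : ℕ}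

variable (k r) in
/-- The polynomials which are homogeneous of degree `n`, where `n` may be negative. -/
def polyPiece (n : ℤ) : AddSubgroup (MvPolynomial (Fin r) k) where
  carrier := {F | ∀ m, F.coeff m ≠ 0 → (m.degree : ℤ) = n}
  zero_mem' := fun m h => absurd (coeff_zero m) h
  add_mem' := fun {F G} hF hG m h => by
    by_cases h1 : F.coeff m = 0
    · refine hG m fun h2 => h ?_
      rw [coeff_add, h1, h2, add_zero]
    · exact hF m h1
  neg_mem' := fun {F} hF m h => hF m fun h1 => h (by rw [coeff_neg, h1, neg_zero])

theorem mem_polyPiece_iff {F : MvPolynomial (Fin r) k} {n : ℕ} :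
    F ∈ polyPiece k r n ↔ F.IsHomogeneous n := by
  constructor
  · intro h m hm
    have := h m hm
    rw [Finsupp.degree_eq_weight_one] at this
    exact_mod_cast this
  · intro h m hm
    rw [isHomogeneous_degree_eq h hm]

theorem polyPiece_of_neg {n : ℤ} (hn : n < 0) {F : MvPolynomial (Fin r) k}
    (hF : F ∈ polyPiece k r n) : F = 0 := by
  ext m
  by_contra h
  rw [coeff_zero] at h
  have := hF m h
  omega

theorem mul_mem_polyPiece {F G : MvPolynomial (Fin r) k} {a b : ℤ} (hF : F ∈ polyPiece k r a)
    (hG : G ∈ polyPiece k r b) : F * G ∈ polyPiece k r (a + b) := by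
  rcases lt_or_ge a 0 with ha | ha
  · rw [polyPiece_of_neg ha hF, zero_mul]; exact zero_mem _
  rcases lt_or_ge b 0 with hb | hb
  · rw [polyPiece_of_neg hb hG, mul_zero]; exact zero_mem _
  lift a to ℕ using ha
  lift b to ℕ using hb
  rw [← Nat.cast_add]
  exact mem_polyPiece_iff.mpr ((mem_polyPiece_iff.mp hF).mul (mem_polyPiece_iff.mp hG))

theorem mul_mem_polyPiece' {F G : MvPolynomial (Fin r) k} {a b c : ℤ} (hF : F ∈ polyPiece k r a)
    (hG : G ∈ polyPiece k r b) (h : a + b = c) : F * G ∈ polyPiece k r c :=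
  h ▸ mul_mem_polyPiece hF hG

theorem koszulSign_mul_mem {k : Type*} [Field k] {r : ℕ} {ι : Type*} [LinearOrder ι] {H : AddSubgroup (MvPolynomial (Fin r) k)}
    {τ : Finset ι} {i : ι} {x : MvPolynomial (Fin r) k} (hx : x ∈ H) :
    koszulSign (MvPolynomial (Fin r) k) τ i * x ∈ H :=
  koszulSign_smul_mem k r H τ i hx

end Pieces

/-- An index set which is the disjoint union of an index set for linear forms and an index set for
variables. -/
structure SumIndex (C : Type*) (h : ℕ) (ι : Type*) where
  /-- the indices of linear forms -/
  c : C → ι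
  /-- the indices of variables -/
  l : Fin h → ι
  c_inj : Function.Injective c
  l_inj : Function.Injective l
  ne : ∀ a b, c a ≠ l b
  cover : ∀ i, (∃ a, c a = i) ∨ ∃ b, l b = i

namespace SumIndex

variable {C ι : Type*} {h : ℕ} [Fintype C] [LinearOrder ι] (I : SumIndex C h ι)

/-- The linear forms in `ρ`. -/
def L (ρ : Finset ι) : Finset C := Finset.univ.filter (I.c · ∈ ρ)

/-- The variables in `ρ`. -/
def R (ρ : Finset ι) : Finset (Fin h) := Finset.univ.filter (I.l · ∈ ρ)

@[simp] theorem mem_L {ρ : Finset ι} {a : C} : a ∈ I.L ρ ↔ I.c a ∈ ρ := by simp [L]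

omit [Fintype C] in
@[simp] theorem mem_R {ρ : Finset ι} {a : Fin h} : a ∈ I.R ρ ↔ I.l a ∈ ρ := by simp [R]

@[simp] theorem L_insert_l (ρ : Finset ι) (a : Fin h) : I.L (insert (I.l a) ρ) = I.L ρ := by
  ext; simp [I.ne]

omit [Fintype C] in
@[simp] theorem R_insert_c (ρ : Finset ι) (a : C) : I.R (insert (I.c a) ρ) = I.R ρ := by
  ext; simp [(I.ne _ _).symm]

@[simp] theorem L_erase_l (ρ : Finset ι) (a : Fin h) : I.L (ρ.erase (I.l a)) = I.L ρ := by
  ext; simp [I.ne]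

omit [Fintype C] in
@[simp] theorem R_erase_c (ρ : Finset ι) (a : C) : I.R (ρ.erase (I.c a)) = I.R ρ := by
  ext; simp [(I.ne _ _).symm]

theorem card_L_insert {ρ : Finset ι} {a : C} (ha : I.c a ∉ ρ) :
    (I.L (insert (I.c a) ρ)).card = (I.L ρ).card + 1 := by
  classical
  rw [← Finset.card_insert_of_notMem (s := I.L ρ) (a := a) (by simpa using ha)]
  congr 1
  ext; simp [I.c_inj.eq_iff]

omit [Fintype C] in
theorem card_R_insert {ρ : Finset ι} {a : Fin h} (ha : I.l a ∉ ρ) :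
    (I.R (insert (I.l a) ρ)).card = (I.R ρ).card + 1 := by
  rw [← Finset.card_insert_of_notMem (s := I.R ρ) (a := a) (by simpa using ha)]
  congr 1
  ext; simp [I.l_inj.eq_iff]

theorem card_L_erase {ρ : Finset ι} {a : C} (ha : I.c a ∈ ρ) :
    (I.L (ρ.erase (I.c a))).card + 1 = (I.L ρ).card := by
  rw [← I.card_L_insert (Finset.notMem_erase _ _), Finset.insert_erase ha]

omit [Fintype C] in
theorem card_R_erase {ρ : Finset ι} {a : Fin h} (ha : I.l a ∈ ρ) :
    (I.R (ρ.erase (I.l a))).card + 1 = (I.R ρ).card := by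
  rw [← I.card_R_insert (Finset.notMem_erase _ _), Finset.insert_erase ha]

theorem eq_empty {ρ : Finset ι} (hL : (I.L ρ).card = 0) (hR : (I.R ρ).card = 0) : ρ = ∅ := by
  rw [Finset.card_eq_zero] at hL hR
  refine Finset.eq_empty_of_forall_notMem fun i hi => ?_
  rcases I.cover i with ⟨a, rfl⟩ | ⟨a, rfl⟩
  · have : a ∈ I.L ρ := by simpa using hi
    simp [hL] at this
  · have : a ∈ I.R ρ := by simpa using hi
    simp [hR] at this

omit [Fintype C] in
theorem card_R_le (ρ : Finset ι) : (I.R ρ).card ≤ h := by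
  simpa using (I.R ρ).card_le_univ

end SumIndex

/-! ### Operators on the Koszul–Čech bicomplex -/

section TotalComplex

variable {k : Type*} [Field k] {r : ℕ}

local notation "𝔸" => MvPolynomial (Fin r) k

variable {C ι : Type*} {h : ℕ} [Fintype C] [LinearOrder ι] (I : SumIndex C h ι)
  (κ : C → Fin h → MvPolynomial (Fin r) k)

variable (k r h) in
/-- Laurent series in `w_1, …, w_h` with coefficients in `A`. -/
abbrev Laurent : Type _ := (Fin h → ℤ) → MvPolynomial (Fin r) k

variable (k r) in
/-- Multiplication by the variable `w_l`. -/
def mulVar (l : Fin h) : Module.End 𝔸 (Laurent k r h) :=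
  LinearMap.funLeft _ _ fun α => α - Pi.single l 1

variable (k r) in
/-- Division by the variable `w_l`. -/
def divVar (l : Fin h) : Module.End 𝔸 (Laurent k r h) :=
  LinearMap.funLeft _ _ fun α => α + Pi.single l 1

variable (k r) in
/-- The part of exponents which are nonnegative at `l`. -/
def nonnegPart (l : Fin h) : Module.End 𝔸 (Laurent k r h) where
  toFun F α := if 0 ≤ α l then F α else 0
  map_add' F G := by funext α; simp only [Pi.add_apply]; split_ifs <;> simp
  map_smul' a F := by funext α; simp only [Pi.smul_apply, RingHom.id_apply]; split_ifs <;> simp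

theorem mulVar_apply (l : Fin h) (F : Laurent k r h) (α) :
    mulVar k r l F α = F (α - Pi.single l 1) := rfl

theorem divVar_apply (l : Fin h) (F : Laurent k r h) (α) :
    divVar k r l F α = F (α + Pi.single l 1) := rfl

theorem nonnegPart_apply (l : Fin h) (F : Laurent k r h) (α) :
    nonnegPart k r l F α = if 0 ≤ α l then F α else 0 := rfl

theorem mulVar_mul_divVar (l : Fin h) : mulVar k r l * divVar k r l = 1 := by
  refine LinearMap.ext fun F => funext fun α => ?_
  simp [mulVar_apply, divVar_apply]

theorem mulVar_comm (l l' : Fin h) : mulVar k r l * mulVar k r l' = mulVar k r l' * mulVar k r l := by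
  refine LinearMap.ext fun F => funext fun α => ?_
  simp only [Module.End.mul_apply, mulVar_apply]
  congr 1
  abel

theorem mulVar_comm_divVar (l l' : Fin h) :
    mulVar k r l * divVar k r l' = divVar k r l' * mulVar k r l := by
  refine LinearMap.ext fun F => funext fun α => ?_
  simp only [Module.End.mul_apply, mulVar_apply, divVar_apply]
  congr 1
  abel

/-- Multiplication by the linear form `∑ l, v l * w_l`. -/
def mulForm (v : Fin h → 𝔸) : Module.End 𝔸 (Laurent k r h) := ∑ l, v l • mulVar k r l

theorem mulForm_apply (v : Fin h → 𝔸) (F : Laurent k r h) (α) :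
    mulForm v F α = ∑ l, v l * F (α - Pi.single l 1) := by
  simp [mulForm, mulVar_apply]

theorem mulForm_comm (v v' : Fin h → 𝔸) : mulForm v * mulForm v' = mulForm v' * mulForm v := by
  simp only [mulForm, Finset.sum_mul, Finset.mul_sum, smul_mul_smul_comm]
  rw [Finset.sum_comm]
  refine Finset.sum_congr rfl fun i _ => Finset.sum_congr rfl fun j _ => ?_
  rw [mulVar_comm, mul_comm]

theorem mulForm_comm_divVar (v : Fin h → 𝔸) (l : Fin h) :
    mulForm v * divVar k r l = divVar k r l * mulForm v := by
  simp only [mulForm, Finset.sum_mul, Finset.mul_sum, smul_mul_assoc, mul_smul_comm,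
    mulVar_comm_divVar]

/-- The modules of cochains of the Koszul–Čech bicomplex. -/
abbrev Bicochain (k : Type*) [Field k] (r h : ℕ) (ι : Type*) : Type _ := Finset ι → Laurent k r h

/-- The Koszul differential. -/
def diffK : Module.End 𝔸 (Bicochain k r h ι) :=
  ∑ c, contr 𝔸 (Laurent k r h) (I.c c) * pointwise ι (mulForm (κ c))

variable (k r) in
/-- The Čech differential with respect to `w_1, …, w_h`. -/
def diffC : Module.End 𝔸 (Bicochain k r h ι) :=
  ∑ l, wedge 𝔸 (Laurent k r h) (I.l l)

/-- The total differential. -/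
def diffT : Module.End 𝔸 (Bicochain k r h ι) := diffK I κ + diffC k r I

theorem sum_mul_sum_eq_zero {R κ : Type*} [Ring R] [Fintype κ] (a : κ → R)
    (h1 : ∀ i j, a i * a j = - (a j * a i)) (h2 : ∀ i, a i * a i = 0) :
    (∑ i, a i) * ∑ i, a i = 0 := by
  classical
  simp only [Finset.sum_mul, Finset.mul_sum]
  rw [← Finset.sum_product']
  refine Finset.sum_involution (fun x _ => (x.2, x.1)) ?_ ?_ ?_ ?_
  · rintro ⟨i, j⟩ -
    rw [h1, neg_add_cancel]
  · rintro ⟨i, j⟩ - h e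
    simp only [Prod.mk.injEq] at e
    rw [e.1, h2] at h
    exact h rfl
  · simp
  · simp

theorem contr_pointwise_mul (i j : ι) (f g : Module.End 𝔸 (Laurent k r h)) :
    contr 𝔸 (Laurent k r h) i * pointwise ι f * (contr 𝔸 (Laurent k r h) j * pointwise ι g) =
      contr 𝔸 (Laurent k r h) i * contr 𝔸 (Laurent k r h) j * pointwise ι (f * g) := by
  rw [pointwise_mul, mul_assoc, ← mul_assoc (pointwise ι f), ← contr_mul_pointwise]
  simp only [mul_assoc]

theorem diffK_mul_self : diffK I κ * diffK I κ = 0 := by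
  refine sum_mul_sum_eq_zero _ (fun i j => ?_) fun i => ?_
  · rw [contr_pointwise_mul, contr_pointwise_mul, contr_mul_contr, mulForm_comm]
    exact neg_mul (α := Module.End 𝔸 (Bicochain k r h ι)) _ _
  · rw [contr_pointwise_mul, contr_mul_self, zero_mul]

omit [Fintype C] in
theorem diffC_mul_self : diffC k r I * diffC k r I = 0 :=
  sum_mul_sum_eq_zero _ (fun _ _ => wedge_mul_wedge _ _) fun _ => wedge_mul_self _

theorem diffC_mul_diffK : diffC k r I * diffK I κ = - (diffK I κ * diffC k r I) := by
  simp only [diffC, diffK, Finset.sum_mul, Finset.mul_sum]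
  rw [Finset.sum_comm, ← Finset.sum_neg_distrib]
  refine Finset.sum_congr rfl fun l _ => ?_
  rw [← Finset.sum_neg_distrib]
  refine Finset.sum_congr rfl fun c _ => ?_
  rw [← mul_assoc, wedge_mul_contr_of_ne (I.ne c l).symm, mul_assoc (contr 𝔸 (Laurent k r h) (I.c c)),
    ← wedge_mul_pointwise, ← mul_assoc]
  exact neg_mul (α := Module.End 𝔸 (Bicochain k r h ι)) _ _

theorem diffT_mul_self : diffT I κ * diffT I κ = 0 := by
  simp only [diffT, mul_add, add_mul, diffK_mul_self, diffC_mul_self, diffC_mul_diffK]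
  simp

theorem diffT_diffT (u : Bicochain k r h ι) : diffT I κ (diffT I κ u) = 0 :=
  LinearMap.congr_fun (diffT_mul_self I κ) u

/-- The cochains of degree `j` which are supported on the pairs described by `P`. -/
def supportedCochain (P : Finset ι → (Fin h → ℤ) → Prop) (j : ℤ) :
    AddSubgroup (Bicochain k r h ι) where
  carrier := {u | ∀ ρ α, (u ρ α ≠ 0 → P ρ α) ∧ u ρ α ∈ polyPiece k r (j - (I.L ρ).card)}
  zero_mem' := fun _ _ => ⟨fun h => absurd rfl h, zero_mem _⟩
  add_mem' := fun {u v} hu hv ρ α => ⟨fun h => by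
    by_cases h1 : u ρ α = 0
    · refine (hv ρ α).1 fun h2 => h ?_
      rw [Pi.add_apply, Pi.add_apply, h1, h2, add_zero]
    · exact (hu ρ α).1 h1, add_mem (hu ρ α).2 (hv ρ α).2⟩
  neg_mem' := fun {u} hu ρ α => ⟨fun h => (hu ρ α).1 fun h1 => h (by
    rw [Pi.neg_apply, Pi.neg_apply, h1, neg_zero]), neg_mem (hu ρ α).2⟩

variable {I κ}
variable {P Q : Finset ι → (Fin h → ℤ) → Prop} {j : ℤ} {u : Bicochain k r h ι}

theorem supportedCochain_mono (hPQ : ∀ ρ α, P ρ α → Q ρ α) :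
    supportedCochain (k := k) (r := r) I P j ≤ supportedCochain I Q j :=
  fun _ hu ρ α => ⟨fun h => hPQ _ _ ((hu ρ α).1 h), (hu ρ α).2⟩

theorem supportedCochain_graded (P : Finset ι → (Fin h → ℤ) → Prop) :
    IsGradedFamily k r (supportedCochain (k := k) (r := r) I P) := by
  intro F e n x hF hx ρ α
  refine ⟨fun h => (hx ρ α).1 fun h1 => h ?_, ?_⟩
  · rw [Pi.smul_apply, Pi.smul_apply, h1, smul_zero]
  · exact mul_mem_polyPiece' (mem_polyPiece_iff.mpr hF) (hx ρ α).2 (by ring)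

theorem smul_mem_supportedCochain {F : MvPolynomial (Fin r) k} {n j' : ℤ}
    (hF : F ∈ polyPiece k r n) (hu : u ∈ supportedCochain I P j) (hj : n + j = j') :
    F • u ∈ supportedCochain I P j' := by
  intro ρ α
  refine ⟨fun h => (hu ρ α).1 fun h1 => h ?_, ?_⟩
  · rw [Pi.smul_apply, Pi.smul_apply, h1, smul_zero]
  · exact mul_mem_polyPiece' hF (hu ρ α).2 (by rw [← hj]; ring)

theorem wedge_l_mem (hu : u ∈ supportedCochain I P j) (l : Fin h)
    (hPQ : ∀ ρ α, I.l l ∈ ρ → P (ρ.erase (I.l l)) α → Q ρ α) :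
    wedge 𝔸 (Laurent k r h) (I.l l) u ∈ supportedCochain I Q j := by
  intro ρ α
  rw [wedge_apply]
  split_ifs with hρ
  · refine ⟨fun h => hPQ ρ α hρ ((hu _ α).1 fun h1 => h ?_), ?_⟩
    · rw [Pi.smul_apply, h1, smul_zero]
    · have := (hu (ρ.erase (I.l l)) α).2
      rw [I.L_erase_l] at this
      exact koszulSign_mul_mem this
  · exact ⟨fun h => absurd rfl h, zero_mem _⟩

theorem wedge_c_mem (hu : u ∈ supportedCochain I P j) (c : C)
    (hPQ : ∀ ρ α, I.c c ∈ ρ → P (ρ.erase (I.c c)) α → Q ρ α) :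
    wedge 𝔸 (Laurent k r h) (I.c c) u ∈ supportedCochain I Q (j + 1) := by
  intro ρ α
  rw [wedge_apply]
  split_ifs with hρ
  · refine ⟨fun h => hPQ ρ α hρ ((hu _ α).1 fun h1 => h ?_), ?_⟩
    · rw [Pi.smul_apply, h1, smul_zero]
    · have := (hu (ρ.erase (I.c c)) α).2
      have h2 := I.card_L_erase hρ
      rw [show j - ((I.L (ρ.erase (I.c c))).card : ℤ) = j + 1 - (I.L ρ).card by
        rw [← h2]; push_cast; ring] at this
      exact koszulSign_mul_mem this
  · exact ⟨fun h => absurd rfl h, zero_mem _⟩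

theorem contr_l_mem (hu : u ∈ supportedCochain I P j) (l : Fin h)
    (hPQ : ∀ ρ α, I.l l ∉ ρ → P (insert (I.l l) ρ) α → Q ρ α) :
    contr 𝔸 (Laurent k r h) (I.l l) u ∈ supportedCochain I Q j := by
  intro ρ α
  rw [contr_apply]
  split_ifs with hρ
  · exact ⟨fun h => absurd rfl h, zero_mem _⟩
  · refine ⟨fun h => hPQ ρ α hρ ((hu _ α).1 fun h1 => h ?_), ?_⟩
    · rw [Pi.smul_apply, h1, smul_zero]
    · have := (hu (insert (I.l l) ρ) α).2
      rw [I.L_insert_l] at this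
      exact koszulSign_mul_mem this

theorem contr_c_mem (hu : u ∈ supportedCochain I P j) (c : C)
    (hPQ : ∀ ρ α, I.c c ∉ ρ → P (insert (I.c c) ρ) α → Q ρ α) :
    contr 𝔸 (Laurent k r h) (I.c c) u ∈ supportedCochain I Q (j - 1) := by
  intro ρ α
  rw [contr_apply]
  split_ifs with hρ
  · exact ⟨fun h => absurd rfl h, zero_mem _⟩
  · refine ⟨fun h => hPQ ρ α hρ ((hu _ α).1 fun h1 => h ?_), ?_⟩
    · rw [Pi.smul_apply, h1, smul_zero]
    · have := (hu (insert (I.c c) ρ) α).2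
      rw [I.card_L_insert hρ, show j - (((I.L ρ).card + 1 : ℕ) : ℤ) = j - 1 - (I.L ρ).card by
        push_cast; ring] at this
      exact koszulSign_mul_mem this

theorem mulForm_mem {v : Fin h → 𝔸} (hv : ∀ l, v l ∈ polyPiece k r 1)
    (hu : u ∈ supportedCochain I P j)
    (hPQ : ∀ ρ α l, P ρ (α - Pi.single l 1) → Q ρ α) :
    pointwise ι (mulForm v) u ∈ supportedCochain I Q (j + 1) := by
  intro ρ α
  rw [pointwise_apply, mulForm_apply]
  refine ⟨fun h => ?_, sum_mem fun l _ => mul_mem_polyPiece' (hv l) (hu _ _).2 (by ring)⟩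
  obtain ⟨l, -, hl⟩ := Finset.exists_ne_zero_of_sum_ne_zero h
  exact hPQ ρ α l ((hu _ _).1 (right_ne_zero_of_mul hl))

theorem divVar_mem (hu : u ∈ supportedCochain I P j) (l : Fin h)
    (hPQ : ∀ ρ α, P ρ (α + Pi.single l 1) → Q ρ α) :
    pointwise ι (divVar k r l) u ∈ supportedCochain I Q j :=
  fun ρ _ => ⟨fun h => hPQ _ _ ((hu ρ _).1 h), (hu ρ _).2⟩

theorem nonnegPart_mem (hu : u ∈ supportedCochain I P j) (l : Fin h) :
    pointwise ι (nonnegPart k r l) u ∈ supportedCochain I (fun ρ α => P ρ α ∧ 0 ≤ α l) j := by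
  intro ρ α
  rw [pointwise_apply, nonnegPart_apply]
  split_ifs with h0
  · exact ⟨fun h => ⟨(hu ρ α).1 h, h0⟩, (hu ρ α).2⟩
  · exact ⟨fun h => absurd rfl h, zero_mem _⟩

end TotalComplex

/-! ### The total complex in w-degree one and the torsion of its cohomology -/

section TotalComplex

variable {k : Type*} [Field k] {r : ℕ}

local notation "𝔸" => MvPolynomial (Fin r) k

variable {C ι : Type*} {h : ℕ} [Fintype C] [LinearOrder ι] (I : SumIndex C h ι)
  (κ : C → Fin h → MvPolynomial (Fin r) k)

/-- The bigraded pieces which occur in the total complex in degree `n`, where in addition one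
of the variables from the `i`-th on is inverted. -/
def totalSupport (n : ℤ) (i : ℕ) (ρ : Finset ι) (α : Fin h → ℤ) : Prop :=
  (∀ l, α l < 0 → l ∈ I.R ρ) ∧ ∑ l, α l = 1 - (I.L ρ).card ∧
    ((I.R ρ).card : ℤ) - 1 - (I.L ρ).card = n ∧ ∃ l ∈ I.R ρ, i ≤ l

/-- The pieces of bidegree `(q, s)` of the augmented bicomplex. -/
def bidegreeSupport (q s : ℤ) (ρ : Finset ι) (α : Fin h → ℤ) : Prop :=
  (∀ l, α l < 0 → l ∈ I.R ρ) ∧ ∑ l, α l = 1 - (I.L ρ).card ∧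
    ((I.R ρ).card : ℤ) = q ∧ ((I.L ρ).card : ℤ) = s

variable (k r) in
/-- The total complex. -/
abbrev totalCochain (n j : ℤ) : AddSubgroup (Bicochain k r h ι) :=
  supportedCochain I (totalSupport I n 0) j

/-- The cocycles of the total complex. -/
def totalCocycle (n j : ℤ) : AddSubgroup (Bicochain k r h ι) :=
  totalCochain k r I n j ⊓ (diffT I κ).toAddMonoidHom.ker

/-- The images of the `n`-cochains of the total complex. -/
def totalImage (n j : ℤ) : AddSubgroup (Bicochain k r h ι) :=
  (totalCochain k r I n j).map (diffT I κ).toAddMonoidHom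

variable {I κ}
variable {j n : ℤ} {i : ℕ} {u : Bicochain k r h ι}

theorem sum_sub_single (α : Fin h → ℤ) (l : Fin h) :
    ∑ l', (α - Pi.single l 1 : Fin h → ℤ) l' = ∑ l', α l' - 1 := by
  simp [Finset.sum_sub_distrib]

theorem sum_add_single (α : Fin h → ℤ) (l : Fin h) :
    ∑ l', (α + Pi.single l 1 : Fin h → ℤ) l' = ∑ l', α l' + 1 := by
  simp [Finset.sum_add_distrib]

theorem sub_single_neg {α : Fin h → ℤ} (l : Fin h) {l' : Fin h} (hl : α l' < 0) :
    (α - Pi.single l 1 : Fin h → ℤ) l' < 0 := by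
  rw [Pi.sub_apply]
  by_cases e : l' = l
  · subst e; simp; omega
  · simp [e, hl]

theorem diffC_mem {P Q : Finset ι → (Fin h → ℤ) → Prop} (hu : u ∈ supportedCochain I P j)
    (hPQ : ∀ ρ α l, I.l l ∈ ρ → P (ρ.erase (I.l l)) α → Q ρ α) :
    diffC k r I u ∈ supportedCochain I Q j := by
  rw [diffC, LinearMap.sum_apply]
  exact sum_mem fun l _ => wedge_l_mem hu l fun ρ α => hPQ ρ α l

theorem diffK_mem (hκ : ∀ c l, κ c l ∈ polyPiece k r 1) {P Q : Finset ι → (Fin h → ℤ) → Prop}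
    (hu : u ∈ supportedCochain I P j)
    (hPQ : ∀ ρ α c l, I.c c ∉ ρ → P (insert (I.c c) ρ) (α - Pi.single l 1) → Q ρ α) :
    diffK I κ u ∈ supportedCochain I Q j := by
  rw [diffK, LinearMap.sum_apply]
  refine sum_mem fun c _ => ?_
  have := contr_c_mem (Q := Q) (mulForm_mem (Q := fun ρ α => ∃ l, P ρ (α - Pi.single l 1)) (hκ c) hu
    fun ρ α l h => ⟨l, h⟩) c fun ρ α hρ h => by
      obtain ⟨l, hl⟩ := h
      exact hPQ ρ α c l hρ hl
  rwa [add_sub_cancel_right] at this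

theorem totalSupport_of_erase_l {ρ : Finset ι} {α : Fin h → ℤ} {l : Fin h} (hl : I.l l ∈ ρ)
    (H : totalSupport I n i (ρ.erase (I.l l)) α) : totalSupport I (n + 1) i ρ α := by
  obtain ⟨h1, h2, h3, l', h4, h5⟩ := H
  rw [I.L_erase_l] at h2 h3
  have := I.card_R_erase hl
  have hR : ∀ l', l' ∈ I.R (ρ.erase (I.l l)) → l' ∈ I.R ρ := fun l' h => by
    rw [I.mem_R] at h ⊢; exact Finset.mem_of_mem_erase h
  exact ⟨fun l' h => hR _ (h1 l' h), h2, by omega, l', hR _ h4, h5⟩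

theorem totalSupport_of_insert_c {ρ : Finset ι} {α : Fin h → ℤ} {c : C} {l : Fin h} (hc : I.c c ∉ ρ)
    (H : totalSupport I n i (insert (I.c c) ρ) (α - Pi.single l 1)) :
    totalSupport I (n + 1) i ρ α := by
  obtain ⟨h1, h2, h3, l', h4, h5⟩ := H
  rw [I.R_insert_c] at h1 h3 h4
  rw [I.card_L_insert hc] at h2 h3
  rw [sum_sub_single] at h2
  exact ⟨fun l' hl => h1 l' (sub_single_neg l hl), by push_cast at h2; omega, by
    push_cast at h3; omega, l', h4, h5⟩

theorem diffT_mem (hκ : ∀ c l, κ c l ∈ polyPiece k r 1)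
    (hu : u ∈ supportedCochain I (totalSupport I n i) j) :
    diffT I κ u ∈ supportedCochain I (totalSupport I (n + 1) i) j :=
  add_mem (diffK_mem hκ hu fun _ _ _ _ => totalSupport_of_insert_c)
    (diffC_mem hu fun _ _ _ => totalSupport_of_erase_l)

variable (I) in
/-- The homotopy for the multiplication by a relation `a` which is a multiple of the `l`-th unit
vector. -/
def relHomotopy (a : C → 𝔸) (l : Fin h) : Module.End 𝔸 (Bicochain k r h ι) :=
  (∑ c, a c • wedge 𝔸 (Laurent k r h) (I.c c)) * pointwise ι (divVar k r l)

theorem anticommutator_sum {A E X Y : Type*} [CommSemiring A] [Ring E] [Algebra A E] [Fintype X]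
    [Fintype Y] (x : X → E) (a : Y → A) (y : Y → E) (z : X → Y → E)
    (h : ∀ i j, x i * y j + y j * x i = z i j) :
    (∑ i, x i) * (∑ j, a j • y j) + (∑ j, a j • y j) * ∑ i, x i = ∑ j, a j • ∑ i, z i j := by
  simp only [Finset.sum_mul, Finset.mul_sum, ← h, smul_mul_assoc, mul_smul_comm,
    Finset.sum_add_distrib, smul_add, Finset.smul_sum]
  congr 1
  exact Finset.sum_comm

theorem mul_mul_comm_of_anticomm {E : Type*} [Ring E] {w x c f : E} (hxc : x * c = -(c * x))
    (hwc : w * c = -(c * w)) (hxf : x * f = f * x) (hwf : w * f = f * w) :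
    w * x * (c * f) = c * f * (w * x) := by
  have e1 : w * x * (c * f) = w * (x * c) * f := by simp only [mul_assoc]
  have e2 : c * f * (w * x) = c * (f * w) * x := by simp only [mul_assoc]
  rw [e1, e2, ← hwf, hxc, mul_neg, neg_mul, ← mul_assoc, hwc, neg_mul, neg_mul, neg_neg, mul_assoc,
    hxf]
  simp only [mul_assoc]

theorem mul_mul_eq_of_anticomm {E : Type*} [Ring E] {w x c d : E} (hxc : x * c = d - c * x)
    (hwc : w * c = -(c * w)) : w * x * c = c * (w * x) + w * d := by
  rw [mul_assoc, hxc, mul_sub, ← mul_assoc, hwc, neg_mul, sub_neg_eq_add, mul_assoc, add_comm]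

variable (I) in
theorem relHomotopy_eq (a : C → 𝔸) (l : Fin h) : relHomotopy I a l =
    ∑ c, a c • (wedge 𝔸 (Laurent k r h) (I.c c) * pointwise ι (divVar k r l)) := by
  simp only [relHomotopy, Finset.sum_mul, smul_mul_assoc]

/-- The relation says that ∑ a_c κ_c is the linear form g w_l. After division by w_l the vector a
pairs with the linear forms to g, and exterior multiplication by it is the usual Koszul homotopy. -/
theorem diffK_relHomotopy {a : C → 𝔸} {l : Fin h} {g : 𝔸}
    (hag : ∀ l', ∑ c, a c * κ c l' = if l' = l then g else 0) :
    diffK I κ * relHomotopy I a l + relHomotopy I a l * diffK I κ = g • 1 := by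
  classical
  have key : ∀ c c', contr 𝔸 (Laurent k r h) (I.c c) * pointwise ι (mulForm (κ c)) *
      (wedge 𝔸 (Laurent k r h) (I.c c') * pointwise ι (divVar k r l)) +
      wedge 𝔸 (Laurent k r h) (I.c c') * pointwise ι (divVar k r l) *
        (contr 𝔸 (Laurent k r h) (I.c c) * pointwise ι (mulForm (κ c))) =
      if c' = c then pointwise ι (mulForm (κ c) * divVar k r l) else 0 := by
    intro c c'
    have e1 : contr 𝔸 (Laurent k r h) (I.c c) * pointwise ι (mulForm (κ c)) *
      (wedge 𝔸 (Laurent k r h) (I.c c') * pointwise ι (divVar k r l)) =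
      contr 𝔸 (Laurent k r h) (I.c c) * wedge 𝔸 (Laurent k r h) (I.c c') *
        pointwise ι (mulForm (κ c) * divVar k r l) := by
      rw [pointwise_mul, mul_assoc, ← mul_assoc (pointwise ι _), ← wedge_mul_pointwise]
      simp only [mul_assoc]
    have e2 : wedge 𝔸 (Laurent k r h) (I.c c') * pointwise ι (divVar k r l) *
        (contr 𝔸 (Laurent k r h) (I.c c) * pointwise ι (mulForm (κ c))) =
        wedge 𝔸 (Laurent k r h) (I.c c') * contr 𝔸 (Laurent k r h) (I.c c) *
        pointwise ι (mulForm (κ c) * divVar k r l) := by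
      rw [mulForm_comm_divVar, pointwise_mul, mul_assoc, ← mul_assoc (pointwise ι _),
        ← contr_mul_pointwise]
      simp only [mul_assoc]
    rw [e1, e2, ← add_mul, wedge_mul_contr, add_sub_cancel]
    simp only [I.c_inj.eq_iff]
    split_ifs <;> simp
  have e : ∑ c, a c • mulForm (κ c) = g • mulVar k r l := by
    simp only [mulForm, Finset.smul_sum, smul_smul]
    rw [Finset.sum_comm]
    simp only [← Finset.sum_smul, hag, ite_smul, zero_smul, Finset.sum_ite_eq', Finset.mem_univ,
      if_true]
  have e' : ∑ c, a c • pointwise ι (mulForm (κ c) * divVar k r l) = g • 1 := by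
    have : ∑ c, a c • pointwise ι (mulForm (κ c) * divVar k r l) =
        pointwise ι ((∑ c, a c • mulForm (κ c)) * divVar k r l) := by
      refine LinearMap.ext fun u => funext fun σ => ?_
      simp [LinearMap.sum_apply, Finset.sum_apply, pointwise_apply]
    rw [this, e, smul_mul_assoc, mulVar_mul_divVar]
    rfl
  rw [← e', relHomotopy_eq, diffK, anticommutator_sum _ _ _ _ key]
  simp only [Finset.sum_ite_eq, Finset.mem_univ, if_true]

theorem diffC_relHomotopy (a : C → 𝔸) (l : Fin h) :
    diffC k r I * relHomotopy I a l + relHomotopy I a l * diffC k r I = 0 := by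
  have key : ∀ l' c, wedge 𝔸 (Laurent k r h) (I.l l') *
      (wedge 𝔸 (Laurent k r h) (I.c c) * pointwise ι (divVar k r l)) +
      wedge 𝔸 (Laurent k r h) (I.c c) * pointwise ι (divVar k r l) *
        wedge 𝔸 (Laurent k r h) (I.l l') = 0 := by
    intro l' c
    rw [mul_assoc, ← wedge_mul_pointwise, ← mul_assoc, ← mul_assoc, ← add_mul,
      wedge_mul_wedge, neg_add_cancel, zero_mul]
  rw [relHomotopy_eq, diffC, anticommutator_sum _ _ _ _ key]
  simp

theorem diffT_relHomotopy {a : C → 𝔸} {l : Fin h} {g : 𝔸}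
    (hag : ∀ l', ∑ c, a c * κ c l' = if l' = l then g else 0) :
    diffT I κ * relHomotopy I a l + relHomotopy I a l * diffT I κ = g • 1 := by
  rw [diffT, add_mul, mul_add, ← diffK_relHomotopy hag, add_add_add_comm, diffC_relHomotopy,
    add_zero]

theorem proj_mul_contr {l i : ι} (hl : l ≠ i) {f : Module.End 𝔸 (Laurent k r h)} :
    wedge 𝔸 (Laurent k r h) l * contr 𝔸 (Laurent k r h) l *
      (contr 𝔸 (Laurent k r h) i * pointwise ι f) = contr 𝔸 (Laurent k r h) i * pointwise ι f *
      (wedge 𝔸 (Laurent k r h) l * contr 𝔸 (Laurent k r h) l) := 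
  mul_mul_comm_of_anticomm (contr_mul_contr _ _) (wedge_mul_contr_of_ne hl)
    (contr_mul_pointwise _ _) (wedge_mul_pointwise _ _)

theorem proj_mul_wedge (l i : ι) :
    wedge 𝔸 (Laurent k r h) l * contr 𝔸 (Laurent k r h) l * wedge 𝔸 (Laurent k r h) i =
      wedge 𝔸 (Laurent k r h) i * (wedge 𝔸 (Laurent k r h) l * contr 𝔸 (Laurent k r h) l) +
        if i = l then wedge 𝔸 (Laurent k r h) l else 0 := by
  have e : contr 𝔸 (Laurent k r h) l * wedge 𝔸 (Laurent k r h) i =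
      (if i = l then 1 else 0) - wedge 𝔸 (Laurent k r h) i * contr 𝔸 (Laurent k r h) l := by
    rw [wedge_mul_contr, sub_sub_cancel]
  rw [mul_mul_eq_of_anticomm e (wedge_mul_wedge _ _)]
  split_ifs <;> simp

/-- Wedge after contraction projects onto the part where w_l is inverted. Among the terms of the
total differential, only the wedge with l enters that part from outside. -/
theorem proj_mul_diffT (l : Fin h) :
    wedge 𝔸 (Laurent k r h) (I.l l) * contr 𝔸 (Laurent k r h) (I.l l) * diffT I κ =
      diffT I κ * (wedge 𝔸 (Laurent k r h) (I.l l) * contr 𝔸 (Laurent k r h) (I.l l)) +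
        wedge 𝔸 (Laurent k r h) (I.l l) := by
  have h1 : wedge 𝔸 (Laurent k r h) (I.l l) * contr 𝔸 (Laurent k r h) (I.l l) * diffK I κ =
      diffK I κ * (wedge 𝔸 (Laurent k r h) (I.l l) * contr 𝔸 (Laurent k r h) (I.l l)) := by
    rw [diffK, Finset.mul_sum, Finset.sum_mul]
    exact Finset.sum_congr rfl fun c _ => proj_mul_contr (I.ne c l).symm
  have h2 : wedge 𝔸 (Laurent k r h) (I.l l) * contr 𝔸 (Laurent k r h) (I.l l) * diffC k r I =
      diffC k r I * (wedge 𝔸 (Laurent k r h) (I.l l) * contr 𝔸 (Laurent k r h) (I.l l)) +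
        wedge 𝔸 (Laurent k r h) (I.l l) := by
    rw [diffC, Finset.mul_sum, Finset.sum_mul]
    simp only [proj_mul_wedge, Finset.sum_add_distrib, I.l_inj.eq_iff]
    simp
  rw [diffT, mul_add, add_mul, h1, h2, add_assoc]

theorem relHomotopy_mem {a : C → 𝔸} {N : ℤ} (ha : ∀ c, a c ∈ polyPiece k r (N - 1)) (l : Fin h)
    {P Q : Finset ι → (Fin h → ℤ) → Prop} (hu : u ∈ supportedCochain I P j)
    (hPQ : ∀ ρ α c, I.c c ∈ ρ → P (ρ.erase (I.c c)) (α + Pi.single l 1) → Q ρ α) :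
    relHomotopy I a l u ∈ supportedCochain I Q (j + N) := by
  rw [relHomotopy_eq, LinearMap.sum_apply]
  refine sum_mem fun c _ => smul_mem_supportedCochain (ha c) (wedge_c_mem (P := fun ρ α => P ρ (α + Pi.single l 1))
    (divVar_mem hu l fun _ _ => id) c fun ρ α hc h => hPQ ρ α c hc h) (by ring)

/-- Division by w_l can make only the l-th exponent negative, which is harmless where w_l is
inverted. -/
theorem totalSupport_of_erase_c {ρ : Finset ι} {α : Fin h → ℤ} {c : C} {l : Fin h} (hc : I.c c ∈ ρ)
    (hl : I.l l ∈ ρ) (H : totalSupport I n i (ρ.erase (I.c c)) (α + Pi.single l 1)) :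
    totalSupport I (n - 1) i ρ α := by
  obtain ⟨h1, h2, h3, l', h4, h5⟩ := H
  rw [I.R_erase_c] at h1 h3 h4
  rw [sum_add_single] at h2
  have := I.card_L_erase hc
  refine ⟨fun l' hl' => ?_, by omega, by omega, l', h4, h5⟩
  by_cases e : l' = l
  · subst e; simpa using hl
  · exact h1 l' (by simp [e, hl'])

/-- Multiplication by g is null-homotopic where w_l is inverted. Removing that part of the cocycle
leaves terms in which a variable of index greater than l is inverted. -/
theorem exists_torsion_step {a : C → 𝔸} {N : ℤ}
    (ha : ∀ c, a c ∈ polyPiece k r (N - 1)) {l : Fin h} {g : 𝔸} (hg : g ∈ polyPiece k r N)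
    (hag : ∀ l', ∑ c, a c * κ c l' = if l' = l then g else 0)
    (hu : u ∈ supportedCochain I (totalSupport I n l) j) (hdu : diffT I κ u = 0) :
    ∃ v ∈ totalCochain k r I (n - 1) (j + N),
      ∃ u' ∈ supportedCochain I (totalSupport I n (l + 1)) (j + N),
        g • u = diffT I κ v + u' ∧ diffT I κ u' = 0 := by
  set W := wedge (ι := ι) 𝔸 (Laurent k r h) (I.l l) with hW
  set K := contr (ι := ι) 𝔸 (Laurent k r h) (I.l l) with hK
  have e1 := LinearMap.congr_fun (diffT_relHomotopy (I := I) hag) (W (K u))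
  have e2 := LinearMap.congr_fun (proj_mul_diffT (I := I) (κ := κ) l) u
  have e3 : W (K u) = u - K (W u) := LinearMap.congr_fun (wedge_mul_contr_self (I.l l)) u
  simp only [Module.End.mul_apply, LinearMap.add_apply, LinearMap.smul_apply,
    Module.End.one_apply, hdu, map_zero] at e1 e2
  -- The part of a cocycle with w_l inverted is closed only up to this term, and the homotopy
  -- applied to it goes into the remainder.
  have e4 : diffT I κ (W (K u)) = - W u := eq_neg_of_add_eq_zero_left e2.symm
  have hWl : ∀ {ρ : Finset ι} {α}, I.l l ∈ ρ → totalSupport I n l (ρ.erase (I.l l)) α →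
      totalSupport I (n + 1) (l + 1) ρ α := by
    intro ρ α hl H
    obtain ⟨h1, h2, h3, l', h4, h5⟩ := totalSupport_of_erase_l hl H
    obtain ⟨-, -, -, l', h4, h5⟩ := H
    have h6 : l' ≠ l := fun e => by subst e; simp at h4
    refine ⟨h1, h2, h3, l', ?_, by
      have : (l' : ℕ) ≠ l := fun e => h6 (Fin.ext e)
      omega⟩
    rw [I.mem_R] at h4 ⊢
    exact Finset.mem_of_mem_erase h4
  have hWu : W u ∈ supportedCochain I (fun ρ α => totalSupport I (n + 1) (l + 1) ρ α ∧ I.l l ∈ ρ) j :=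
    wedge_l_mem hu l fun ρ α hl H => ⟨hWl hl H, hl⟩
  have hWu' : W u ∈ supportedCochain I
      (fun ρ α => I.l l ∈ ρ ∧ totalSupport I n l (ρ.erase (I.l l)) α) j :=
    wedge_l_mem hu l fun ρ α hl H => ⟨hl, H⟩
  refine ⟨relHomotopy I a l (W (K u)), ?_, g • K (W u) - relHomotopy I a l (W u), ?_, ?_⟩
  · have hKu : K u ∈ supportedCochain I (fun ρ α => I.l l ∉ ρ ∧
        totalSupport I n l (insert (I.l l) ρ) α) j := contr_l_mem hu l fun ρ α h1 h2 => ⟨h1, h2⟩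
    have hWK : W (K u) ∈ supportedCochain I (fun ρ α => I.l l ∈ ρ ∧ totalSupport I n 0 ρ α) j :=
      wedge_l_mem hKu l fun ρ α h1 h2 => ⟨h1, by
        have := h2.2
        rw [Finset.insert_erase h1] at this
        exact ⟨this.1, this.2.1, this.2.2.1, l, by simpa using h1, Nat.zero_le _⟩⟩
    refine relHomotopy_mem ha l hWK fun ρ α c hc H => totalSupport_of_erase_c hc ?_ H.2
    exact Finset.mem_of_mem_erase H.1
  · refine sub_mem (smul_mem_supportedCochain hg (contr_l_mem hWu' l fun ρ α hl H => ?_) (by ring))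
      (relHomotopy_mem ha l hWu fun ρ α c hc H => ?_)
    · obtain ⟨-, H⟩ := H
      rw [Finset.erase_insert hl] at H
      obtain ⟨h1, h2, h3, l', h4, h5⟩ := H
      refine ⟨h1, h2, h3, l', h4, ?_⟩
      have : (l' : ℕ) ≠ l := fun e => hl (by rw [← Fin.ext e]; simpa using h4)
      omega
    · have := totalSupport_of_erase_c hc (Finset.mem_of_mem_erase H.2) H.1
      rwa [add_sub_cancel_right] at this
  · have e5 : g • u = diffT I κ (relHomotopy I a l (W (K u))) +
        (g • K (W u) - relHomotopy I a l (W u)) := by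
      rw [e4, map_neg, e3, smul_sub] at e1
      rw [e3]
      linear_combination (exp := 1) -e1
    refine ⟨e5, ?_⟩
    have := congrArg (diffT I κ) e5
    rw [map_smul, hdu, smul_zero, map_add, diffT_diffT, zero_add] at this
    exact this.symm

end TotalComplex

theorem pow_mem_polyPiece {k : Type*} [Field k] {r : ℕ} {g : MvPolynomial (Fin r) k} {N : ℤ}
    (hg : g ∈ polyPiece k r N) (t : ℕ) : g ^ t ∈ polyPiece k r (t * N) := by
  induction t with
  | zero => simpa using mem_polyPiece_iff.mpr (isHomogeneous_one (Fin r) k)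
  | succ t ih =>
    rw [pow_succ]
    exact mul_mem_polyPiece' ih hg (by push_cast; ring)

section TotalComplex

variable {k : Type*} [Field k] {r : ℕ}

local notation "𝔸" => MvPolynomial (Fin r) k

variable {C ι : Type*} {h : ℕ} [Fintype C] [LinearOrder ι] {I : SumIndex C h ι}
  {κ : C → Fin h → MvPolynomial (Fin r) k}

section Spans

omit [LinearOrder ι]

variable (k r h) in
/-- The vectors with homogeneous entries of degree `j`. -/
def freePiece (j : ℤ) : AddSubgroup (Fin h → 𝔸) where
  carrier := {x | ∀ l, x l ∈ polyPiece k r j}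
  zero_mem' := fun _ => zero_mem _
  add_mem' := fun hx hy l => add_mem (hx l) (hy l)
  neg_mem' := fun hx l => neg_mem (hx l)

/-- The homogeneous elements of degree `j` of the module spanned by the linear vectors `κ c`. -/
def spanPiece (κ : C → Fin h → 𝔸) (j : ℤ) : AddSubgroup (Fin h → 𝔸) where
  carrier := {x | ∃ y : C → 𝔸, (∀ c, y c ∈ polyPiece k r (j - 1)) ∧ x = ∑ c, y c • κ c}
  zero_mem' := ⟨0, fun _ => zero_mem _, by simp⟩
  add_mem' := by
    rintro _ _ ⟨y, hy, rfl⟩ ⟨z, hz, rfl⟩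
    exact ⟨y + z, fun c => add_mem (hy c) (hz c), by simp [add_smul, Finset.sum_add_distrib]⟩
  neg_mem' := by
    rintro _ ⟨y, hy, rfl⟩
    exact ⟨-y, fun c => neg_mem (hy c), by simp⟩

end Spans

variable {j n : ℤ} {i : ℕ} {u : Bicochain k r h ι}

/-- Each factor g treats one more index of an inverted variable; once the indices below h are used
up, the support is empty. -/
theorem exists_torsion {a : Fin h → C → 𝔸} {N : ℤ}
    (ha : ∀ l c, a l c ∈ polyPiece k r (N - 1)) {g : 𝔸} (hg : g ∈ polyPiece k r N)
    (hag : ∀ l l', ∑ c, a l c * κ c l' = if l' = l then g else 0) (t i : ℕ) (hti : h ≤ i + t) :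
    ∀ (j : ℤ), ∀ u ∈ supportedCochain I (totalSupport I n i) j, diffT I κ u = 0 →
    ∃ v ∈ totalCochain k r I (n - 1) (j + t * N), g ^ t • u = diffT I κ v := by
  induction t generalizing i with
  | zero =>
    intro j u hu hdu
    refine ⟨0, zero_mem _, ?_⟩
    rw [map_zero, pow_zero, one_smul]
    funext ρ α
    by_contra h0
    obtain ⟨-, -, -, l, -, hl⟩ := (hu ρ α).1 h0
    omega
  | succ t ih =>
    intro j u hu hdu
    rcases lt_or_ge i h with hi | hi
    · obtain ⟨v, hv, u', hu', e, hdu'⟩ :=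
        exists_torsion_step (l := ⟨i, hi⟩) (ha ⟨i, hi⟩) hg (hag _) hu hdu
      obtain ⟨v', hv', e'⟩ := ih (i + 1) (by omega) _ u' hu' hdu'
      refine ⟨g ^ t • v + v', add_mem (smul_mem_supportedCochain (pow_mem_polyPiece hg t) hv ?_) ?_,
        ?_⟩
      · push_cast; ring
      · rwa [show j + ((t + 1 : ℕ) : ℤ) * N = j + N + t * N by push_cast; ring]
      · rw [pow_succ, mul_smul, e, smul_add, e', map_add, map_smul]
    · refine ⟨0, zero_mem _, ?_⟩
      rw [map_zero]
      suffices u = 0 by rw [this, smul_zero]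
      funext ρ α
      by_contra h0
      obtain ⟨-, -, -, l, -, hl⟩ := (hu ρ α).1 h0
      omega

theorem totalCocycle_graded : IsGradedFamily k r (totalCocycle I κ n) := by
  intro F e m x hF hx
  refine ⟨supportedCochain_graded _ F e m x hF hx.1, ?_⟩
  have h2 : diffT I κ x = 0 := hx.2
  change diffT I κ (F • x) = 0
  rw [map_smul, h2, smul_zero]

theorem totalImage_graded : IsGradedFamily k r (totalImage I κ n) := by
  rintro F e m _ hF ⟨x, hx, rfl⟩
  exact ⟨F • x, supportedCochain_graded _ F e m x hF hx, map_smul (diffT I κ) F x⟩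

theorem totalImage_le (hκ : ∀ c l, κ c l ∈ polyPiece k r 1) {n' : ℤ} (hn : n + 1 = n') (j : ℤ) :
    totalImage I κ n j ≤ totalCocycle I κ n' j := by
  rintro _ ⟨x, hx, rfl⟩
  subst hn
  exact ⟨diffT_mem hκ hx, diffT_diffT I κ x⟩

/-- By `exists_torsion`, annihilators of the cokernel of κ are, up to powers, annihilators of the
cohomology of the total complex. So this cohomology also has dimension at most one. -/
theorem vanishes_totalCocycle {ℓ : 𝔸} {e e' N : ℕ}
    (hℓ : ℓ.IsHomogeneous e) (he : 1 ≤ e) {β : Fin r → 𝔸} (hβ : ∀ i, (β i).IsHomogeneous e')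
    (hN : e' + e = N)
    (hann : ∀ i l, Pi.single l (X i ^ N - ℓ * β i) ∈ spanPiece (k := k) (r := r) κ N) {p : ℤ}
    (hp : 2 ≤ p) {n' : ℤ} (hn : n + 1 = n') :
    CohomologyVanishes k r p j (totalCocycle I κ n') (totalImage I κ n) := by
  subst hn
  choose a ha ha' using fun i l => hann i l
  have hg : ∀ i, (X i ^ N - ℓ * β i : 𝔸).IsHomogeneous N := fun i =>
    (by simpa using (isHomogeneous_X k i).pow N : (X i ^ N : 𝔸).IsHomogeneous N).sub
      (by simpa only [← hN, add_comm] using hℓ.mul (hβ i))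
  -- With x = X_i^N and g = x - ℓβ_i, factor x^(h+1) - g^(h+1) = (x - g) ∑ x^s g^(h-s). Here x - g =
  -- ℓβ_i, and g^(h+1) acts as zero on cohomology.
  refine cohomologyVanishes_of_parameter totalCocycle_graded totalImage_graded hℓ he
    (β := fun i => β i * ∑ s ∈ Finset.range (h + 1), (X i ^ N) ^ s * (X i ^ N - ℓ * β i) ^ (h - s))
    (e' := e' + N * h) (N := (h + 1) * N) (fun i => ?_) (by rw [← hN]; ring) (fun i m z hz => ?_) hp
  · refine (hβ i).mul (IsHomogeneous.sum _ _ _ fun s hs => ?_)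
    have h1 := (((isHomogeneous_X k i).pow N).pow s).mul ((hg i).pow (h - s))
    have h2 : 1 * N * s + N * (h - s) = N * h := by
      rw [one_mul, ← mul_add, Nat.add_sub_cancel' (Nat.lt_succ_iff.mp (Finset.mem_range.mp hs))]
    rwa [h2] at h1
  · have e1 : X i ^ ((h + 1) * N) - ℓ * (β i * ∑ s ∈ Finset.range (h + 1), (X i ^ N) ^ s *
        (X i ^ N - ℓ * β i) ^ (h - s)) = (X i ^ N - ℓ * β i) ^ (h + 1) := by
      have := (Commute.all (X i ^ N) (X i ^ N - ℓ * β i)).mul_geom_sum₂ (h + 1)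
      rw [sub_sub_cancel, add_tsub_cancel_right] at this
      rw [← mul_assoc, this, mul_comm (h + 1), pow_mul]; ring
    rw [e1]
    have hag : ∀ l l', ∑ c, a i l c * κ c l' = if l' = l then X i ^ N - ℓ * β i else 0 := by
      intro l l'
      have := congrFun (ha' i l) l'
      rw [Pi.single_apply] at this
      rw [this, Finset.sum_apply]
      rfl
    obtain ⟨v, hv, e2⟩ := exists_torsion (ha i) (mem_polyPiece_iff.mpr (hg i)) hag (h + 1) 0
      (by omega) m z hz.1 hz.2
    rw [e2]
    rw [add_sub_cancel_right] at hv
    rw [Nat.cast_mul]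
    exact ⟨v, hv, rfl⟩

/-! ### Exactness of the augmented Čech complexes in w -/

section Acyclic

omit [Fintype C] in
-- Contraction with l is a contracting homotopy of the Čech complex. It respects the supports only
-- where the exponent of w_l is nonnegative, so that w_l need not be inverted.
theorem diffC_contr_nonnegPart (l : Fin h) {y : Bicochain k r h ι} (hdy : diffC k r I y = 0) :
    diffC k r I (contr 𝔸 (Laurent k r h) (I.l l) (pointwise ι (nonnegPart k r l) y)) =
      pointwise ι (nonnegPart k r l) y := by
  classical
  have e1 : diffC k r I * contr 𝔸 (Laurent k r h) (I.l l) =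
      1 - contr 𝔸 (Laurent k r h) (I.l l) * diffC k r I := by
    simp only [diffC, Finset.sum_mul, Finset.mul_sum, wedge_mul_contr, Finset.sum_sub_distrib,
      I.l_inj.eq_iff, Finset.sum_ite_eq', Finset.mem_univ, if_true]
  have e2 : diffC k r I * pointwise ι (nonnegPart k r l) =
      pointwise ι (nonnegPart k r l) * diffC k r I := by
    simp only [diffC, Finset.sum_mul, Finset.mul_sum, wedge_mul_pointwise]
  have e1' := LinearMap.congr_fun e1 (pointwise ι (nonnegPart k r l) y)
  have e2' := LinearMap.congr_fun e2 y
  simp only [Module.End.mul_apply, LinearMap.sub_apply, Module.End.one_apply, hdy,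
    map_zero] at e1' e2'
  rw [e1', e2', map_zero, sub_zero]

/-- Only monomials with all exponents negative can contribute to Čech cohomology. The variables are
treated one at a time. -/
theorem exists_diffC_partial (S : Finset (Fin h)) {q s : ℤ} {y : Bicochain k r h ι}
    (hy : y ∈ supportedCochain I (bidegreeSupport I q s) j) (hdy : diffC k r I y = 0) :
    ∃ y' ∈ supportedCochain I (bidegreeSupport I (q - 1) s) j,
      ∃ y'' ∈ supportedCochain I (fun ρ α => bidegreeSupport I q s ρ α ∧ ∀ l ∈ S, α l < 0) j,
        y = diffC k r I y' + y'' ∧ diffC k r I y'' = 0 := by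
  classical
  induction S using Finset.induction_on with
  | empty => exact ⟨0, zero_mem _, y, by simpa using hy, by simp, hdy⟩
  | insert l S hl ih =>
    obtain ⟨y', hy', y'', hy'', e, hd⟩ := ih
    have e2 := diffC_contr_nonnegPart l hd
    refine ⟨y' + contr 𝔸 (Laurent k r h) (I.l l) (pointwise ι (nonnegPart k r l) y''),
      add_mem hy' (contr_l_mem (nonnegPart_mem hy'' l) l ?_),
      y'' - pointwise ι (nonnegPart k r l) y'', ?_, ?_, ?_⟩
    · rintro ρ α hρ ⟨⟨⟨h1, h2, h3, h4⟩, -⟩, h5⟩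
      rw [I.L_insert_l] at h2 h4
      rw [I.card_R_insert hρ] at h3
      refine ⟨fun l' hl' => ?_, h2, by push_cast at h3; omega, h4⟩
      have := h1 l' hl'
      rw [I.mem_R, Finset.mem_insert, I.l_inj.eq_iff] at this
      rcases this with rfl | this
      · omega
      · exact I.mem_R.mpr this
    · intro ρ α
      refine ⟨fun h0 => ?_, sub_mem (hy'' ρ α).2 (nonnegPart_mem hy'' l ρ α).2⟩
      rw [Pi.sub_apply, Pi.sub_apply, pointwise_apply, nonnegPart_apply] at h0
      split_ifs at h0 with h1
      · simp at h0
      · rw [sub_zero] at h0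
        obtain ⟨h2, h3⟩ := (hy'' ρ α).1 h0
        refine ⟨h2, fun l' hl' => ?_⟩
        rcases Finset.mem_insert.mp hl' with rfl | hl'
        · omega
        · exact h3 l' hl'
    · rw [map_add, e2, e]; abel
    · rw [map_sub, hd, ← e2, ← Module.End.mul_apply (diffC k r I) (diffC k r I), diffC_mul_self]
      simp

/-- The augmented Čech complexes are exact in the relevant degrees. -/
theorem exists_diffC_eq {q s : ℤ} (hs : s ≤ h) {y : Bicochain k r h ι}
    (hy : y ∈ supportedCochain I (bidegreeSupport I q s) j) (hdy : diffC k r I y = 0) :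
    ∃ y' ∈ supportedCochain I (bidegreeSupport I (q - 1) s) j, diffC k r I y' = y := by
  obtain ⟨y', hy', y'', hy'', e, -⟩ := exists_diffC_partial Finset.univ hy hdy
  refine ⟨y', hy', ?_⟩
  suffices y'' = 0 by rw [e, this, add_zero]
  funext ρ α
  by_contra h0
  obtain ⟨⟨-, h2, -, h4⟩, h5⟩ := (hy'' ρ α).1 h0
  -- All exponents being negative, their sum is at most -h, but it equals 1 - s ≥ 1 - h.
  have : ∑ l, α l ≤ ∑ l : Fin h, (-1) := Finset.sum_le_sum fun l _ => by
    have := h5 l (Finset.mem_univ _); omega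
  simp at this
  omega

end Acyclic

end TotalComplex

/-! ### Cohomology of the total complex in degree zero: the cokernel of the presentation -/

section TotalComplex

variable {k : Type*} [Field k] {r : ℕ}

local notation "𝔸" => MvPolynomial (Fin r) k

variable {C ι : Type*} {h : ℕ} [Fintype C] [LinearOrder ι] {I : SumIndex C h ι}
  {κ : C → Fin h → MvPolynomial (Fin r) k} {j n : ℤ} {y : Bicochain k r h ι}

/-- A vector of polynomials as a linear form in `w_1, …, w_h`. -/
def linearEmb (ι : Type*) [DecidableEq ι] : (Fin h → 𝔸) →ₗ[𝔸] Bicochain k r h ι where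
  toFun x ρ α := if ρ = ∅ then ∑ l, if α = Pi.single l 1 then x l else 0 else 0
  map_add' x y := by
    funext ρ α
    simp only [Pi.add_apply]
    split_ifs
    · rw [← Finset.sum_add_distrib]
      exact Finset.sum_congr rfl fun l _ => by split_ifs <;> simp
    · simp
  map_smul' a x := by
    funext ρ α
    simp only [Pi.smul_apply, RingHom.id_apply]
    split_ifs
    · rw [Finset.smul_sum]
      exact Finset.sum_congr rfl fun l _ => by split_ifs <;> simp
    · simp

theorem single_one_injective {l l' : Fin h} (e : (Pi.single l 1 : Fin h → ℤ) = Pi.single l' 1) :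
    l = l' := by
  by_contra hne
  have := congrFun e l
  simp [hne] at this

theorem linearEmb_single (x : Fin h → 𝔸) (l : Fin h) :
    linearEmb ι x ∅ (Pi.single l 1) = x l := by
  simp only [linearEmb, LinearMap.coe_mk, AddHom.coe_mk, if_true]
  rw [Finset.sum_eq_single l]
  · simp
  · exact fun l' _ hl' => if_neg fun e => hl' (single_one_injective e).symm
  · simp

theorem linearEmb_of_ne (x : Fin h → 𝔸) {ρ : Finset ι} (hρ : ρ ≠ ∅) (α : Fin h → ℤ) :
    linearEmb ι x ρ α = 0 := by
  simp only [linearEmb, LinearMap.coe_mk, AddHom.coe_mk, if_neg hρ]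

theorem linearEmb_mem {x : Fin h → 𝔸} (hx : x ∈ freePiece k r h j) :
    linearEmb ι x ∈ supportedCochain I (bidegreeSupport I 0 0) j := by
  intro ρ α
  by_cases hρ : ρ = ∅
  · subst hρ
    simp only [linearEmb, LinearMap.coe_mk, AddHom.coe_mk, if_true]
    have hL : I.L ∅ = ∅ := by ext; simp
    have hR : I.R ∅ = ∅ := by ext; simp
    constructor
    · intro h0
      obtain ⟨l, -, hl⟩ := Finset.exists_ne_zero_of_sum_ne_zero h0
      obtain ⟨rfl, -⟩ := ite_ne_right_iff.mp hl
      refine ⟨fun l' hl' => ?_, by simp [hL], by simp [hR], by simp [hL]⟩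
      by_cases e : l' = l
      · subst e; simp at hl'
      · simp [e] at hl'
    · refine sum_mem fun l _ => ?_
      split_ifs
      · rw [hL]; simpa using hx l
      · exact zero_mem _
  · rw [linearEmb_of_ne x hρ]
    exact ⟨fun h => absurd rfl h, zero_mem _⟩

theorem eq_single_of_nonneg {α : Fin h → ℤ} (h0 : ∀ l, 0 ≤ α l) (h1 : ∑ l, α l = 1) :
    ∃ l, α = Pi.single l 1 := by
  obtain ⟨l, -, hl⟩ := Finset.exists_ne_zero_of_sum_ne_zero (h1.trans_ne one_ne_zero)
  refine ⟨l, funext fun l' => ?_⟩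
  have h2 := Finset.add_sum_erase Finset.univ α (Finset.mem_univ l)
  have h3 : 0 ≤ ∑ x ∈ Finset.univ.erase l, α x := Finset.sum_nonneg fun x _ => h0 x
  have h4 := h0 l
  by_cases e : l' = l
  · subst e; simp; omega
  · have h5 := Finset.single_le_sum (f := α) (fun x _ => h0 x)
      (Finset.mem_erase.mpr ⟨e, Finset.mem_univ l'⟩)
    have h6 := h0 l'
    simp [e]; omega

/-- In bidegree (0, 0) no variable is inverted, so the exponents are nonnegative with sum 1, that
is, unit vectors. -/
theorem exists_linearEmb (hy : y ∈ supportedCochain I (bidegreeSupport I 0 0) j) :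
    (fun l => y ∅ (Pi.single l 1)) ∈ freePiece k r h j ∧
      y = linearEmb ι fun l => y ∅ (Pi.single l 1) := by
  have hL : I.L ∅ = ∅ := by ext; simp
  constructor
  · intro l
    have := (hy ∅ (Pi.single l 1)).2
    rw [hL] at this
    simpa using this
  · funext ρ α
    by_cases h0 : y ρ α = 0 ∧ linearEmb ι (fun l => y ∅ (Pi.single l 1)) ρ α = 0
    · rw [h0.1, h0.2]
    have hs : bidegreeSupport I 0 0 ρ α := by
      by_cases h1 : y ρ α = 0
      · refine (linearEmb_mem (I := I) (j := j) (fun l => ?_) ρ α).1 fun h2 => h0 ⟨h1, h2⟩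
        have := (hy ∅ (Pi.single l 1)).2
        rw [hL] at this
        simpa using this
      · exact (hy ρ α).1 h1
    obtain ⟨h1, h2, h3, h4⟩ := hs
    obtain rfl := I.eq_empty (by exact_mod_cast h4) (by exact_mod_cast h3)
    obtain ⟨l, rfl⟩ := eq_single_of_nonneg (α := α) (fun l => by
      by_contra h5
      simpa using h1 l (by omega)) (by simpa [hL] using h2)
    rw [linearEmb_single]

theorem diffK_linearEmb (x : Fin h → 𝔸) : diffK I κ (linearEmb ι x) = 0 := by
  rw [diffK, LinearMap.sum_apply]
  refine Finset.sum_eq_zero fun c _ => ?_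
  funext ρ α
  rw [Module.End.mul_apply, contr_apply]
  split_ifs
  · rfl
  · rw [pointwise_apply]
    rw [show linearEmb ι x (insert (I.c c) ρ) = 0 from
      funext fun α => linearEmb_of_ne x (Finset.insert_ne_empty _ _) α]
    simp

theorem diffK_bidegree_mem (hκ : ∀ c l, κ c l ∈ polyPiece k r 1) {q s : ℤ}
    (hy : y ∈ supportedCochain I (bidegreeSupport I q s) j) :
    diffK I κ y ∈ supportedCochain I (bidegreeSupport I q (s - 1)) j := by
  refine diffK_mem hκ hy fun ρ α c l hc ⟨h1, h2, h3, h4⟩ => ?_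
  rw [I.R_insert_c] at h1 h3
  rw [I.card_L_insert hc] at h2 h4
  rw [sum_sub_single] at h2
  exact ⟨fun l' hl => h1 l' (sub_single_neg l hl), by push_cast at h2; omega, h3, by
    push_cast at h4; omega⟩

theorem diffC_bidegree_mem {q s : ℤ}
    (hy : y ∈ supportedCochain I (bidegreeSupport I q s) j) :
    diffC k r I y ∈ supportedCochain I (bidegreeSupport I (q + 1) s) j := by
  refine diffC_mem hy fun ρ α l hl ⟨h1, h2, h3, h4⟩ => ?_
  rw [I.L_erase_l] at h2 h4
  have := I.card_R_erase hl
  refine ⟨fun l' hl' => ?_, h2, by omega, h4⟩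
  have := h1 l' hl'
  rw [I.mem_R] at this ⊢
  exact Finset.mem_of_mem_erase this

/-- The Koszul differential on the constants at the linear forms. -/
theorem diffK_eq_linearEmb (hκ : ∀ c l, κ c l ∈ polyPiece k r 1)
    (hy : y ∈ supportedCochain I (bidegreeSupport I 0 1) j) :
    diffK I κ y = linearEmb ι (∑ c, y {I.c c} 0 • κ c) := by
  have h0 := diffK_bidegree_mem hκ hy
  rw [sub_self] at h0
  rw [(exists_linearEmb h0).2]
  congr 1
  funext l
  rw [diffK, LinearMap.sum_apply, Finset.sum_apply, Finset.sum_apply, Finset.sum_apply]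
  refine Finset.sum_congr rfl fun c _ => ?_
  rw [Module.End.mul_apply, contr_apply, if_neg (Finset.notMem_empty _), pointwise_apply,
    Pi.smul_apply, mulForm_apply, Finset.sum_eq_single l]
  · simp [koszulSign, mul_comm]
  · intro l' _ hl'
    by_contra h1
    have h2 := ((hy _ _).1 (right_ne_zero_of_mul h1)).1 l' (by simp [hl'])
    simp [(I.ne _ _).symm] at h2
  · simp

/-- The elements `y c` at the linear forms. -/
theorem exists_diffK_eq_linearEmb (hκ : ∀ c l, κ c l ∈ polyPiece k r 1) {x : Fin h → 𝔸}
    (hx : x ∈ spanPiece κ j) :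
    ∃ y ∈ supportedCochain I (bidegreeSupport I 0 1) j, diffK I κ y = linearEmb ι x := by
  classical
  obtain ⟨z, hz, rfl⟩ := hx
  have hL : ∀ c, I.L {I.c c} = {c} := fun c => by ext; simp [I.c_inj.eq_iff]
  have hR : ∀ c, I.R {I.c c} = ∅ := fun c => by ext; simp [(I.ne _ _).symm]
  have hY : (fun ρ α => ∑ c, if ρ = {I.c c} ∧ α = 0 then z c else 0 : Bicochain k r h ι) ∈
      supportedCochain I (bidegreeSupport I 0 1) j := by
    intro ρ α
    constructor
    · intro h0
      obtain ⟨c, -, hc⟩ := Finset.exists_ne_zero_of_sum_ne_zero h0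
      obtain ⟨⟨rfl, rfl⟩, -⟩ := ite_ne_right_iff.mp hc
      exact ⟨by simp, by simp [hL], by simp [hR], by simp [hL]⟩
    · refine sum_mem fun c _ => ?_
      split_ifs with hc
      · rw [hc.1, hL]; simpa using hz c
      · exact zero_mem _
  refine ⟨_, hY, ?_⟩
  rw [diffK_eq_linearEmb hκ hY]
  simp [I.c_inj.eq_iff]

theorem linearEmb_injective : Function.Injective (linearEmb (k := k) (r := r) (h := h) ι) := by
  intro x y e
  funext l
  rw [← linearEmb_single (ι := ι) x, e, linearEmb_single]

theorem bidegree_to_total {q s : ℤ} (hq : 1 ≤ q) (hn : q - 1 - s = n)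
    (hy : y ∈ supportedCochain I (bidegreeSupport I q s) j) : y ∈ totalCochain k r I n j := by
  refine supportedCochain_mono (fun ρ α ⟨h1, h2, h3, h4⟩ => ⟨h1, h2, by omega, ?_⟩) hy
  obtain ⟨l, hl⟩ := Finset.card_pos.mp (show 0 < (I.R ρ).card by omega)
  exact ⟨l, hl, Nat.zero_le _⟩

/-- The part of bidegree `(q, *)`. -/
def columnPart (I : SumIndex C h ι) (q : ℕ) (y : Bicochain k r h ι) : Bicochain k r h ι :=
  fun ρ => if (I.R ρ).card = q then y ρ else 0

theorem columnPart_mem {q : ℕ} (hy : y ∈ totalCochain k r I n j) :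
    columnPart I q y ∈ supportedCochain I (bidegreeSupport I q (q - 1 - n)) j := by
  intro ρ α
  unfold columnPart
  split_ifs with h0
  · refine ⟨fun h => ?_, (hy ρ α).2⟩
    obtain ⟨h1, h2, h3, -⟩ := (hy ρ α).1 h
    exact ⟨h1, h2, by rw [h0], by omega⟩
  · exact ⟨fun h => absurd rfl h, zero_mem _⟩

/-- In column q + 1 the total differential sees only the Čech differential of the last nonzero
column, because the Koszul differential preserves columns. -/
theorem diffC_columnPart {q : ℕ} (hq : ∀ ρ, q < (I.R ρ).card → y ρ = 0)
    (hdy : ∀ ρ, q < (I.R ρ).card → diffT I κ y ρ = 0) : diffC k r I (columnPart I q y) = 0 := by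
  funext ρ
  have hK : ∀ ρ, (I.R ρ).card = q + 1 → diffK I κ y ρ = 0 := by
    intro ρ hρ
    rw [diffK, LinearMap.sum_apply, Finset.sum_apply]
    refine Finset.sum_eq_zero fun c _ => ?_
    rw [Module.End.mul_apply, contr_apply]
    split_ifs
    · rfl
    · rw [pointwise_apply, hq _ (by rw [I.R_insert_c]; omega), map_zero, smul_zero]
  have hC : ∀ z : Bicochain k r h ι, diffC k r I z ρ = ∑ l, if I.l l ∈ ρ then
      koszulSign 𝔸 ρ (I.l l) • z (ρ.erase (I.l l)) else 0 := by
    intro z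
    rw [diffC, LinearMap.sum_apply, Finset.sum_apply]
    rfl
  by_cases hρ : (I.R ρ).card = q + 1
  · have h1 := hdy ρ (by omega)
    rw [diffT, LinearMap.add_apply, Pi.add_apply, hK ρ hρ, zero_add, hC] at h1
    rw [hC]
    refine (Finset.sum_congr rfl fun l _ => ?_).trans h1
    split_ifs with hl
    · have := I.card_R_erase hl
      rw [columnPart, if_pos (by omega)]
    · rfl
  · rw [hC]
    refine Finset.sum_eq_zero fun l _ => ?_
    split_ifs with hl
    · have := I.card_R_erase hl
      rw [columnPart, if_neg (by omega), smul_zero]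
    · rfl

/-- A cochain whose boundary lives in the first column is, up to a boundary, of bidegree `(0, *)`. -/
theorem exists_reduce (hκ : ∀ c l, κ c l ∈ polyPiece k r 1) (hn : -1 ≤ n) (m : ℕ) :
    ∀ y ∈ totalCochain k r I n j, (∀ ρ, m + 1 < (I.R ρ).card → y ρ = 0) →
      (∀ ρ, 1 < (I.R ρ).card → diffT I κ y ρ = 0) →
    ∃ v ∈ totalCochain k r I (n - 1) j, ∃ y' ∈ supportedCochain I (bidegreeSupport I 0 (-n)) j,
      y = diffT I κ v + diffC k r I y' := by
  induction m with
  | zero =>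
    intro y hy h1 h2
    have e : columnPart I 1 y = y := by
      funext ρ α
      unfold columnPart
      split_ifs with h3
      · rfl
      · by_contra h4
        obtain ⟨-, -, -, l, hl, -⟩ := (hy ρ α).1 (Ne.symm h4)
        have := Finset.card_pos.mpr ⟨l, hl⟩
        exact h4 (by rw [h1 ρ (by omega)])
    have h3 := columnPart_mem (q := 1) hy
    have h4 := diffC_columnPart (q := 1) (κ := κ) (by simpa using h1) (by simpa using h2)
    rw [e] at h3 h4
    -- For h = 0 there is no variable to invert and the total complex is zero; otherwise exactness
    -- in the first column applies, as -n ≤ 1 ≤ h.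
    rcases Nat.eq_zero_or_pos h with h0 | h0
    · refine ⟨0, zero_mem _, 0, zero_mem _, ?_⟩
      funext ρ α
      by_contra h5
      obtain ⟨-, -, -, l, -⟩ := (hy ρ α).1 (by simpa using h5)
      exact absurd l.2 (by omega)
    · obtain ⟨y', hy', e'⟩ := exists_diffC_eq (by push_cast; omega) h3 h4
      refine ⟨0, zero_mem _, y', ?_, by rw [map_zero, zero_add, e']⟩
      convert hy' using 2
      simp
  | succ m ih =>
    intro y hy h1 h2
    by_cases hm : h < m + 2
    · exact ih y hy (fun ρ hρ => h1 ρ (by have := I.card_R_le ρ; omega)) h2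
    have h3 := columnPart_mem (q := m + 2) hy
    have h4 := diffC_columnPart (q := m + 2) (κ := κ) h1 (fun ρ hρ => h2 ρ (by omega))
    -- The last column involves q - 1 - n linear forms with q = m + 2 ≤ h. This number is at most h
    -- because n ≥ -1.
    obtain ⟨y', hy', e'⟩ := exists_diffC_eq (by push_cast; omega) h3 h4
    have h5 : y' ∈ totalCochain k r I (n - 1) j :=
      bidegree_to_total (by push_cast; omega) (by push_cast; ring) hy'
    have h6 := diffT_mem hκ h5
    rw [sub_add_cancel] at h6
    have h7 : ∀ ρ, m + 1 < (I.R ρ).card → (y - diffT I κ y') ρ = 0 := by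
      intro ρ hρ
      have h8 : diffK I κ y' ρ = 0 := by
        funext α
        by_contra h9
        obtain ⟨-, -, h9, -⟩ := (diffK_bidegree_mem hκ hy' ρ α).1 h9
        push_cast at h9
        omega
      rw [diffT, LinearMap.add_apply, e', Pi.sub_apply, Pi.add_apply, h8, zero_add, columnPart]
      split_ifs with h9
      · rw [sub_self]
      · rw [sub_zero]; exact h1 ρ (by omega)
    obtain ⟨v, hv, y'', hy'', e''⟩ := ih (y - diffT I κ y') (sub_mem hy h6) h7
      (fun ρ hρ => by rw [map_sub, diffT_diffT, sub_zero]; exact h2 ρ hρ)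
    exact ⟨y' + v, add_mem h5 hv, y'', hy'', by rw [map_add, add_assoc, ← e'']; abel⟩

/-- The cohomology of the total complex in degree `0`. -/
theorem inducesIso_linearEmb (hκ : ∀ c l, κ c l ∈ polyPiece k r 1) :
    InducesIso (diffC k r I ∘ₗ linearEmb ι) (freePiece k r h) (spanPiece κ) (totalCocycle I κ 0)
      (totalImage I κ (-1)) where
  map_mem j x hx := by
    have h1 := diffC_bidegree_mem (linearEmb_mem (I := I) hx)
    refine ⟨bidegree_to_total le_rfl (by ring) h1, ?_⟩
    have h2 := LinearMap.congr_fun (diffC_mul_diffK I κ) (linearEmb ι x)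
    have h3 := LinearMap.congr_fun (diffC_mul_self (k := k) (r := r) I) (linearEmb ι x)
    simp only [Module.End.mul_apply, LinearMap.neg_apply, diffK_linearEmb, map_zero,
      LinearMap.zero_apply] at h2 h3
    change diffT I κ (diffC k r I (linearEmb ι x)) = 0
    rw [diffT, LinearMap.add_apply, h3, add_zero, ← neg_eq_zero, ← h2]
  map_mem_sub j x hx := by
    obtain ⟨y, hy, e⟩ := exists_diffK_eq_linearEmb (I := I) hκ hx
    have h1 := diffC_bidegree_mem hy
    refine ⟨-diffC k r I y, neg_mem (bidegree_to_total le_rfl (by ring) h1), ?_⟩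
    have h2 := LinearMap.congr_fun (diffC_mul_diffK I κ) y
    have h3 := LinearMap.congr_fun (diffC_mul_self (k := k) (r := r) I) y
    simp only [Module.End.mul_apply, LinearMap.neg_apply, LinearMap.zero_apply] at h2 h3
    change diffT I κ (-diffC k r I y) = diffC k r I (linearEmb ι x)
    rw [diffT, map_neg, LinearMap.add_apply, h3, add_zero, ← e, h2]
  surj j y hy := by
    have hdy : diffT I κ y = 0 := hy.2
    obtain ⟨v, hv, y', hy', e⟩ := exists_reduce hκ (by norm_num) h y hy.1
      (fun ρ hρ => absurd (I.card_R_le ρ) (by omega)) (fun ρ _ => by rw [hdy]; rfl)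
    rw [neg_zero] at hy'
    refine ⟨_, (exists_linearEmb hy').1, v, by simpa using hv, ?_⟩
    change diffT I κ v = y - diffC k r I (linearEmb ι _)
    rw [← (exists_linearEmb hy').2, e, add_sub_cancel_right]
  inj j x hx hgx := by
    obtain ⟨y, hy, e⟩ := hgx
    change diffT I κ y = diffC k r I (linearEmb ι x) at e
    have h1 := diffC_bidegree_mem (linearEmb_mem (I := I) hx)
    obtain ⟨v, hv, y', hy', e'⟩ := exists_reduce hκ le_rfl h y hy
      (fun ρ hρ => absurd (I.card_R_le ρ) (by omega)) (fun ρ hρ => by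
        rw [e]
        funext α
        by_contra h2
        obtain ⟨-, -, h3, -⟩ := (h1 ρ α).1 h2
        omega)
    rw [neg_neg] at hy'
    rw [e', map_add, diffT_diffT, zero_add, diffT, LinearMap.add_apply] at e
    have h2 := LinearMap.congr_fun (diffC_mul_diffK I κ) y'
    have h3 := LinearMap.congr_fun (diffC_mul_self (k := k) (r := r) I) y'
    simp only [Module.End.mul_apply, LinearMap.neg_apply, LinearMap.zero_apply] at h2 h3
    rw [h3, add_zero] at e
    have h4 := diffK_bidegree_mem hκ hy'
    rw [sub_self] at h4
    -- A Čech cocycle in column 0 has a primitive in column -1, which is empty. So `x` equals minus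
    -- the Koszul boundary of `y'`, a combination of the κ_c.
    obtain ⟨z, hz, e2⟩ := exists_diffC_eq (by simp) (add_mem (linearEmb_mem (I := I) hx) h4)
      (by rw [map_add, h2, ← e, add_neg_cancel])
    have hz0 : z = 0 := by
      funext ρ α
      by_contra h5
      obtain ⟨-, -, h6, -⟩ := (hz ρ α).1 h5
      omega
    rw [hz0, map_zero, diffK_eq_linearEmb hκ hy', ← map_add] at e2
    have e3 := linearEmb_injective (e2.symm.trans (map_zero (linearEmb (k := k) (r := r) ι)).symm)
    refine ⟨fun c => - y' {I.c c} 0, fun c => neg_mem ?_, ?_⟩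
    · have hL : I.L {I.c c} = {c} := by ext; simp [I.c_inj.eq_iff]
      have := (hy' {I.c c} 0).2
      rw [hL] at this
      simpa using this
    · rw [eq_neg_of_add_eq_zero_left e3]
      simp

end TotalComplex

/-! ### Local cohomology along the total complex -/

section TotalComplex

variable {k : Type*} [Field k] {r : ℕ}

local notation "𝔸" => MvPolynomial (Fin r) k

theorem cohomologyVanishes_of_neg {M : Type*} [AddCommGroup M] [Module 𝔸 M] {p j : ℤ} (hp : p < 0)
    (Z B : ℤ → AddSubgroup M) : CohomologyVanishes k r p j Z B := by
  intro a u hu _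
  have h0 : u = 0 := funext fun σ => (hu σ).1 (by omega)
  exact ⟨0, 0, zero_mem _, by simp [h0, zero_mem]⟩

theorem isGradedFamily_bot {M : Type*} [AddCommGroup M] [Module 𝔸 M] :
    IsGradedFamily k r (fun _ => (⊥ : AddSubgroup M)) := by
  rintro F e n x hF hx
  rw [AddSubgroup.mem_bot] at hx ⊢
  rw [hx, smul_zero]

theorem divMonomial_mem {F : 𝔸} {n : ℤ} (hF : F ∈ polyPiece k r n) (l : Fin r) (a : ℕ) :
    F.divMonomial (Finsupp.single l a) ∈ polyPiece k r (n - a) := by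
  intro m hm
  rw [coeff_divMonomial] at hm
  have := hF _ hm
  rw [map_add, Finsupp.degree_single] at this
  push_cast at this
  omega

/-- A monomial divisible by no T_l^a has all exponents at most a - 1, hence degree at most r(a - 1).
This is why H^r(A) vanishes in degrees above -r. -/
theorem eq_zero_of_divMonomial_eq_zero {F : 𝔸} {n : ℤ} {a : ℕ} (hF : F ∈ polyPiece k r n)
    (h : ∀ l, F.divMonomial (Finsupp.single l a) = 0) (hn : (a : ℤ) * r < n + r) : F = 0 := by
  ext m
  by_contra h0
  rw [coeff_zero] at h0
  have h1 : ∀ l, m l < a := by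
    intro l
    by_contra h2
    refine h0 ?_
    have h3 := congrArg (coeff (m - Finsupp.single l a)) (h l)
    rwa [coeff_divMonomial, add_tsub_cancel_of_le (Finsupp.single_le_iff.mpr (not_lt.mp h2)),
      coeff_zero] at h3
  have h2 := hF m h0
  rw [Finsupp.degree_eq_sum] at h2
  have h3 : ∑ l, ((m l : ℤ) + 1) ≤ ∑ l : Fin r, (a : ℤ) :=
    Finset.sum_le_sum fun l _ => by have := h1 l; omega
  rw [Finset.sum_add_distrib] at h3
  simp only [Finset.sum_const, Finset.card_univ, Fintype.card_fin, nsmul_eq_mul, mul_one] at h3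
  push_cast at h2
  linarith [mul_comm (a : ℤ) r]

theorem divMonomial_X_pow_mul (l : Fin r) (a : ℕ) (F : 𝔸) :
    (X l ^ a * F).divMonomial (Finsupp.single l a) = F := by
  rw [X_pow_eq_monomial, divMonomial_monomial_mul]

theorem divMonomial_X_pow_mul_of_ne {l i : Fin r} (hil : i ≠ l) (a : ℕ) (F : 𝔸) :
    (X i ^ a * F).divMonomial (Finsupp.single l a) =
      X i ^ a * F.divMonomial (Finsupp.single l a) := by
  ext m
  rw [coeff_divMonomial, X_pow_eq_monomial, coeff_monomial_mul', coeff_monomial_mul',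
    coeff_divMonomial]
  have : Finsupp.single i a ≤ Finsupp.single l a + m ↔ Finsupp.single i a ≤ m := by
    rw [Finsupp.single_le_iff, Finsupp.single_le_iff]
    simp [hil.symm]
  simp only [this]
  split_ifs with h
  · rw [add_tsub_assoc_of_le h]
  · rfl

variable {C ι : Type*} {h : ℕ} [Fintype C] [LinearOrder ι] {I : SumIndex C h ι}
  {κ : C → Fin h → MvPolynomial (Fin r) k} {j n : ℤ}

/-- The terms in degree n are copies of A shifted by |L| = |R| - 1 - n ≤ h - 1 - n. They have
cohomology only in degree r, and there only up to degree h - 1 - n - r. -/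
theorem vanishes_totalCochain {q : ℤ} (hq : q = r → h - 1 - n - r < j) :
    CohomologyVanishes k r q j (totalCochain k r I n) (fun _ => ⊥) := by
  rcases lt_or_ge (r : ℤ) q with h0 | h0
  · exact cohomologyVanishes_of_gt h0 _ _
  refine cohomologyVanishes_of_division (supportedCochain_graded _)
    (fun a l => { toFun := fun u ρ α => (u ρ α).divMonomial (Finsupp.single l a)
                  map_zero' := by funext ρ α; simp
                  map_add' := fun u v => by funext ρ α; simp [add_divMonomial] })
    (fun a l x => ?_) (fun a l i x hil => ?_) (fun a l i x => ?_) (fun a l n x hx => ?_) ?_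
  · funext ρ α
    exact divMonomial_X_pow_mul l a _
  · funext ρ α
    exact divMonomial_X_pow_mul_of_ne hil a _
  · funext ρ α
    change ((x ρ α).divMonomial _).divMonomial _ = ((x ρ α).divMonomial _).divMonomial _
    rw [← divMonomial_add, ← divMonomial_add, add_comm]
  · intro ρ α
    refine ⟨fun h => (hx ρ α).1 fun h1 => h ?_, ?_⟩
    · change (x ρ α).divMonomial _ = 0
      rw [h1, zero_divMonomial]
    · have := divMonomial_mem (hx ρ α).2 l a
      rwa [sub_right_comm] at this
  · rcases eq_or_lt_of_le h0 with h1 | h1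
    · refine Or.inr fun a x hx hx0 => funext fun ρ => funext fun α => ?_
      by_contra h2
      obtain ⟨-, -, h3, -⟩ := (hx ρ α).1 h2
      have h4 := hq h1
      have h5 := I.card_R_le ρ
      refine h2 (eq_zero_of_divMonomial_eq_zero (a := a) (hx ρ α).2
        (fun l => congrFun (congrFun (hx0 l) ρ) α) ?_)
      have : ((I.R ρ).card : ℤ) ≤ h := by exact_mod_cast h5
      linarith
    · exact Or.inl h1

theorem inducesIso_diffT : InducesIso (diffT I κ) (totalCochain k r I n) (totalCocycle I κ n)
    (totalImage I κ n) (fun _ => ⊥) where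
  map_mem _ x hx := ⟨x, hx, rfl⟩
  map_mem_sub _ x hx := AddSubgroup.mem_bot.mpr hx.2
  surj _ y := by
    rintro ⟨x, hx, rfl⟩
    refine ⟨x, hx, ?_⟩
    rw [AddSubgroup.mem_bot]
    exact sub_self (diffT I κ x)
  inj _ x hx h := ⟨hx, AddSubgroup.mem_bot.mp h⟩

/-- Descending induction on q. The boundaries out of degree p - q are cochains modulo cocycles, so
H^q of them is controlled by H^q of the cochains and H^(q+1) of the cocycles. The latter vanishes by
the induction hypothesis for the previous boundaries, since the cohomology of the complex has no
H^(q+1) for q + 1 ≥ 2. The condition on j is what the cochains require when q = r. -/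
theorem vanishes_totalImage (hκ : ∀ c l, κ c l ∈ polyPiece k r 1)
    (hZ : ∀ p n n' : ℤ, 2 ≤ p → n + 1 = n' →
      CohomologyVanishes k r p j (totalCocycle I κ n') (totalImage I κ n))
    {p : ℤ} (hp : 0 ≤ p) (hj : h - p ≤ j) (t : ℕ) :
    ∀ q : ℤ, p + 1 ≤ q → r < q + t →
      CohomologyVanishes k r q j (totalImage I κ (p - q)) (fun _ => ⊥) := by
  induction t with
  | zero => exact fun q _ hq => cohomologyVanishes_of_gt (by simpa using hq) _ _
  | succ t ih =>
    intro q hpq hq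
    refine inducesIso_diffT.vanishes' isGradedFamily_bot (supportedCochain_graded _) ?_
    have h1 := ih (q + 1) (by omega) (by push_cast at hq; omega)
    have h2 := CohomologyVanishes.middle isGradedFamily_bot totalCocycle_graded (fun _ => bot_le)
      (totalImage_le hκ (by ring)) h1 (hZ (q + 1) (p - (q + 1)) (p - q) (by omega) (by ring))
    exact CohomologyVanishes.quotient totalCocycle_graded (supportedCochain_graded _)
      (fun _ => bot_le) (fun _ => inf_le_left)
      (vanishes_totalCochain (by intro h; omega)) h2

/-- The boundaries in degree 0 have no H^(p+1), so it remains to treat the cocycles. Their H^p is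
bounded by H^p of the cochains and H^(p-1) of the boundaries in degree 1. As p ≤ 1, the latter is a
submodule effect: it is bounded by H^(p-2), which is zero, and by H^(p-1) of the cochains in degree
1. -/
theorem vanishes_totalCocycle_zero (hκ : ∀ c l, κ c l ∈ polyPiece k r 1)
    (hZ : ∀ p n n' : ℤ, 2 ≤ p → n + 1 = n' →
      CohomologyVanishes k r p j (totalCocycle I κ n') (totalImage I κ n))
    {p : ℤ} (hp : p = 0 ∨ p = 1) (hj : h - p ≤ j) :
    CohomologyVanishes k r p j (totalCocycle I κ 0) (totalImage I κ (-1)) := by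
  have h1 := vanishes_totalImage hκ hZ (by omega) hj r (p + 1) le_rfl (by omega)
  rw [show p - (p + 1) = -1 by ring] at h1
  refine CohomologyVanishes.quotient totalImage_graded totalCocycle_graded (fun _ => bot_le)
    (totalImage_le hκ (by ring)) ?_ h1
  refine CohomologyVanishes.sub isGradedFamily_bot totalCocycle_graded (fun _ => bot_le)
    (fun _ => inf_le_left) ?_ (vanishes_totalCochain (by intro h; omega))
  refine inducesIso_diffT.vanishes isGradedFamily_bot (supportedCochain_graded _) ?_
  refine CohomologyVanishes.sub (Z := totalCochain k r I 1) isGradedFamily_bot totalImage_graded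
    (fun _ => bot_le) (fun j => (totalImage_le hκ (by ring) j).trans inf_le_left)
    (cohomologyVanishes_of_neg (by omega) _ _) (vanishes_totalCochain (by intro h; omega))

end TotalComplex

/-! ### Vanishing for linearly presented modules of dimension at most one -/

section LinearPresentation

variable {k : Type*} [Field k] {r h m : ℕ} {κ : Fin m → Fin h → MvPolynomial (Fin r) k}

local notation "𝔸" => MvPolynomial (Fin r) k

/-- The index set for `m` linear forms and `h` variables. -/
def finSumIndex (m h : ℕ) : SumIndex (Fin m) h (Fin m ⊕ₗ Fin h) where
  c a := toLex (Sum.inl a)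
  l b := toLex (Sum.inr b)
  c_inj a b e := by simpa using e
  l_inj a b e := by simpa using e
  ne a b := by simp
  cover i := by
    obtain ⟨i, rfl⟩ := toLex.surjective i
    rcases i with a | b
    · exact Or.inl ⟨a, rfl⟩
    · exact Or.inr ⟨b, rfl⟩

/-- The local cohomology of a module with a linear presentation and of dimension at most one. -/
theorem cohomologyVanishes_of_linear_presentation (hκ : ∀ c l, κ c l ∈ polyPiece k r 1) {ℓ : 𝔸}
    {e e' N : ℕ} (hℓ : ℓ.IsHomogeneous e) (he : 1 ≤ e) {β : Fin r → 𝔸}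
    (hβ : ∀ i, (β i).IsHomogeneous e') (hN : e' + e = N)
    (hann : ∀ i l, Pi.single l (X i ^ N - ℓ * β i) ∈ spanPiece (k := k) (r := r) κ N) {p j : ℤ}
    (hj : p < 2 → h - p ≤ j) :
    CohomologyVanishes k r p j (freePiece k r h) (spanPiece κ) := by
  rcases lt_or_ge p 0 with hp | hp
  · exact cohomologyVanishes_of_neg hp _ _
  have hZ : ∀ p n n' : ℤ, 2 ≤ p → n + 1 = n' → CohomologyVanishes k r p j
      (totalCocycle (finSumIndex m h) κ n') (totalImage (finSumIndex m h) κ n) :=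
    fun p n n' hp hn => vanishes_totalCocycle hℓ he hβ hN hann hp hn
  refine (inducesIso_linearEmb (I := finSumIndex m h) hκ).vanishes totalImage_graded ?_ ?_
  · exact fun F e n x hF hx l => mul_mem_polyPiece' (mem_polyPiece_iff.mpr hF) (hx l) (by ring)
  · rcases lt_or_ge p 2 with h2 | h2
    · exact vanishes_totalCocycle_zero hκ hZ (by omega) (hj h2)
    · exact hZ p (-1) 0 h2 (by ring)

end LinearPresentation

/-! ### The Čech complex and the Koszul complexes of powers -/

section Bridge

variable {k : Type*} [Field k] {r : ℕ} {M : Type*} [AddCommGroup M]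
  [Module (MvPolynomial (Fin r) k) M]

local notation "𝔸" => MvPolynomial (Fin r) k

/-- A family of subgroups, extended by zero to negative degrees. -/
def extendPiece {M : Type*} [AddCommGroup M] (ℳ : ℕ → AddSubgroup M) (n : ℤ) : AddSubgroup M :=
  if 0 ≤ n then ℳ n.toNat else ⊥

theorem extendPiece_natCast {M : Type*} [AddCommGroup M] (ℳ : ℕ → AddSubgroup M) (n : ℕ) :
    extendPiece ℳ n = ℳ n := by simp [extendPiece]

theorem extendPiece_of_neg {M : Type*} [AddCommGroup M] (ℳ : ℕ → AddSubgroup M) {n : ℤ}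
    (hn : n < 0) : extendPiece ℳ n = ⊥ := if_neg (not_le.mpr hn)

theorem isGradedFamily_extendPiece {ℳ : ℕ → AddSubgroup M}
    (hℳ : ∀ (F : 𝔸) (e n : ℕ) (x : M), F.IsHomogeneous e → x ∈ ℳ n → F • x ∈ ℳ (n + e)) :
    IsGradedFamily k r (extendPiece ℳ) := by
  intro F e n x hF hx
  rcases lt_or_ge n 0 with hn | hn
  · rw [extendPiece_of_neg ℳ hn, AddSubgroup.mem_bot] at hx
    rw [hx, smul_zero]; exact zero_mem _
  · lift n to ℕ using hn
    rw [extendPiece_natCast] at hx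
    rw [← Nat.cast_add, extendPiece_natCast]
    exact hℳ F e n x hF hx

theorem prod_X_mem_varMonoid (σ : Finset (Fin r)) : (∏ i ∈ σ, X i : 𝔸) ∈ varMonoid k σ :=
  prod_mem fun i hi => Submonoid.subset_closure ⟨i, hi, rfl⟩

variable (k M) in
/-- The map `u ↦ u / T_σ^a`. -/
def fraction (σ : Finset (Fin r)) (a : ℕ) : M →ₗ[𝔸] LocalizedModule (varMonoid k σ) M where
  toFun u := LocalizedModule.mk u ⟨(∏ i ∈ σ, X i) ^ a, pow_mem (prod_X_mem_varMonoid σ) a⟩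
  map_add' u v := by
    rw [LocalizedModule.mk_add_mk, ← smul_add, LocalizedModule.mk_cancel_common_left]
  map_smul' F u := by
    rw [RingHom.id_apply, LocalizedModule.smul'_mk]

theorem fraction_apply (σ : Finset (Fin r)) (a : ℕ) (u : M) : fraction k M σ a u =
    LocalizedModule.mk u ⟨(∏ i ∈ σ, X i) ^ a, pow_mem (prod_X_mem_varMonoid σ) a⟩ := rfl

theorem fraction_add (σ : Finset (Fin r)) (a b : ℕ) (u : M) :
    fraction k M σ (a + b) (((∏ i ∈ σ, X i) ^ b : 𝔸) • u) = fraction k M σ a u := by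
  rw [fraction_apply, fraction_apply, LocalizedModule.mk_eq]
  refine ⟨1, ?_⟩
  simp only [Submonoid.smul_def, smul_smul, one_smul]
  rw [pow_add]

theorem exists_monomial_of_mem {σ : Finset (Fin r)} {s : 𝔸} (hs : s ∈ varMonoid k σ) :
    ∃ m : Fin r →₀ ℕ, s = monomial m 1 ∧ ∀ i ∉ σ, m i = 0 := by
  induction hs using Submonoid.closure_induction with
  | mem x hx =>
    obtain ⟨i, hi, rfl⟩ := hx
    refine ⟨Finsupp.single i 1, rfl, fun i' hi' => ?_⟩
    rw [Finsupp.single_apply, if_neg]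
    rintro rfl
    exact hi' hi
  | one => exact ⟨0, rfl, fun _ _ => rfl⟩
  | mul x y _ _ hx hy =>
    obtain ⟨m, rfl, hm⟩ := hx
    obtain ⟨n, rfl, hn⟩ := hy
    exact ⟨m + n, by rw [monomial_mul, mul_one], fun i hi => by simp [hm i hi, hn i hi]⟩

/-- The denominators are monomials in the variables of σ, and such a monomial divides T_σ^a as soon
as a exceeds all its exponents. -/
theorem exists_mul_eq_pow {σ : Finset (Fin r)} {s : 𝔸} (hs : s ∈ varMonoid k σ) :
    ∃ (N : ℕ) (D : ℕ), s.IsHomogeneous D ∧ ∀ a, N ≤ a → D ≤ a * σ.card ∧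
      ∃ t : 𝔸, t.IsHomogeneous (a * σ.card - D) ∧ t * s = (∏ i ∈ σ, X i) ^ a := by
  obtain ⟨m, rfl, hm⟩ := exists_monomial_of_mem hs
  have hD : ∑ i ∈ σ, m i = m.degree := by
    rw [Finsupp.degree_eq_sum]
    exact Finset.sum_subset (Finset.subset_univ _) fun i _ hi => hm i hi
  refine ⟨m.degree, m.degree, isHomogeneous_monomial _ rfl, fun a ha => ?_⟩
  have hle : ∀ i, m i ≤ a := fun i => (Finsupp.le_degree i m).trans ha
  have e : ∑ i ∈ σ, (a - m i) + m.degree = a * σ.card := by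
    rw [← hD, ← Finset.sum_add_distrib, Finset.sum_congr rfl fun i _ => Nat.sub_add_cancel (hle i)]
    simp [mul_comm]
  refine ⟨by omega, ∏ i ∈ σ, X i ^ (a - m i), ?_, ?_⟩
  · have := IsHomogeneous.prod σ (fun i => (X i ^ (a - m i) : 𝔸)) (fun i => a - m i)
      fun i _ => by simpa using (isHomogeneous_X k i).pow (a - m i)
    rwa [show a * σ.card - m.degree = ∑ i ∈ σ, (a - m i) by omega]
  · have e2 : (monomial m (1 : k)) = ∏ i ∈ σ, X i ^ m i := by
      rw [monomial_eq, C_1, one_mul, Finsupp.prod]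
      refine Finset.prod_subset (fun i hi => ?_) fun i _ hi => ?_
      · by_contra h
        exact (Finsupp.mem_support_iff.mp hi) (hm i h)
      · rw [Finsupp.notMem_support_iff.mp hi, pow_zero]
    rw [e2, ← Finset.prod_mul_distrib, ← Finset.prod_pow]
    exact Finset.prod_congr rfl fun i _ => by rw [← pow_add, Nat.sub_add_cancel (hle i)]

/-- The statement covers all large exponents, so that finitely many fractions can be given the same
one. -/
theorem exists_eq_fraction {ℳ : ℕ → AddSubgroup M}
    (hℳ : ∀ (F : 𝔸) (e n : ℕ) (x : M), F.IsHomogeneous e → x ∈ ℳ n → F • x ∈ ℳ (n + e))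
    {σ : Finset (Fin r)} {j : ℤ} {z : LocalizedModule (varMonoid k σ) M}
    (hz : z ∈ locDegree ℳ σ j) : ∃ N : ℕ, ∀ a, N ≤ a →
      ∃ u ∈ extendPiece ℳ (j + a * σ.card), z = fraction k M σ a u := by
  induction hz using AddSubgroup.closure_induction with
  | mem z hz =>
    obtain ⟨a₀, b, u, s, hu, hs, hj, rfl⟩ := hz
    obtain ⟨N, D, hD, h⟩ := exists_mul_eq_pow s.2
    have hs0 : (s : 𝔸) ≠ 0 := by
      obtain ⟨m, hm, -⟩ := exists_monomial_of_mem s.2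
      rw [hm]; simp
    obtain rfl := hs.inj_right hD hs0
    refine ⟨N, fun a ha => ?_⟩
    obtain ⟨hle, t, ht, e⟩ := h a ha
    refine ⟨t • u, ?_, ?_⟩
    · have := hℳ t _ _ u ht hu
      rw [← extendPiece_natCast ℳ] at this
      convert this using 2
      push_cast [Nat.cast_sub hle]
      rw [← hj]; ring
    · rw [fraction_apply, LocalizedModule.mk_eq]
      refine ⟨1, ?_⟩
      simp only [Submonoid.smul_def, smul_smul, ← e, one_smul]
      rw [mul_comm]
  | zero => exact ⟨0, fun a _ => ⟨0, zero_mem _, (map_zero _).symm⟩⟩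
  | add x y _ _ hx hy =>
    obtain ⟨N, hN⟩ := hx
    obtain ⟨N', hN'⟩ := hy
    refine ⟨max N N', fun a ha => ?_⟩
    obtain ⟨u, hu, rfl⟩ := hN a (le_of_max_le_left ha)
    obtain ⟨v, hv, rfl⟩ := hN' a (le_of_max_le_right ha)
    exact ⟨u + v, add_mem hu hv, (map_add _ _ _).symm⟩
  | neg x _ hx =>
    obtain ⟨N, hN⟩ := hx
    refine ⟨N, fun a ha => ?_⟩
    obtain ⟨u, hu, rfl⟩ := hN a ha
    exact ⟨-u, neg_mem hu, (map_neg _ _).symm⟩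

theorem fraction_mem_locDegree {ℳ : ℕ → AddSubgroup M} {σ : Finset (Fin r)} {j : ℤ} {a : ℕ} {u : M}
    (hu : u ∈ extendPiece ℳ (j + a * σ.card)) : fraction k M σ a u ∈ locDegree ℳ σ j := by
  rcases lt_or_ge (j + a * σ.card) 0 with hn | hn
  · rw [extendPiece_of_neg ℳ hn, AddSubgroup.mem_bot] at hu
    rw [hu, map_zero]; exact zero_mem _
  · obtain ⟨n, hn⟩ := Int.eq_ofNat_of_zero_le hn
    rw [hn, extendPiece_natCast] at hu
    refine AddSubgroup.subset_closure ⟨n, a * σ.card, u, _, hu, ?_, ?_, rfl⟩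
    · rw [mul_comm]; exact (isHomogeneous_prod_X k σ).pow a
    · push_cast; linarith

theorem cechRes_fraction {σ τ : Finset (Fin r)} (h : σ ⊆ τ) (a : ℕ) (u : M) :
    cechRes h (fraction k M σ a u) = fraction k M τ a (((∏ i ∈ τ \ σ, X i) ^ a : 𝔸) • u) := by
  rw [fraction_apply, fraction_apply, IsLocalizedModule.mk_eq_mk', cechRes,
    LocalizedModule.liftOfLE, IsLocalizedModule.liftOfLE_mk', ← IsLocalizedModule.mk_eq_mk',
    LocalizedModule.mk_eq]
  refine ⟨1, ?_⟩
  simp only [Submonoid.smul_def, smul_smul, one_smul]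
  rw [← mul_pow, mul_comm, Finset.prod_sdiff h]

/-- Passing from the denominator T_(τ∖i)^a to T_τ^a multiplies the numerator by T_i^a, which is the
Koszul coefficient. -/
theorem cechD_fraction (a : ℕ) (u : Finset (Fin r) → M) :
    cechD (k := k) (fun σ => fraction k M σ a (u σ)) =
      fun σ => fraction k M σ a (koszulD k r M a u σ) := by
  funext τ
  rw [koszulD_apply, map_sum]
  change ∑ i ∈ τ, _ = _
  refine Finset.sum_congr rfl fun i hi => ?_
  rw [cechRes_fraction, map_smul, Finset.sdiff_erase hi, Finset.sdiff_self, insert_empty_eq,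
    Finset.prod_singleton, map_smul, map_smul, smul_comm]
  rfl

theorem exists_pow_smul_eq_zero {σ : Finset (Fin r)} {a : ℕ} {u : M} (h : fraction k M σ a u = 0) :
    ∃ N : ℕ, ∀ b, N ≤ b → ((∏ i ∈ σ, X i) ^ b : 𝔸) • u = 0 := by
  rw [← LocalizedModule.zero_mk 1, fraction_apply, LocalizedModule.mk_eq] at h
  obtain ⟨s, hs⟩ := h
  simp only [one_smul, smul_zero] at hs
  obtain ⟨N, D, -, h⟩ := exists_mul_eq_pow s.2
  refine ⟨N, fun b hb => ?_⟩
  obtain ⟨-, t, -, e⟩ := h b hb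
  rw [← e, mul_smul]
  rw [Submonoid.smul_def] at hs
  rw [hs, smul_zero]

/-- The vanishing of the local cohomology of the Čech complex. -/
theorem CohomologyVanishes.subsingleton {ℳ : ℕ → AddSubgroup M}
    (hℳ : ∀ (F : 𝔸) (e n : ℕ) (x : M), F.IsHomogeneous e → x ∈ ℳ n → F • x ∈ ℳ (n + e))
    {p : ℕ} {j : ℤ} (hV : CohomologyVanishes k r p j (extendPiece ℳ) (fun _ => ⊥)) :
    Subsingleton (LocalCohomology (k := k) (r := r) ℳ p j) := by
  classical
  rw [QuotientAddGroup.subsingleton_iff, eq_top_iff]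
  rintro ⟨c, ⟨hc0, hcj⟩, hdc⟩ -
  rw [AddSubgroup.mem_addSubgroupOf]
  change cechD c = 0 at hdc
  change c ∈ _
  choose N hN using fun σ => exists_eq_fraction hℳ (hcj σ)
  choose u hu hcu using fun σ => hN σ (∑ σ, N σ) (Finset.single_le_sum (fun _ _ => Nat.zero_le _)
    (Finset.mem_univ σ))
  set a := ∑ σ, N σ
  set u' : Finset (Fin r) → M := fun σ => if σ.card = p then u σ else 0 with hu'
  have hu'm : u' ∈ koszulCochain (extendPiece ℳ) p j a := fun σ =>
    ⟨fun h => if_neg fun h' => h (by rw [h']), by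
      rw [hu']; dsimp only; split_ifs; exacts [hu σ, zero_mem _]⟩
  have hc : c = fun σ => fraction k M σ a (u' σ) := by
    funext σ
    rw [hu']; dsimp only; split_ifs with h
    · exact hcu σ
    · rw [hc0 σ h, map_zero]
  rw [hc, cechD_fraction] at hdc
  -- The numerators form a Koszul cocycle only after a further shift, since fractions vanish up to
  -- powers of T_σ.
  choose N' hN' using fun σ => exists_pow_smul_eq_zero (congrFun hdc σ)
  have hN'' := fun σ => hN' σ (∑ σ, N' σ) (Finset.single_le_sum (fun _ _ => Nat.zero_le _)
    (Finset.mem_univ σ))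
  set b := ∑ σ, N' σ
  have hgr := isGradedFamily_extendPiece hℳ
  obtain ⟨b', v, hv, hvu⟩ := hV (a + b) (koszulShift k r M b u') (koszulShift_mem hgr hu'm) (by
    rw [koszulD_koszulShift, show koszulShift k r M b (koszulD k r M a u') = 0 from funext hN'']
    exact zero_mem _)
  have hvu' : koszulD k r M (a + b + b') v = koszulShift k r M b' (koszulShift k r M b u') := by
    rw [← sub_eq_zero]
    exact funext fun σ => AddSubgroup.mem_bot.mp (hvu σ).2
  have hcv : cechD (k := k) (fun σ => fraction k M σ (a + b + b') (v σ)) = c := by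
    rw [cechD_fraction, hvu', hc]
    funext σ
    rw [koszulShift_apply, fraction_add, koszulShift_apply, fraction_add]
  rw [← hcv]
  -- For p = 0 the primitive lives on sets with -1 elements, so it is zero and the cocycle vanishes.
  rcases p with _ | q
  · have : v = 0 := funext fun σ => (hv σ).1 (by push_cast; omega)
    rw [this]
    simp only [Pi.zero_apply, map_zero]
    rw [show (fun σ => 0 : CechCochain k r M) = 0 from rfl, map_zero]
    exact zero_mem _
  · refine AddSubgroup.mem_iSup_of_mem q (AddSubgroup.mem_iSup_of_mem rfl
      ⟨fun σ => fraction k M σ (a + b + b') (v σ), ⟨?_, ?_⟩, rfl⟩)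
    · intro σ hσ
      dsimp only
      rw [(hv σ).1 (by push_cast; omega), map_zero]
    · exact fun σ => fraction_mem_locDegree (hv σ).2

theorem regularity_le {ℳ : ℕ → AddSubgroup M}
    (hℳ : ∀ (F : 𝔸) (e n : ℕ) (x : M), F.IsHomogeneous e → x ∈ ℳ n → F • x ∈ ℳ (n + e)) {c : ℤ}
    (hV : ∀ (p : ℕ) (j : ℤ), c < j + p →
      CohomologyVanishes k r p j (extendPiece ℳ) (fun _ => ⊥)) :
    regularity k r ℳ ≤ ((c : ℝ) : EReal) := by
  refine iSup_le fun p => iSup_le fun j => iSup_le fun hn => ?_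
  rw [EReal.coe_le_coe_iff, Int.cast_le]
  by_contra h
  have := (hV p j (not_le.mp h)).subsingleton hℳ
  exact not_subsingleton _ this

theorem regularity_eq_bot {ℳ : ℕ → AddSubgroup M} [Subsingleton M] :
    regularity k r ℳ = ⊥ := by
  rw [eq_bot_iff]
  refine iSup_le fun p => iSup_le fun j => iSup_le fun hn => ?_
  have h0 : ∀ σ, Subsingleton (LocalizedModule (varMonoid k (r := r) σ) M) := fun σ => by
    refine ⟨fun x y => ?_⟩
    induction x with | _ m s =>
    induction y with | _ m' s' =>
    rw [LocalizedModule.mk_eq]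
    exact ⟨1, Subsingleton.elim _ _⟩
  have h1 : Subsingleton (CechCochain k r M) := Pi.instSubsingleton
  obtain ⟨x, y, hxy⟩ := hn
  refine absurd ?_ hxy
  induction x using QuotientAddGroup.induction_on with | _ x =>
  induction y using QuotientAddGroup.induction_on with | _ y =>
  rw [Subsingleton.elim x y]

end Bridge

/-! ### Regularity of a homogeneous ideal and of its quotient ring -/

section Ideals

variable {k : Type*} [Field k] {r : ℕ} {I : Ideal (MvPolynomial (Fin r) k)}

local notation "𝔸" => MvPolynomial (Fin r) k

/-- The homogeneous elements of an ideal, as polynomials. -/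
def idealFamily (I : Ideal 𝔸) (n : ℤ) : AddSubgroup 𝔸 :=
  polyPiece k r n ⊓ I.toAddSubgroup

theorem polyPiece_graded : IsGradedFamily k r (polyPiece k r) :=
  fun _ _ _ _ hF hx => mul_mem_polyPiece' (mem_polyPiece_iff.mpr hF) hx (by ring)

theorem idealFamily_graded (I : Ideal 𝔸) : IsGradedFamily k r (idealFamily I) :=
  fun F e n x hF hx => ⟨polyPiece_graded F e n x hF hx.1, I.mul_mem_left F hx.2⟩

theorem idealFamily_le (I : Ideal 𝔸) (n : ℤ) : idealFamily I n ≤ polyPiece k r n := inf_le_left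

theorem regIdeal_le {c : ℤ} (hV : ∀ (p : ℕ) (j : ℤ), c < j + p →
    CohomologyVanishes k r p j (idealFamily I) (fun _ => ⊥)) :
    regIdeal I ≤ ((c : ℝ) : EReal) := by
  have h1 : ∀ (n : ℤ) (x : I), x ∈ extendPiece (idealPiece I) n ↔ (x : 𝔸) ∈ idealFamily I n := by
    intro n x
    rcases lt_or_ge n 0 with hn | hn
    · rw [extendPiece_of_neg _ hn, AddSubgroup.mem_bot]
      constructor
      · rintro rfl; exact zero_mem _
      · exact fun h => Subtype.ext (polyPiece_of_neg hn h.1)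
    · lift n to ℕ using hn
      rw [extendPiece_natCast]
      exact ⟨fun h => ⟨mem_polyPiece_iff.mpr h, x.2⟩, fun h => mem_polyPiece_iff.mp h.1⟩
  have hgr : ∀ (F : 𝔸) (e n : ℕ) (x : I), F.IsHomogeneous e → x ∈ idealPiece I n →
      F • x ∈ idealPiece I (n + e) := fun F e n x hF hx => by
    have : ((F • x : I) : 𝔸).IsHomogeneous (n + e) := by
      rw [add_comm]; exact hF.mul hx
    exact this
  refine regularity_le hgr fun p j hpj => ?_
  have h2 : InducesIso I.subtype (extendPiece (idealPiece I)) (fun _ => ⊥) (idealFamily I)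
      (fun _ => ⊥) :=
    { map_mem := fun n x hx => (h1 n x).mp hx
      map_mem_sub := fun n x hx => by
        rw [AddSubgroup.mem_bot] at hx ⊢; rw [hx, map_zero]
      surj := fun n y hy => ⟨⟨y, hy.2⟩, (h1 n _).mpr hy, by simp⟩
      inj := fun n x _ hx => by
        rw [AddSubgroup.mem_bot] at hx ⊢; exact Subtype.ext hx }
  exact h2.vanishes isGradedFamily_bot (isGradedFamily_extendPiece hgr) (hV p j hpj)

theorem regQuotient_le {c : ℤ} (hV : ∀ (p : ℕ) (j : ℤ), c < j + p →
    CohomologyVanishes k r p j (polyPiece k r) (idealFamily I)) :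
    regQuotient I ≤ ((c : ℝ) : EReal) := by
  have h0 : ∀ n : ℕ, extendPiece (fun n => (quotientPiece I n).toAddSubgroup) n =
      (quotientPiece I n).toAddSubgroup := extendPiece_natCast _
  have hgr : ∀ (F : 𝔸) (e n : ℕ) (x : 𝔸 ⧸ I), F.IsHomogeneous e →
      x ∈ (quotientPiece I n).toAddSubgroup → F • x ∈ (quotientPiece I (n + e)).toAddSubgroup := by
    rintro F e n _ hF ⟨y, hy, rfl⟩
    refine ⟨F * y, ?_, rfl⟩
    rw [add_comm]
    exact hF.mul hy
  refine regularity_le hgr fun p j hpj => ?_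
  have h2 : InducesIso I.mkQ (polyPiece k r) (idealFamily I)
      (extendPiece fun n => (quotientPiece I n).toAddSubgroup) (fun _ => ⊥) :=
    { map_mem := fun n x hx => by
        rcases lt_or_ge n 0 with hn | hn
        · rw [polyPiece_of_neg hn hx, map_zero]; exact zero_mem _
        · lift n to ℕ using hn
          rw [h0]
          exact ⟨x, mem_polyPiece_iff.mp hx, rfl⟩
      map_mem_sub := fun n x hx => by
        rw [AddSubgroup.mem_bot]; exact (Submodule.Quotient.mk_eq_zero I).mpr hx.2
      surj := fun n y hy => by
        rcases lt_or_ge n 0 with hn | hn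
        · rw [extendPiece_of_neg _ hn, AddSubgroup.mem_bot] at hy
          exact ⟨0, zero_mem _, by simp [hy]⟩
        · lift n to ℕ using hn
          rw [h0] at hy
          obtain ⟨x, hx, rfl⟩ := hy
          exact ⟨x, mem_polyPiece_iff.mpr hx, AddSubgroup.mem_bot.mpr (sub_self _)⟩
      inj := fun n x hx h => ⟨hx, (Submodule.Quotient.mk_eq_zero I).mp (AddSubgroup.mem_bot.mp h)⟩ }
  exact h2.vanishes' isGradedFamily_bot polyPiece_graded (hV p j hpj)

end Ideals

/-! ### Homogeneous pieces with integer degrees -/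

section Component

variable {k : Type*} [CommRing k] {r : ℕ}

local notation "𝔸" => MvPolynomial (Fin r) k

variable (k r) in
/-- The homogeneous component of degree `n`, where `n` may be negative. -/
def component (n : ℤ) : 𝔸 →ₗ[k] 𝔸 :=
  if 0 ≤ n then homogeneousComponent n.toNat else 0

theorem coeff_component (n : ℤ) (F : 𝔸) (m : Fin r →₀ ℕ) :
    coeff m (component k r n F) = if (m.degree : ℤ) = n then coeff m F else 0 := by
  unfold component
  split_ifs with h0 h1 h1
  · rw [coeff_homogeneousComponent, if_pos (by omega)]
  · rw [coeff_homogeneousComponent, if_neg (by omega)]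
  · omega
  · simp

theorem component_mem (n : ℤ) (F : 𝔸) : component k r n F ∈ polyPiece k r n := by
  intro m hm
  rw [coeff_component] at hm
  by_contra h
  rw [if_neg h] at hm
  exact hm rfl

theorem component_of_mem {n : ℤ} {F : 𝔸} (hF : F ∈ polyPiece k r n) : component k r n F = F := by
  ext m
  rw [coeff_component]
  split_ifs with h
  · rfl
  · by_contra h'
    exact h (hF m (Ne.symm h'))

theorem component_of_mem_of_ne {n n' : ℤ} {F : 𝔸} (hF : F ∈ polyPiece k r n') (h : n' ≠ n) :
    component k r n F = 0 := by
  ext m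
  rw [coeff_component, coeff_zero]
  split_ifs with h1
  · by_contra h'
    exact h ((hF m h').symm.trans h1)
  · rfl

theorem sum_component (F : 𝔸) :
    ∑ i ∈ Finset.range (F.totalDegree + 1), component k r i F = F := by
  conv_rhs => rw [← sum_homogeneousComponent F]
  exact Finset.sum_congr rfl fun i _ => by simp [component]

theorem component_mul {e : ℤ} {G : 𝔸} (hG : G ∈ polyPiece k r e) (n : ℤ) (F : 𝔸) :
    component k r n (F * G) = component k r (n - e) F * G := by
  conv_lhs => rw [← sum_component F]
  conv_rhs => rw [← sum_component F]
  rw [Finset.sum_mul, map_sum, map_sum, Finset.sum_mul]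
  refine Finset.sum_congr rfl fun i _ => ?_
  by_cases h : (i : ℤ) = n - e
  · rw [component_of_mem (n := n) (mul_mem_polyPiece' (component_mem _ _) hG (by omega)),
      component_of_mem (n := n - e) (by rw [← h]; exact component_mem _ _)]
  · rw [component_of_mem_of_ne (mul_mem_polyPiece (component_mem _ _) hG) (by omega),
      component_of_mem_of_ne (component_mem _ _) h, zero_mul]

theorem component_sum_mul {ι : Type*} {s : Finset ι} {F G : ι → 𝔸} {e : ι → ℤ}
    (hG : ∀ i ∈ s, G i ∈ polyPiece k r (e i)) (n : ℤ) :
    component k r n (∑ i ∈ s, F i * G i) = ∑ i ∈ s, component k r (n - e i) (F i) * G i := by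
  rw [map_sum]
  exact Finset.sum_congr rfl fun i hi => component_mul (hG i hi) n (F i)

theorem eq_zero_of_component {F : 𝔸} (h : ∀ n, component k r n F = 0) : F = 0 := by
  rw [← sum_component F]
  exact Finset.sum_eq_zero fun i _ => h i

/-- Cofactors of a homogeneous element which divides a homogeneous element are homogeneous. -/
theorem mem_polyPiece_of_mul [IsDomain k] {e n : ℤ} {F G : 𝔸} (hG : G ∈ polyPiece k r e) (hG0 : G ≠ 0)
    (h : F * G ∈ polyPiece k r n) : F ∈ polyPiece k r (n - e) := by
  have h1 := component_mul hG n F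
  rw [component_of_mem h] at h1
  rw [mul_right_cancel₀ hG0 h1]
  exact component_mem _ _

theorem C_mem_polyPiece (c : k) : C c ∈ polyPiece k r 0 :=
  mem_polyPiece_iff.mpr (isHomogeneous_C _ _)

theorem X_mem_polyPiece (i : Fin r) : (X i : 𝔸) ∈ polyPiece k r 1 :=
  mem_polyPiece_iff.mpr (isHomogeneous_X k i)

theorem X_pow_mem_polyPiece (i : Fin r) (a : ℕ) : (X i ^ a : 𝔸) ∈ polyPiece k r a :=
  mem_polyPiece_iff.mpr (isHomogeneous_X_pow i a)

theorem mem_polyPiece_zero {F : 𝔸} (hF : F ∈ polyPiece k r 0) : ∃ c, F = C c := by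
  rw [← Nat.cast_zero, mem_polyPiece_iff] at hF
  exact ⟨coeff 0 F, by rw [← homogeneousComponent_zero, homogeneousComponent_eq_self hF]⟩

end Component

/-! ### Finite-dimensional spaces of forms -/

section FormSpace

variable {k : Type*} [Field k] {r : ℕ}

local notation "𝔸" => MvPolynomial (Fin r) k

variable (k r) in
/-- The forms of degree `n`, as a vector space. -/
def formSpace (n : ℤ) : Submodule k (MvPolynomial (Fin r) k) where
  __ := polyPiece k r n
  smul_mem' c F hF m hm := hF m fun h => hm (by
    change coeff m (c • F) = 0
    rw [coeff_smul, h, smul_zero])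

theorem mem_formSpace {n : ℤ} {F : 𝔸} : F ∈ formSpace k r n ↔ F ∈ polyPiece k r n := Iff.rfl

theorem formSpace_natCast (n : ℕ) : formSpace k r n = homogeneousSubmodule (Fin r) k n := by
  ext F
  rw [mem_formSpace, mem_polyPiece_iff, mem_homogeneousSubmodule]

theorem formSpace_of_neg {n : ℤ} (hn : n < 0) : formSpace k r n = ⊥ := by
  rw [eq_bot_iff]
  exact fun F hF => polyPiece_of_neg hn hF

instance (n : ℤ) : FiniteDimensional k (formSpace k r n) := by
  rcases lt_or_ge n 0 with h | h
  · rw [formSpace_of_neg h]; infer_instance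
  · lift n to ℕ using h
    rw [formSpace_natCast]
    exact Module.Finite.iff_fg.mpr (homogeneousSubmodule_fg _ _ _)

end FormSpace

/-! ### Forms in two variables -/

section TwoVariables

variable {k : Type*} [Field k]

local notation "ℛ" => MvPolynomial (Fin 2) k

/-- The exponent of `x ^ i * y ^ (n - i)`. -/
def binaryExponent (n i : ℕ) : Fin 2 →₀ ℕ := Finsupp.single 0 i + Finsupp.single 1 (n - i)

theorem binaryExponent_degree {n i : ℕ} (h : i ≤ n) : (binaryExponent n i).degree = n := by
  rw [binaryExponent, map_add, Finsupp.degree_single, Finsupp.degree_single]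
  omega

theorem eq_binaryExponent {m : Fin 2 →₀ ℕ} {n : ℕ} (h : m.degree = n) :
    m = binaryExponent n (m 0) := by
  rw [Finsupp.degree_eq_sum, Fin.sum_univ_two] at h
  ext i
  fin_cases i
  · simp [binaryExponent]
  · simp [binaryExponent]; omega

theorem le_of_degree {m : Fin 2 →₀ ℕ} {n : ℕ} (h : m.degree = n) : m 0 ≤ n := by
  rw [Finsupp.degree_eq_sum, Fin.sum_univ_two] at h
  omega

/-- The coordinates of binary forms. -/
def binaryFormEquiv (n : ℕ) : formSpace k 2 n ≃ₗ[k] (Fin (n + 1) → k) where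
  toFun F i := coeff (binaryExponent n i) (F : ℛ)
  map_add' F G := by funext i; simp
  map_smul' c F := by funext i; simp
  invFun v := ⟨∑ i : Fin (n + 1), monomial (binaryExponent n i) (v i), sum_mem fun i _ =>
    mem_polyPiece_iff.mpr (isHomogeneous_monomial _ (binaryExponent_degree (by omega)))⟩
  left_inv F := by
    obtain ⟨F, hF⟩ := F
    ext m
    rw [coeff_sum]
    simp only [coeff_monomial]
    by_cases hm : m.degree = n
    · rw [Finset.sum_eq_single ⟨m 0, by have := le_of_degree hm; omega⟩]
      · rw [← eq_binaryExponent hm, if_pos rfl]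
      · intro i _ hi
        refine if_neg fun e => hi ?_
        ext
        simp [← e, binaryExponent]
      · simp
    · rw [Finset.sum_eq_zero, eq_comm]
      · by_contra h
        exact hm (by exact_mod_cast hF m h)
      · exact fun i _ => if_neg fun e => hm (by rw [← e, binaryExponent_degree (by omega)])
  right_inv v := by
    funext i
    simp only [coeff_sum, coeff_monomial]
    rw [Finset.sum_eq_single i]
    · simp
    · intro j _ hj
      refine if_neg fun e => hj ?_
      have := DFunLike.congr_fun e 0
      ext
      simpa [binaryExponent] using this
    · simp

theorem finrank_formSpace (n : ℤ) : Module.finrank k (formSpace k 2 n) = (n + 1).toNat := by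
  rcases lt_or_ge n 0 with h | h
  · rw [formSpace_of_neg h, finrank_bot]; omega
  · lift n to ℕ using h
    rw [(binaryFormEquiv n).finrank_eq]
    simp

/-- Forms of large degree are combinations of two coprime forms. -/
theorem exists_eq_add_of_isRelPrime {D₁ D₂ e : ℤ} {g₁ g₂ : ℛ} (h₁ : g₁ ∈ polyPiece k 2 D₁)
    (h₂ : g₂ ∈ polyPiece k 2 D₂) (hg₁ : g₁ ≠ 0) (hg₂ : g₂ ≠ 0) (hg : IsRelPrime g₁ g₂)
    (he : D₁ + D₂ - 1 ≤ e)
    {F : ℛ} (hF : F ∈ polyPiece k 2 e) : ∃ a ∈ polyPiece k 2 (e - D₁), ∃ b ∈ polyPiece k 2 (e - D₂),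
      F = a * g₁ + b * g₂ := by
  have hD : ∀ {D : ℤ} {g : ℛ}, g ∈ polyPiece k 2 D → g ≠ 0 → 0 ≤ D := fun h h0 => by
    by_contra hn
    exact h0 (polyPiece_of_neg (not_le.mp hn) h)
  have hD₁ := hD h₁ hg₁
  have hD₂ := hD h₂ hg₂
  let φ : formSpace k 2 (e - D₁) × formSpace k 2 (e - D₂) →ₗ[k] formSpace k 2 e :=
    { toFun := fun p => ⟨p.1 * g₁ + p.2 * g₂, add_mem (mul_mem_polyPiece' p.1.2 h₁ (by ring))
        (mul_mem_polyPiece' p.2.2 h₂ (by ring))⟩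
      map_add' := fun p q => by ext1; simp; ring
      map_smul' := fun c p => by ext1; simp }
  let ψ : formSpace k 2 (e - D₁ - D₂) →ₗ[k] formSpace k 2 (e - D₁) × formSpace k 2 (e - D₂) :=
    { toFun := fun c => (⟨c * g₂, mul_mem_polyPiece' c.2 h₂ (by ring)⟩,
        ⟨-(c * g₁), neg_mem (mul_mem_polyPiece' c.2 h₁ (by ring))⟩)
      map_add' := fun p q => by ext1 <;> ext1 <;> simp <;> ring
      map_smul' := fun c p => by ext1 <;> ext1 <;> simp }
  -- Coprimality leaves only the Koszul relations between g₁ and g₂.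
  have hker : LinearMap.ker φ ≤ LinearMap.range ψ := by
    rintro ⟨⟨a, ha⟩, ⟨b, hb⟩⟩ hab
    have hab' : a * g₁ + b * g₂ = 0 := congrArg Subtype.val hab
    obtain ⟨c, rfl⟩ : g₂ ∣ a := hg.symm.dvd_of_dvd_mul_right
      ⟨-b, by linear_combination hab'⟩
    have hb' : b = -(c * g₁) := mul_right_cancel₀ hg₂ (by linear_combination hab')
    subst hb'
    refine ⟨⟨c, ?_⟩, ?_⟩
    · rw [mul_comm] at ha
      exact mem_polyPiece_of_mul h₂ hg₂ ha
    · ext1 <;> ext1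
      · exact mul_comm _ _
      · rfl
  have hr := LinearMap.finrank_range_add_finrank_ker φ
  have hk := (Submodule.finrank_mono hker).trans (LinearMap.finrank_range_le ψ)
  rw [Module.finrank_prod] at hr
  simp only [finrank_formSpace] at hr hk
  -- For e ≥ D₁ + D₂ - 1 the dimensions add up without truncation: (e - D₁ + 1) + (e - D₂ + 1) - (e
  -- - D₁ - D₂ + 1) = e + 1.
  have htop : LinearMap.range φ = ⊤ := by
    apply Submodule.eq_top_of_finrank_eq
    refine le_antisymm (Submodule.finrank_le _) ?_
    rw [finrank_formSpace]
    omega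
  obtain ⟨⟨a, b⟩, hab⟩ := LinearMap.range_eq_top.mp htop ⟨F, hF⟩
  exact ⟨a, a.2, b, b.2, (congrArg Subtype.val hab).symm⟩

end TwoVariables

/-! ### Homogeneous prime avoidance -/

section Avoidance

variable {k : Type*} [Field k] {r : ℕ}

local notation "𝔸" => MvPolynomial (Fin r) k

/-- There are forms of every large degree outside of finitely many primes which do not contain all
variables. -/
theorem exists_form_notMem (c : ℕ) : ∀ S : Finset (Ideal 𝔸), S.card = c → (∀ P ∈ S, P.IsPrime) →
    (∀ P ∈ S, ∃ i, X i ∉ P) → ∃ E : ℕ, ∀ e, E ≤ e → ∃ ℓ : 𝔸, ℓ.IsHomogeneous e ∧ ∀ P ∈ S, ℓ ∉ P := by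
  classical
  induction c using Nat.strong_induction_on with
  | _ c ih =>
  intro S hc hprime hX
  rcases S.eq_empty_or_nonempty with rfl | hS
  · exact ⟨0, fun e _ => ⟨0, isHomogeneous_zero _ _ _, by simp⟩⟩
  -- The primes need not be homogeneous, so they are compared only through the forms they contain.
  -- Minimality of P yields, for each Q with other forms, a form in Q outside P.
  set H : Ideal 𝔸 → Set 𝔸 := fun P => {F | F ∈ P ∧ ∃ n, F.IsHomogeneous n} with hH
  obtain ⟨P, hP, hmin⟩ := S.exists_minimalFor H hS
  set S' := S.filter fun Q => H Q ≠ H P with hS'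
  have hPS' : P ∉ S' := by simp [hS']
  have hcard : S'.card < c := by
    rw [← hc]
    exact Finset.card_lt_card ⟨Finset.filter_subset _ _, fun h => hPS' (h hP)⟩
  have hsub : ∀ Q ∈ S', Q ∈ S := fun Q hQ => (Finset.mem_filter.mp hQ).1
  obtain ⟨E', hE'⟩ := ih _ hcard S' rfl (fun Q hQ => hprime Q (hsub Q hQ))
    fun Q hQ => hX Q (hsub Q hQ)
  have hex : ∀ Q ∈ S', ∃ F n, F ∈ Q ∧ F ∉ P ∧ F.IsHomogeneous n := by
    intro Q hQ
    by_contra! hcon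
    have h1 : H Q ≤ H P := by
      rintro F ⟨hF, n, hn⟩
      refine ⟨?_, n, hn⟩
      by_contra h2
      exact hcon F n hF h2 hn
    exact (Finset.mem_filter.mp hQ).2 (le_antisymm h1 (hmin (hsub Q hQ) h1))
  choose! F n hFQ hFP hFn using hex
  obtain ⟨i, hi⟩ := hX P hP
  have hPp := hprime P hP
  refine ⟨max E' (∑ Q ∈ S', n Q), fun e he => ?_⟩
  obtain ⟨ℓ, hℓ, hℓS⟩ := hE' e (le_of_max_le_left he)
  have hEq : ∀ {G : 𝔸}, G.IsHomogeneous e → G ∉ P → (∀ Q ∈ S', G ∉ Q) → ∀ Q ∈ S, G ∉ Q := by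
    intro G hG hGP hGS Q hQ hGQ
    by_cases h : H Q = H P
    · have : G ∈ H Q := ⟨hGQ, e, hG⟩
      rw [h] at this
      exact hGP this.1
    · exact hGS Q (Finset.mem_filter.mpr ⟨hQ, h⟩) hGQ
  by_cases hℓP : ℓ ∈ P
  -- This form lies in every Q of `S'` but not in P; the power of a variable outside P adjusts its
  -- degree. Adding it repairs ℓ at P without affecting the other primes.
  · set h : 𝔸 := (∏ Q ∈ S', F Q) * X i ^ (e - ∑ Q ∈ S', n Q) with hh
    have h1 : h.IsHomogeneous e := by
      have := (IsHomogeneous.prod S' F n fun Q hQ => hFn Q hQ).mul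
        (isHomogeneous_X_pow (R := k) i (e - ∑ Q ∈ S', n Q))
      rwa [add_tsub_cancel_of_le (le_of_max_le_right he)] at this
    have h2 : h ∉ P := by
      intro h3
      rcases hPp.mem_or_mem h3 with h4 | h4
      · obtain ⟨Q, hQ, h5⟩ := (hPp.prod_mem_iff).mp h4
        exact hFP Q hQ h5
      · exact hi (hPp.mem_of_pow_mem _ h4)
    refine ⟨ℓ + h, hℓ.add h1, hEq (hℓ.add h1) ?_ ?_⟩
    · exact fun h3 => h2 ((Ideal.add_mem_iff_right P hℓP).mp h3)
    · intro Q hQ h3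
      refine hℓS Q hQ ((Ideal.add_mem_iff_left Q ?_).mp h3)
      exact Ideal.mul_mem_right _ _ (Ideal.mem_of_dvd Q (Finset.dvd_prod_of_mem F hQ) (hFQ Q hQ))
  · exact ⟨ℓ, hℓ, hEq hℓ hℓP hℓS⟩

variable {f : Fin r → MvPolynomial (Fin 2) k} {d : ℕ}

/-- There are forms of every large degree whose restriction to the curve has no zeros in common with
a given form. -/
theorem IsParametrization.exists_isRelPrime (hf : IsParametrization f d)
    {G : MvPolynomial (Fin 2) k} (hG : G ≠ 0) : ∃ E : ℕ, ∀ e, E ≤ e →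
      ∃ ℓ : 𝔸, ℓ.IsHomogeneous e ∧ aeval f ℓ ≠ 0 ∧ IsRelPrime (aeval f ℓ) G := by
  classical
  -- The factor X 0 ensures that there is a prime factor to avoid even if G is a unit. It forces the
  -- value of ℓ to be nonzero.
  have hG' : G * X 0 ≠ 0 := mul_ne_zero hG (X_ne_zero 0)
  obtain ⟨E, hE⟩ := exists_form_notMem _
    ((UniqueFactorizationMonoid.factors (G * X 0)).toFinset.image fun p =>
      Ideal.comap (aeval f : 𝔸 →ₐ[k] MvPolynomial (Fin 2) k) (Ideal.span {p})) rfl (by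
    intro P hP
    simp only [Finset.mem_image, Multiset.mem_toFinset] at hP
    obtain ⟨p, hp, rfl⟩ := hP
    have hp' := UniqueFactorizationMonoid.prime_of_factor p hp
    have := (Ideal.span_singleton_prime hp'.ne_zero).mpr hp'
    exact Ideal.comap_isPrime _ _) (by
    intro P hP
    simp only [Finset.mem_image, Multiset.mem_toFinset] at hP
    obtain ⟨p, hp, rfl⟩ := hP
    have hp' := UniqueFactorizationMonoid.prime_of_factor p hp
    by_contra! hcon
    refine hp'.not_isUnit (hf.no_common_factor p fun i => ?_)
    have := hcon i
    rwa [Ideal.mem_comap, aeval_X, Ideal.mem_span_singleton] at this)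
  refine ⟨E, fun e he => ?_⟩
  obtain ⟨ℓ, hℓ, h1⟩ := hE e he
  have h2 : IsRelPrime (aeval f ℓ) (G * X 0) := by
    intro q hq1 hq2
    by_contra hq
    obtain ⟨p, hp, hpq⟩ := WfDvdMonoid.exists_irreducible_factor hq (ne_zero_of_dvd_ne_zero hG' hq2)
    obtain ⟨p', hp', h3⟩ := UniqueFactorizationMonoid.exists_mem_factors_of_dvd hG' hp
      (hpq.trans hq2)
    refine h1 _ (Finset.mem_image.mpr ⟨p', Multiset.mem_toFinset.mpr hp', rfl⟩) ?_
    rw [Ideal.mem_comap, Ideal.mem_span_singleton]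
    exact (h3.symm.dvd.trans hpq).trans hq1
  refine ⟨ℓ, hℓ, fun h0 => ?_, h2.of_mul_right_left⟩
  rw [h0, isRelPrime_zero_left] at h2
  have := isUnit_of_mul_isUnit_right h2
  have h3 : (X 0 : MvPolynomial (Fin 2) k).IsHomogeneous 0 := by
    obtain ⟨c, -, hc⟩ := (MvPolynomial.isUnit_iff_eq_C_of_isReduced).mp this
    rw [hc]; exact isHomogeneous_C _ _
  exact one_ne_zero ((isHomogeneous_X k (0 : Fin 2)).inj_right h3 (X_ne_zero 0))

theorem IsParametrization.aeval_mem (hf : IsParametrization f d) {F : 𝔸} {n : ℤ}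
    (hF : F ∈ polyPiece k r n) : aeval f F ∈ polyPiece k 2 (d * n) := by
  rcases lt_or_ge n 0 with h | h
  · rw [polyPiece_of_neg h hF, map_zero]; exact zero_mem _
  · lift n to ℕ using h
    rw [← Nat.cast_mul, mem_polyPiece_iff]
    exact (mem_polyPiece_iff.mp hF).aeval f hf.isHomogeneous

theorem IsParametrization.exists_ne_zero (hf : IsParametrization f d) : ∃ i, f i ≠ 0 := by
  by_contra! h
  exact not_isUnit_zero (hf.no_common_factor 0 fun i => by rw [h i])

/-- Every binary form of large degree lies in the ideal of two coprime forms from `k[f]`. -/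
theorem IsParametrization.exists_coprime_pair (hf : IsParametrization f d) : ∃ E : ℕ, ∀ e, E ≤ e →
    ∃ ℓ₁ ℓ₂ : 𝔸, ℓ₁.IsHomogeneous e ∧ ℓ₂.IsHomogeneous e ∧ aeval f ℓ₁ ≠ 0 ∧ aeval f ℓ₂ ≠ 0 ∧
      IsRelPrime (aeval f ℓ₁) (aeval f ℓ₂) := by
  obtain ⟨i, hi⟩ := hf.exists_ne_zero
  obtain ⟨E, hE⟩ := hf.exists_isRelPrime hi
  refine ⟨E, fun e he => ?_⟩
  obtain ⟨ℓ, h1, h2, h3⟩ := hE e he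
  exact ⟨X i ^ e, ℓ, isHomogeneous_X_pow i e, h1, by simpa using pow_ne_zero e hi, h2, by
    simpa using h3.symm.pow_left⟩

/-- Binary forms of large degree are combinations of the `f i`. -/
theorem IsParametrization.exists_eq_sum_of_large (hf : IsParametrization f d) :
    ∃ E : ℤ, ∀ e, E ≤ e → ∀ F ∈ polyPiece k 2 e, ∃ a : Fin r → MvPolynomial (Fin 2) k,
      (∀ i, a i ∈ polyPiece k 2 (e - d)) ∧ ∑ i, a i * f i = F := by
  -- A form of positive degree in the T_i takes its value in the ideal (f). The bound on n is the
  -- pigeonhole bound for a = 1.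
  have key : ∀ {n : ℕ} {ℓ : 𝔸}, r < n → ℓ.IsHomogeneous n → ∃ G : Fin r → MvPolynomial (Fin 2) k,
      (∀ i, G i ∈ polyPiece k 2 (d * n - d)) ∧ ∑ i, G i * f i = aeval f ℓ := by
    intro n ℓ hn hℓ
    obtain ⟨γ, hγ, e⟩ : ∃ γ : Fin r → 𝔸, (∀ i, (γ i).IsHomogeneous (n - 1)) ∧
        ℓ = ∑ i, γ i * X i := by
      simpa using exists_eq_sum_mul_X_pow (a := 1) hℓ (by omega) (by omega : n - 1 + 1 = n)
    refine ⟨fun i => aeval f (γ i), fun i => ?_, by simp [e]⟩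
    have := hf.aeval_mem (mem_polyPiece_iff.mpr (hγ i))
    rwa [show (d : ℤ) * ((n - 1 : ℕ) : ℤ) = d * n - d by rw [Nat.cast_sub (by omega)]; push_cast; ring] at this
  obtain ⟨E, hE⟩ := hf.exists_coprime_pair
  obtain ⟨ℓ₁, ℓ₂, h1, h2, h10, h20, hrel⟩ := hE (E + r + 1) (by omega)
  obtain ⟨G₁, hG₁, e₁⟩ := key (by omega) h1
  obtain ⟨G₂, hG₂, e₂⟩ := key (by omega) h2
  refine ⟨d * (E + r + 1 : ℕ) + d * (E + r + 1 : ℕ) - 1, fun e he F hF => ?_⟩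
  obtain ⟨a, ha, b, hb, rfl⟩ := exists_eq_add_of_isRelPrime
    (hf.aeval_mem (mem_polyPiece_iff.mpr h1)) (hf.aeval_mem (mem_polyPiece_iff.mpr h2)) h10 h20 hrel
    he hF
  refine ⟨fun i => a * G₁ i + b * G₂ i, fun i => add_mem (mul_mem_polyPiece' ha (hG₁ i) (by ring))
    (mul_mem_polyPiece' hb (hG₂ i) (by ring)), ?_⟩
  rw [← e₁, ← e₂, Finset.mul_sum, Finset.mul_sum, ← Finset.sum_add_distrib]
  exact Finset.sum_congr rfl fun i _ => by ring

end Avoidance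

/-! ### Syzygies -/

section Syzygies

variable {k : Type*} [Field k] {r d : ℕ} {f : Fin r → MvPolynomial (Fin 2) k}

local notation "ℛ" => MvPolynomial (Fin 2) k

theorem mem_syzygies {a : Fin r → ℛ} : a ∈ syzygies f ↔ ∑ i, a i * f i = 0 := by
  simp [syzygies, Fintype.linearCombination_apply]

theorem component_mem_syzygies (hf : ∀ i, f i ∈ polyPiece k 2 d) {a : Fin r → ℛ}
    (ha : a ∈ syzygies f) (n : ℤ) : (fun i => component k 2 n (a i)) ∈ syzygies f := by
  rw [mem_syzygies] at ha ⊢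
  have := component_sum_mul (s := Finset.univ) (F := a) (fun i _ => hf i) (n + d)
  rw [ha, map_zero] at this
  rw [this]
  simp

/-- The homogeneous components of a finite generating set are again syzygies, as the f_i all have
the same degree. -/
theorem exists_homogeneous_generators (hf : ∀ i, f i ∈ polyPiece k 2 d) :
    ∃ (s : ℕ) (Φ : Fin s → Fin r → ℛ) (μ : Fin s → ℕ),
      (∀ j i, Φ j i ∈ polyPiece k 2 (μ j)) ∧ Submodule.span ℛ (Set.range Φ) = syzygies f := by
  classical
  obtain ⟨S, hS⟩ := IsNoetherian.noetherian (syzygies f)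
  obtain ⟨N, hN⟩ : ∃ N, ∀ a ∈ S, ∀ i, (a i).totalDegree < N := by
    refine ⟨∑ a ∈ S, ∑ i, (a i).totalDegree + 1, fun a ha i => ?_⟩
    have h1 := Finset.single_le_sum (f := fun a : Fin r → ℛ => ∑ i, (a i).totalDegree)
      (fun _ _ => Nat.zero_le _) ha
    have h2 := Finset.single_le_sum (f := fun i => (a i).totalDegree)
      (fun _ _ => Nat.zero_le _) (Finset.mem_univ i)
    omega
  let e := Fintype.equivFin (S × Fin N)
  refine ⟨_, fun j i => component k 2 ((e.symm j).2 : ℕ) ((e.symm j).1.1 i),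
    fun j => (e.symm j).2, fun j i => component_mem _ _, le_antisymm ?_ ?_⟩
  · rw [Submodule.span_le]
    rintro _ ⟨j, rfl⟩
    refine component_mem_syzygies hf ?_ _
    rw [← hS]
    exact Submodule.subset_span (e.symm j).1.2
  · rw [← hS, Submodule.span_le]
    intro a ha
    have : a = ∑ n : Fin N, fun i => component k 2 (n : ℕ) (a i) := by
      funext i
      rw [Finset.sum_apply, Fin.sum_univ_eq_sum_range (fun n => component k 2 (n : ℕ) (a i)) N]
      conv_lhs => rw [← sum_component (a i)]
      refine Finset.sum_subset (fun n hn => ?_) fun n _ hn => ?_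
      · rw [Finset.mem_range] at hn ⊢
        have := hN a ha i
        omega
      · rw [Finset.mem_range] at hn
        simp only [component, Nat.cast_nonneg, if_true, Int.toNat_natCast]
        exact homogeneousComponent_eq_zero _ _ (by omega)
    rw [SetLike.mem_coe, this]
    refine sum_mem fun n _ => Submodule.subset_span ⟨e (⟨a, ha⟩, n), ?_⟩
    simp

/-! ### Freeness of the syzygy module -/

section Generators

variable {s : ℕ} {Φ : Fin s → Fin r → MvPolynomial (Fin 2) k} {μ : Fin s → ℕ}

theorem exists_homogeneous_coefficients (hΦ : ∀ j i, Φ j i ∈ polyPiece k 2 (μ j))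
    (hspan : Submodule.span ℛ (Set.range Φ) = syzygies f) {e : ℤ} {a : Fin r → ℛ}
    (ha : a ∈ syzygies f) (hae : ∀ i, a i ∈ polyPiece k 2 e) :
    ∃ c : Fin s → ℛ, (∀ j, c j ∈ polyPiece k 2 (e - μ j)) ∧ ∑ j, c j • Φ j = a := by
  rw [← hspan] at ha
  obtain ⟨c, rfl⟩ := (Submodule.mem_span_range_iff_exists_fun ℛ).mp ha
  refine ⟨fun j => component k 2 (e - μ j) (c j), fun j => component_mem _ _, funext fun i => ?_⟩
  rw [← component_of_mem (hae i)]
  simp only [Finset.sum_apply, Pi.smul_apply, smul_eq_mul]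
  exact (component_sum_mul (fun j _ => hΦ j i) e).symm

/-- Split off the pure power of y; the other monomials are divisible by x. Here q is a scalar
multiple of y^(n-1), so x divides it only if it vanishes. -/
theorem isHomogeneous_split {n : ℤ} {F : ℛ} (hF : F ∈ polyPiece k 2 n) (h : n = 0 → F = 0) :
    ∃ q ∈ polyPiece k 2 (n - 1), ∃ c ∈ polyPiece k 2 (n - 1), F = X 1 * q + X 0 * c ∧
      (X 0 ∣ q → q = 0) := by
  rcases lt_or_ge n 0 with h0 | h0
  · exact ⟨0, zero_mem _, 0, zero_mem _, by simp [polyPiece_of_neg h0 hF], fun _ => rfl⟩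
  rcases eq_or_lt_of_le h0 with h1 | h1
  · exact ⟨0, zero_mem _, 0, zero_mem _, by simp [h h1.symm], fun _ => rfl⟩
  lift n to ℕ using h0
  obtain ⟨N, rfl⟩ : ∃ N, n = N + 1 := ⟨n - 1, by omega⟩
  refine ⟨monomial (Finsupp.single 1 N) (coeff (Finsupp.single 1 (N + 1)) F), ?_,
    F.divMonomial (Finsupp.single 0 1), divMonomial_mem hF 0 1, ?_, ?_⟩
  · rw [show ((N + 1 : ℕ) : ℤ) - 1 = (N : ℕ) by push_cast; ring]
    exact mem_polyPiece_iff.mpr (isHomogeneous_monomial _ (by simp))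
  · ext m
    rw [coeff_add, X, monomial_mul, one_mul, X, coeff_monomial, coeff_monomial_mul']
    simp only [coeff_divMonomial, one_mul]
    by_cases hm : Finsupp.single 0 1 ≤ m
    · rw [if_neg, if_pos hm, zero_add, add_tsub_cancel_of_le hm]
      rintro rfl
      rw [Finsupp.single_le_iff] at hm
      simp at hm
    · rw [if_neg hm, add_zero, ← Finsupp.single_add, add_comm 1 N]
      split_ifs with h2
      · rw [h2]
      · by_contra h3
        have h4 := hF m h3
        rw [Finsupp.degree_eq_sum, Fin.sum_univ_two] at h4
        rw [Finsupp.single_le_iff] at hm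
        refine h2 ?_
        ext i
        fin_cases i
        · simp; omega
        · simp; omega
  · rintro ⟨t, ht⟩
    rw [ht]
    by_contra h2
    have h3 := congrArg (coeff (Finsupp.single 1 N)) ht
    rw [coeff_monomial, if_pos rfl, X, coeff_monomial_mul', if_neg] at h3
    · rw [h3, map_zero] at ht
      exact h2 ht.symm
    · rw [Finsupp.single_le_iff]; simp

theorem not_X_zero_dvd_X_one : ¬ (X 0 : ℛ) ∣ X 1 := by
  rw [X_dvd_X]; simp

/-- The syzygy module has depth two, so it is free, and minimal generators form a basis. In
elementary terms: write a relation as y q + x c'. Then x divides ∑ q_j Φ_j, and the quotient is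
again a syzygy, say ∑ h_j Φ_j. Now q - x h is a relation of smaller degree, hence zero, so x divides
q and q = 0. Finally c' is a relation of smaller degree. -/
theorem homogeneous_relation_eq_zero (hΦ : ∀ j i, Φ j i ∈ polyPiece k 2 (μ j))
    (hspan : Submodule.span ℛ (Set.range Φ) = syzygies f)
    (hmin : ∀ (e : ℤ) (c : Fin s → ℛ), (∀ j, c j ∈ polyPiece k 2 (e - μ j)) →
      ∑ j, c j • Φ j = 0 → ∀ j, e = μ j → c j = 0) (n : ℕ) :
    ∀ c : Fin s → ℛ, (∀ j, c j ∈ polyPiece k 2 ((n : ℤ) - 1 - μ j)) → ∑ j, c j • Φ j = 0 → c = 0 := by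
  induction n with
  | zero => exact fun c hc _ => funext fun j => polyPiece_of_neg (by push_cast; omega) (hc j)
  | succ n ih =>
    intro c hc h0
    have hX : (X 0 : ℛ) ≠ 0 := X_ne_zero 0
    rw [Nat.cast_succ, add_sub_cancel_right] at hc
    choose q hq c' hc' e1 hdvd using fun j => isHomogeneous_split (hc j)
      fun h => hmin n c hc h0 j (by omega)
    have hcast : ∀ j, (n : ℤ) - μ j - 1 = n - 1 - μ j := fun j => by ring
    simp only [hcast] at hq hc'
    have e2 : ∀ i, X 1 * (∑ j, q j • Φ j) i = X 0 * (-(∑ j, c' j • Φ j) i) := by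
      intro i
      have := congrFun h0 i
      simp only [Finset.sum_apply, Pi.smul_apply, smul_eq_mul, Pi.zero_apply, e1] at this ⊢
      rw [mul_neg, eq_neg_iff_add_eq_zero, Finset.mul_sum, Finset.mul_sum,
        ← Finset.sum_add_distrib, ← this]
      exact Finset.sum_congr rfl fun j _ => by ring
    have e3 : ∀ i, ∃ t, (∑ j, q j • Φ j) i = X 0 * t := fun i =>
      (((X_prime (R := k) (i := (0 : Fin 2))).dvd_or_dvd ⟨_, e2 i⟩).resolve_left not_X_zero_dvd_X_one)
    choose t ht using e3
    have hsyz : ∀ v : Fin s → ℛ, ∑ j, v j • Φ j ∈ syzygies f := fun v => by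
      rw [← hspan]
      exact sum_mem fun j _ => Submodule.smul_mem _ _ (Submodule.subset_span ⟨j, rfl⟩)
    have htsyz : t ∈ syzygies f := by
      have := hsyz q
      rw [mem_syzygies] at this ⊢
      simp only [ht, mul_assoc, ← Finset.mul_sum] at this
      exact (mul_eq_zero.mp this).resolve_left hX
    have htdeg : ∀ i, t i ∈ polyPiece k 2 ((n : ℤ) - 1 - 1) := by
      intro i
      refine mem_polyPiece_of_mul (X_mem_polyPiece (0 : Fin 2)) hX ?_
      rw [mul_comm, ← ht, Finset.sum_apply]
      exact sum_mem fun j _ => mul_mem_polyPiece' (hq j) (hΦ j i) (by ring)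
    obtain ⟨h, hh, eh⟩ := exists_homogeneous_coefficients hΦ hspan htsyz htdeg
    have hq0 : q = 0 := by
      have h1 : ∀ j, q j - X 0 * h j ∈ polyPiece k 2 ((n : ℤ) - 1 - μ j) := fun j =>
        sub_mem (hq j) (mul_mem_polyPiece' (X_mem_polyPiece 0) (hh j) (by ring))
      have h2 : ∑ j, (q j - X 0 * h j) • Φ j = 0 := by
        funext i
        have h3 := ht i
        rw [← eh] at h3
        simp only [Finset.sum_apply, Pi.smul_apply, smul_eq_mul, Pi.zero_apply, sub_mul,
          Finset.sum_sub_distrib, Finset.mul_sum, mul_assoc] at h3 ⊢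
        rw [h3, sub_self]
      have h3 : (fun j => q j - X 0 * h j) = 0 := ih _ h1 h2
      funext j
      have h4 : q j - X 0 * h j = 0 := congrFun h3 j
      exact hdvd j (Dvd.intro _ (sub_eq_zero.mp h4).symm)
    subst hq0
    have hc0 : c' = 0 := by
      refine ih c' hc' (funext fun i => ?_)
      have h1 := e2 i
      simp only [Finset.sum_apply, Pi.smul_apply, smul_eq_mul, Pi.zero_apply, zero_mul,
        Finset.sum_const_zero, mul_zero] at h1 ⊢
      exact neg_eq_zero.mp ((mul_eq_zero.mp h1.symm).resolve_left hX)
    subst hc0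
    funext j
    rw [e1]
    simp

end Generators

theorem finrank_syzygies (hf : IsParametrization f d) : Module.finrank ℛ (syzygies f) + 1 = r := by
  obtain ⟨i, hi⟩ := hf.exists_ne_zero
  have h1 := (syzygies f).finrank_quotient_add_finrank
  rw [Module.finrank_fin_fun] at h1
  have h2 := (Fintype.linearCombination ℛ f).quotKerEquivRange.finrank_eq
  have h3 : Module.finrank ℛ (LinearMap.range (Fintype.linearCombination ℛ f)) = 1 := by
    refine le_antisymm ?_ ?_
    · simpa using Submodule.finrank_le (LinearMap.range (Fintype.linearCombination ℛ f))
    · have : Nontrivial (LinearMap.range (Fintype.linearCombination ℛ f)) := by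
        refine ⟨⟨⟨f i, Pi.single i 1, by
          simp [Fintype.linearCombination_apply, Pi.single_apply]⟩, 0, fun h => hi ?_⟩⟩
        exact congrArg Subtype.val h
      exact Module.finrank_pos
  unfold syzygies at h1 ⊢
  omega

theorem IsParametrization.mem_polyPiece (hf : IsParametrization f d) (i : Fin r) :
    f i ∈ polyPiece k 2 d := mem_polyPiece_iff.mpr (hf.isHomogeneous i)

/-- The syzygy module has a homogeneous basis. -/
theorem IsParametrization.exists_isSyzygyDegrees (hf : IsParametrization f d) :
    ∃ μ : Fin (r - 1) → ℕ, IsSyzygyDegrees f μ := by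
  classical
  have hex := exists_homogeneous_generators hf.mem_polyPiece
  obtain ⟨Φ, μ, hΦ, hspan⟩ := Nat.find_spec hex
  -- A nonzero constant coefficient in a relation would make a generator superfluous, against the
  -- minimality of their number.
  have hmin : ∀ (e : ℤ) (c : Fin (Nat.find hex) → ℛ), (∀ j, c j ∈ polyPiece k 2 (e - μ j)) →
      ∑ j, c j • Φ j = 0 → ∀ j, e = μ j → c j = 0 := by
    intro e c hc h0 j hj
    by_contra hcj
    obtain ⟨γ, hγ⟩ := mem_polyPiece_zero (by simpa [hj] using hc j)
    have hγ0 : γ ≠ 0 := by rintro rfl; exact hcj (by rw [hγ, map_zero])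
    generalize hs : Nat.find hex = s at *
    obtain ⟨s, rfl⟩ : ∃ s', s = s' + 1 := ⟨s - 1, by have := j.2; omega⟩
    refine Nat.find_min hex (m := s) (by omega) ⟨fun i => Φ (j.succAbove i),
      fun i => μ (j.succAbove i), fun i l => hΦ _ l, ?_⟩
    rw [← hspan]
    refine le_antisymm (Submodule.span_mono ?_) (Submodule.span_le.mpr ?_)
    · rintro _ ⟨i, rfl⟩; exact ⟨_, rfl⟩
    · rintro _ ⟨i, rfl⟩
      have hsub : ∀ i, Φ (j.succAbove i) ∈
          Submodule.span ℛ (Set.range fun i => Φ (j.succAbove i)) := fun i =>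
        Submodule.subset_span ⟨i, rfl⟩
      rcases Fin.eq_self_or_eq_succAbove j i with rfl | ⟨i, rfl⟩
      · rw [Fin.sum_univ_succAbove _ i, hγ] at h0
        have : Φ i = (C γ⁻¹ : ℛ) • (- ∑ x, c (i.succAbove x) • Φ (i.succAbove x)) := by
          rw [← eq_neg_of_add_eq_zero_left h0, smul_smul, ← C_mul, inv_mul_cancel₀ hγ0, C_1,
            one_smul]
        rw [SetLike.mem_coe, this]
        exact Submodule.smul_mem _ _ (neg_mem (sum_mem fun x _ => Submodule.smul_mem _ _ (hsub x)))
      · exact hsub i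
  have hrel := homogeneous_relation_eq_zero hΦ hspan hmin
  have hli : LinearIndependent ℛ Φ := by
    rw [Fintype.linearIndependent_iff]
    intro c hc j
    refine eq_zero_of_component fun n => ?_
    rcases lt_or_ge n 0 with hn | hn
    · exact polyPiece_of_neg hn (component_mem _ _)
    -- The homogeneous part of the relation of total degree n + μ_j contains the degree n part of
    -- c_j. The summand 1 compensates the shift in the degree convention of
    -- `homogeneous_relation_eq_zero`.
    have h1 := hrel (n.toNat + μ j + 1) (fun j' => component k 2 (n + μ j - μ j') (c j'))
      (fun j' => by
        convert component_mem (k := k) (r := 2) (n + μ j - μ j') (c j') using 1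
        congr 1
        push_cast
        omega) (by
        funext i
        have := component_sum_mul (s := Finset.univ) (F := c) (fun j' _ => hΦ j' i) (n + μ j)
        have h2 := congrFun hc i
        simp only [Finset.sum_apply, Pi.smul_apply, smul_eq_mul, Pi.zero_apply] at h2 ⊢
        rw [← this, h2, map_zero])
    have := congrFun h1 j
    simpa using this
  let b := (Module.Basis.span hli).map (LinearEquiv.ofEq _ _ hspan)
  have hb : ∀ j, ((b j : syzygies f) : Fin r → ℛ) = Φ j := fun j => by
    simp [b, Module.Basis.span_apply]
  have hcard : Nat.find hex = r - 1 := by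
    have h1 := Module.finrank_eq_card_basis b
    have h2 := finrank_syzygies hf
    rw [Fintype.card_fin] at h1
    omega
  refine ⟨fun j => μ (Fin.cast hcard.symm j), b.reindex (finCongr hcard), fun j i => ?_⟩
  rw [Module.Basis.reindex_apply, hb]
  exact mem_polyPiece_iff.mp (hΦ _ _)

end Syzygies

/-! ### Dimension counts with the syzygy degrees -/

section Dimensions

variable {k : Type*} [Field k] {r d : ℕ} {f : Fin r → MvPolynomial (Fin 2) k} {μ : Fin (r - 1) → ℕ}

local notation "ℛ" => MvPolynomial (Fin 2) k

/-- A single form would be its own common factor, hence a constant, contrary to d ≥ 1. -/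
theorem IsParametrization.two_le (hf : IsParametrization f d) : 2 ≤ r := by
  by_contra h
  obtain ⟨i, hi⟩ := hf.exists_ne_zero
  have h1 : IsUnit (f i) := hf.no_common_factor _ fun j => by
    have h2 := i.2
    have h3 := j.2
    rw [show j = i from Fin.ext (by omega)]
  obtain ⟨c, -, hc⟩ := (MvPolynomial.isUnit_iff_eq_C_of_isReduced).mp h1
  have h2 := hf.isHomogeneous i
  have h3 := h2.inj_right (by rw [hc]; exact isHomogeneous_C _ _) hi
  have := hf.one_le
  omega

/-- The homogeneous syzygies are counted by the syzygy degrees. -/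
theorem IsSyzygyDegrees.finrank_syzygies (hμ : IsSyzygyDegrees f μ)
    (m : ℤ) (φ : (Fin r → formSpace k 2 m) →ₗ[k] formSpace k 2 (m + d))
    (hφ : ∀ a, (φ a : ℛ) = ∑ i, (a i : ℛ) * f i) :
    Module.finrank k (LinearMap.ker φ) = ∑ j, (m - μ j + 1).toNat := by
  obtain ⟨Φ, hΦ⟩ := hμ
  have hΦ' : ∀ j i, (Φ j : Fin r → ℛ) i ∈ polyPiece k 2 (μ j) := fun j i =>
    mem_polyPiece_iff.mpr (hΦ j i)
  let ψ : (∀ j, formSpace k 2 (m - μ j)) →ₗ[k] (Fin r → formSpace k 2 m) :=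
    { toFun := fun c i => ⟨∑ j, (c j : ℛ) * (Φ j : Fin r → ℛ) i, sum_mem fun j _ =>
        mul_mem_polyPiece' (c j).2 (hΦ' j i) (by ring)⟩
      map_add' := fun c c' => by
        funext i; ext1; simp [add_mul, Finset.sum_add_distrib]
      map_smul' := fun a c => by
        funext i; ext1; simp [Finset.smul_sum] }
  have hψ : ∀ c i, (ψ c i : ℛ) = (∑ j, (c j : ℛ) • Φ j : syzygies f).1 i := fun c i => by
    simp [ψ]
  have hinj : Function.Injective ψ := by
    rw [← LinearMap.ker_eq_bot, LinearMap.ker_eq_bot']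
    intro c hc
    have h1 : ∑ j, (c j : ℛ) • Φ j = 0 := Subtype.ext (funext fun i => by
      rw [← hψ, hc]; rfl)
    have := Fintype.linearIndependent_iff.mp Φ.linearIndependent _ h1
    exact funext fun j => Subtype.ext (this j)
  have hrange : LinearMap.range ψ = LinearMap.ker φ := by
    refine le_antisymm ?_ fun a ha => ?_
    · rintro _ ⟨c, rfl⟩
      rw [LinearMap.mem_ker]
      ext1
      rw [hφ]
      simp only [hψ]
      exact mem_syzygies.mp (∑ j, (c j : ℛ) • Φ j : syzygies f).2
    · have ha' : (fun i => (a i : ℛ)) ∈ syzygies f := by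
        rw [mem_syzygies, ← hφ, LinearMap.mem_ker.mp ha]; rfl
      have h1 := Φ.sum_repr ⟨_, ha'⟩
      refine ⟨fun j => ⟨component k 2 (m - μ j) (Φ.repr ⟨_, ha'⟩ j), component_mem _ _⟩, ?_⟩
      funext i
      ext1
      change ∑ j, component k 2 (m - μ j) (Φ.repr ⟨_, ha'⟩ j) * (Φ j : Fin r → ℛ) i = a i
      rw [← component_sum_mul (fun j _ => hΦ' j i), ← component_of_mem (a i).2]
      congr 1
      have h2 : ∀ c : Fin (r - 1) → ℛ, (∑ j, c j • Φ j : syzygies f).1 i =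
          ∑ j, c j * (Φ j : Fin r → ℛ) i := fun c => by simp
      exact (h2 _).symm.trans (by rw [h1])
  rw [← hrange, LinearMap.finrank_range_of_inj hinj, Module.finrank_pi_fintype]
  simp only [finrank_formSpace]

/-- The map `a ↦ ∑ a i * f i` on forms. -/
def combination (hf : ∀ i, f i ∈ polyPiece k 2 d) (m : ℤ) :
    (Fin r → formSpace k 2 m) →ₗ[k] formSpace k 2 (m + d) where
  toFun a := ⟨∑ i, (a i : ℛ) * f i, sum_mem fun i _ => mul_mem_polyPiece (a i).2 (hf i)⟩
  map_add' a b := by ext1; simp [add_mul, Finset.sum_add_distrib]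
  map_smul' c a := by ext1; simp [Finset.smul_sum]

/-- The count is r(m + 1) - ∑ (m + 1 - μ_j). The hypothesis on m is exactly what prevents truncation
in these dimensions. -/
theorem IsSyzygyDegrees.finrank_range (hf : IsParametrization f d) (hμ : IsSyzygyDegrees f μ)
    {m : ℤ} (hm : ∀ j, μ j ≤ m + 1) :
    (Module.finrank k (LinearMap.range (combination hf.mem_polyPiece m)) : ℤ) =
      m + 1 + ∑ j, μ j := by
  have h1 := (combination hf.mem_polyPiece m).finrank_range_add_finrank_ker
  rw [hμ.finrank_syzygies m _ fun _ => rfl, Module.finrank_pi_fintype] at h1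
  simp only [finrank_formSpace, Finset.sum_const, Finset.card_univ, Fintype.card_fin,
    smul_eq_mul] at h1
  have h2 := hf.two_le
  have h3 : 0 ≤ m + 1 := (Int.natCast_nonneg _).trans (hm ⟨0, by omega⟩)
  have h4 : ((∑ j, (m - μ j + 1).toNat : ℕ) : ℤ) = ((r : ℤ) - 1) * (m + 1) - ∑ j, μ j := by
    push_cast
    rw [Finset.sum_congr rfl fun j _ => show ((m - μ j + 1).toNat : ℤ) = (m + 1) - μ j by
      rw [Int.toNat_of_nonneg (by have := hm j; omega)]; ring]
    rw [Finset.sum_sub_distrib, Finset.sum_const, Finset.card_univ, Fintype.card_fin, nsmul_eq_mul,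
      Nat.cast_sub (by omega)]
    push_cast; ring
  have h5 : (Module.finrank k (LinearMap.range (combination hf.mem_polyPiece m)) : ℤ) +
      ((∑ j, (m - μ j + 1).toNat : ℕ) : ℤ) = (r : ℤ) * (m + 1) := by
    rw [← Nat.cast_add, h1]
    push_cast
    rw [Int.toNat_of_nonneg h3]
  rw [h4] at h5
  linarith

/-- The sum of the syzygy degrees. -/
theorem IsSyzygyDegrees.sum_eq (hf : IsParametrization f d) (hμ : IsSyzygyDegrees f μ) :
    ∑ j, μ j = d := by
  obtain ⟨E, hE⟩ := hf.exists_eq_sum_of_large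
  obtain ⟨m, hm1, hm2, hm0⟩ : ∃ m : ℤ, E ≤ m + d ∧ (∀ j, (μ j : ℤ) ≤ m + 1) ∧ 0 ≤ m := by
    refine ⟨|E| + (∑ j, μ j : ℕ), by have := le_abs_self E; omega, fun j => ?_, by positivity⟩
    have := Finset.single_le_sum (f := μ) (fun _ _ => Nat.zero_le _) (Finset.mem_univ j)
    have h2 := abs_nonneg E
    have h3 : (μ j : ℤ) ≤ ((∑ j, μ j : ℕ) : ℤ) := by exact_mod_cast this
    omega
  have h1 := hμ.finrank_range hf hm2
  -- In large degree the map is onto a space of dimension m + d + 1, while the count gives m + 1 + ∑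
  -- μ_j.
  have h2 : LinearMap.range (combination hf.mem_polyPiece m) = ⊤ := by
    rw [LinearMap.range_eq_top]
    rintro ⟨F, hF⟩
    obtain ⟨a, ha, e⟩ := hE _ hm1 F hF
    rw [add_sub_cancel_right] at ha
    exact ⟨fun i => ⟨a i, ha i⟩, Subtype.ext e⟩
  rw [h2, finrank_top, finrank_formSpace, Int.toNat_of_nonneg (by omega)] at h1
  have h3 : ((∑ j, μ j : ℕ) : ℤ) = d := by linarith
  exact_mod_cast h3

/-- The forms of sufficiently large degree lie in the ideal of `f`. -/
theorem IsSyzygyDegrees.exists_eq_sum (hf : IsParametrization f d) (hμ : IsSyzygyDegrees f μ)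
    {m e : ℤ} (hm : ∀ j, μ j ≤ m + 1) (he : m + d = e) {F : ℛ} (hF : F ∈ polyPiece k 2 e) :
    ∃ a : Fin r → ℛ, (∀ i, a i ∈ polyPiece k 2 m) ∧ ∑ i, a i * f i = F := by
  subst he
  have h1 := hμ.finrank_range hf hm
  have h2 := hf.two_le
  have h3 : 0 ≤ m + 1 := (Int.natCast_nonneg _).trans (hm ⟨0, by omega⟩)
  have h4 := hμ.sum_eq hf
  -- Now that ∑ μ_j = d is known, the same count shows surjectivity as soon as m ≥ max μ_j - 1.
  have h5 : LinearMap.range (combination hf.mem_polyPiece m) = ⊤ := by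
    apply Submodule.eq_top_of_finrank_eq
    rw [finrank_formSpace]
    rw [h4] at h1
    omega
  obtain ⟨a, ha⟩ := LinearMap.range_eq_top.mp h5 ⟨F, hF⟩
  exact ⟨fun i => a i, fun i => (a i).2, congrArg Subtype.val ha⟩

end Dimensions

/-! ### Polynomials with homogeneous coefficients -/

section Coefficients

variable {k : Type*} [Field k] {r n : ℕ}

variable (k r n) in
/-- The polynomials over `k[T_1, …, T_r]` whose coefficients are homogeneous of degree `s`. -/
def coeffPiece (s : ℤ) : AddSubgroup (MvPolynomial (Fin n) (MvPolynomial (Fin r) k)) where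
  carrier := {z | ∀ m, coeff m z ∈ polyPiece k r s}
  zero_mem' := fun m => by rw [coeff_zero]; exact zero_mem _
  add_mem' := fun h h' m => by rw [coeff_add]; exact add_mem (h m) (h' m)
  neg_mem' := fun h m => by rw [coeff_neg]; exact neg_mem (h m)

local notation "𝔓" => MvPolynomial (Fin n) (MvPolynomial (Fin r) k)

theorem mul_mem_coeffPiece {F G : 𝔓} {a b c : ℤ} (hF : F ∈ coeffPiece k r n a)
    (hG : G ∈ coeffPiece k r n b) (h : a + b = c) : F * G ∈ coeffPiece k r n c := fun m => by
  rw [coeff_mul]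
  exact sum_mem fun x _ => mul_mem_polyPiece' (hF _) (hG _) h

theorem map_C_mem_coeffPiece (F : MvPolynomial (Fin n) k) :
    MvPolynomial.map C F ∈ coeffPiece k r n 0 := fun m => by
  rw [coeff_map]; exact C_mem_polyPiece _

theorem C_mem_coeffPiece {F : MvPolynomial (Fin r) k} {s : ℤ} (hF : F ∈ polyPiece k r s) :
    C F ∈ coeffPiece k r n s := fun m => by
  classical
  rw [coeff_C]
  split_ifs
  · exact hF
  · exact zero_mem _

theorem X_pow_mem_coeffPiece (i : Fin n) (a : ℕ) : (X i ^ a : 𝔓) ∈ coeffPiece k r n 0 := by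
  have := map_C_mem_coeffPiece (r := r) (X i ^ a : MvPolynomial (Fin n) k)
  simpa using this

theorem map_C_mem_polyPiece {F : MvPolynomial (Fin n) k} {e : ℤ} (hF : F ∈ polyPiece k n e) :
    MvPolynomial.map C F ∈ polyPiece (MvPolynomial (Fin r) k) n e := fun m hm => hF m fun h => hm (by
  rw [coeff_map, h, map_zero])

/-- The part of a polynomial with coefficients of degree `s`. -/
def coeffComponent (s : ℤ) (z : 𝔓) : 𝔓 :=
  ∑ m ∈ z.support, monomial m (component k r s (coeff m z))

theorem coeff_coeffComponent (s : ℤ) (z : 𝔓) (m : Fin n →₀ ℕ) :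
    coeff m (coeffComponent s z) = component k r s (coeff m z) := by
  classical
  rw [coeffComponent, coeff_sum]
  simp only [coeff_monomial]
  rw [Finset.sum_ite_eq']
  split_ifs with h
  · rfl
  · rw [notMem_support_iff.mp h, map_zero]

theorem coeffComponent_mem (s : ℤ) (z : 𝔓) : coeffComponent s z ∈ coeffPiece k r n s := fun m => by
  rw [coeff_coeffComponent]; exact component_mem _ _

theorem coeffComponent_mem_polyPiece {s e : ℤ} {z : 𝔓}
    (hz : z ∈ polyPiece (MvPolynomial (Fin r) k) n e) :
    coeffComponent s z ∈ polyPiece (MvPolynomial (Fin r) k) n e := fun m hm => hz m fun h => hm (by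
  rw [coeff_coeffComponent, h, map_zero])

theorem coeffComponent_of_mem {s : ℤ} {z : 𝔓} (hz : z ∈ coeffPiece k r n s) :
    coeffComponent s z = z := by
  ext1 m
  rw [coeff_coeffComponent, component_of_mem (hz m)]

theorem coeffComponent_sum_mul {ι : Type*} {t : Finset ι} {F G : ι → 𝔓} {e : ℤ}
    (hG : ∀ i ∈ t, G i ∈ coeffPiece k r n e) (s : ℤ) :
    coeffComponent s (∑ i ∈ t, F i * G i) = ∑ i ∈ t, coeffComponent (s - e) (F i) * G i := by
  ext1 m
  rw [coeff_coeffComponent, coeff_sum, coeff_sum, map_sum]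
  refine Finset.sum_congr rfl fun i hi => ?_
  rw [coeff_mul, coeff_mul, component_sum_mul (e := fun _ => e) fun x _ => hG i hi _]
  simp only [coeff_coeffComponent]

/-- Coefficients of a combination of bihomogeneous elements can be chosen bihomogeneous. -/
theorem exists_bihomogeneous {ι : Type*} [Fintype ι] {G : ι → 𝔓} {μ : ι → ℤ} {b t e : ℤ} {z : 𝔓}
    (hG : ∀ i, G i ∈ polyPiece (MvPolynomial (Fin r) k) n (μ i))
    (hG' : ∀ i, G i ∈ coeffPiece k r n e)
    (hz : z ∈ polyPiece (MvPolynomial (Fin r) k) n b) (hz' : z ∈ coeffPiece k r n t)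
    {a : ι → 𝔓} (ha : z = ∑ i, a i * G i) :
    ∃ a' : ι → 𝔓, (∀ i, a' i ∈ polyPiece (MvPolynomial (Fin r) k) n (b - μ i)) ∧
      (∀ i, a' i ∈ coeffPiece k r n (t - e)) ∧ z = ∑ i, a' i * G i := by
  refine ⟨fun i => coeffComponent (t - e) (component _ _ (b - μ i) (a i)),
    fun i => coeffComponent_mem_polyPiece (component_mem _ _), fun i => coeffComponent_mem _ _, ?_⟩
  rw [← coeffComponent_sum_mul fun i _ => hG' i, ← component_sum_mul fun i _ => hG i, ← ha,
    component_of_mem hz, coeffComponent_of_mem hz']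

theorem aeval_mul_of_mem {S : Type*} [CommRing S] [Algebra k S] {F : MvPolynomial (Fin r) k} {t : ℤ}
    (hF : F ∈ polyPiece k r t) (c : S) (g : Fin r → S) :
    aeval (fun i => c * g i) F = c ^ t.toNat * aeval g F := by
  rw [aeval_def, aeval_def, eval₂_eq, eval₂_eq, Finset.mul_sum]
  refine Finset.sum_congr rfl fun m hm => ?_
  have h1 := hF m (mem_support_iff.mp hm)
  have h2 : t.toNat = ∑ i ∈ m.support, m i := by
    rw [Finsupp.degree_apply] at h1; omega
  rw [h2, ← Finset.prod_pow_eq_pow_sum]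
  simp only [mul_pow, Finset.prod_mul_distrib]
  ring

/-- Scaling the values of `T_1, …, T_r`. -/
theorem eval₂Hom_aeval_mul_of_mem {S : Type*} [CommRing S] [Algebra k S] {z : 𝔓} {t : ℤ}
    (hz : z ∈ coeffPiece k r n t) (c : S) (g : Fin r → S) (w : Fin n → S) :
    eval₂Hom ((aeval fun i => c * g i : MvPolynomial (Fin r) k →ₐ[k] S) : _ →+* S) w z =
      c ^ t.toNat * eval₂Hom ((aeval g : MvPolynomial (Fin r) k →ₐ[k] S) : _ →+* S) w z := by
  rw [coe_eval₂Hom, coe_eval₂Hom, eval₂_eq, eval₂_eq, Finset.mul_sum]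
  refine Finset.sum_congr rfl fun m _ => ?_
  rw [RingHom.coe_coe, RingHom.coe_coe, aeval_mul_of_mem (hz m), mul_assoc]

end Coefficients

/-! ### The Koszul relations of the variables -/

/-- The relations between variables are generated by the Koszul relations. -/
theorem exists_koszul_relation {R ι : Type*} [CommRing R] (S : Finset ι)
    (c : ι → MvPolynomial ι R) (hc : ∑ j ∈ S, c j * X j = 0) :
    ∃ δ : ι → ι → MvPolynomial ι R, ∀ j ∈ S, c j = ∑ i ∈ S, (δ i j - δ j i) * X i := by
  classical
  induction S using Finset.induction_on generalizing c with
  | empty => exact ⟨0, by simp⟩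
  | insert a S ha ih =>
    rw [Finset.sum_insert ha] at hc
    -- The variable X_a is a nonzerodivisor modulo the other variables; on monomials, multiplying by
    -- X_a does not change the other exponents.
    have h1 : c a ∈ Ideal.span (X '' (S : Set ι) : Set (MvPolynomial ι R)) := by
      have h2 : c a * X a ∈ Ideal.span (X '' (S : Set ι) : Set (MvPolynomial ι R)) := by
        rw [eq_neg_of_add_eq_zero_left hc]
        exact neg_mem (sum_mem fun j hj =>
          Ideal.mul_mem_left _ _ (Ideal.subset_span ⟨j, hj, rfl⟩))
      rw [mem_ideal_span_X_image] at h2 ⊢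
      intro m hm
      obtain ⟨i, hi, h3⟩ := h2 (m + Finsupp.single a 1) (by
        rw [mem_support_iff, coeff_mul_X]; exact mem_support_iff.mp hm)
      refine ⟨i, hi, fun h4 => h3 ?_⟩
      have h5 : a ≠ i := fun h => ha (h ▸ hi)
      rw [Finsupp.add_apply, h4, Finsupp.single_eq_of_ne h5.symm, add_zero]
    obtain ⟨e, he⟩ : ∃ e : ι → MvPolynomial ι R, c a = ∑ i ∈ S, e i * X i := by
      obtain ⟨l, hl⟩ := (Submodule.mem_span_image_finset_iff_exists_fun _).mp h1
      refine ⟨fun i => if h : i ∈ S then l ⟨i, h⟩ else 0, ?_⟩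
      rw [← hl, ← Finset.sum_coe_sort S]
      exact Finset.sum_congr rfl fun i _ => by simp
    obtain ⟨δ, hδ⟩ := ih (fun j => c j + e j * X a) (by
      rw [← hc, he, Finset.sum_mul, ← Finset.sum_add_distrib]
      exact Finset.sum_congr rfl fun i _ => by ring)
    refine ⟨fun i j => if j = a then e i else if i = a then 0 else δ i j, fun j hj => ?_⟩
    have hS : ∀ i ∈ S, i ≠ a := fun i hi h => ha (h ▸ hi)
    rw [Finset.sum_insert ha]
    rcases Finset.mem_insert.mp hj with rfl | hj
    · rw [sub_self, zero_mul, zero_add, he]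
      refine Finset.sum_congr rfl fun i hi => ?_
      simp [hS i hi]
    · have h6 : ∑ i ∈ S, (δ i j - δ j i) * X i = c j + e j * X a := (hδ j hj).symm
      simp only [if_neg (hS j hj), if_true]
      have h7 : ∑ i ∈ S, ((if i = a then 0 else δ i j) - if i = a then e j else δ j i) * X i =
          c j + e j * X a := by
        rw [← h6]
        exact Finset.sum_congr rfl fun i hi => by rw [if_neg (hS i hi), if_neg (hS i hi)]
      rw [h7]
      ring

/-! ### The equations of the Rees algebra that are linear in `T_1, …, T_r` -/

section Rees

variable {k : Type*} [Field k] {r d : ℕ} {f : Fin r → MvPolynomial (Fin 2) k} {μ : Fin (r - 1) → ℕ}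

local notation "𝔸" => MvPolynomial (Fin r) k
local notation "ℛ" => MvPolynomial (Fin 2) k
local notation "𝔓" => MvPolynomial (Fin 2) (MvPolynomial (Fin r) k)

/-- The linear form in `T_1, …, T_r` with coefficients `φ`. -/
def linearEquation (φ : Fin r → ℛ) : 𝔓 := ∑ i, MvPolynomial.map C (φ i) * C (X i)

theorem linearEquation_mem_coeffPiece (φ : Fin r → ℛ) : linearEquation φ ∈ coeffPiece k r 2 1 :=
  sum_mem fun i _ => mul_mem_coeffPiece (map_C_mem_coeffPiece _) (C_mem_coeffPiece (X_mem_polyPiece i))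
    (zero_add 1)

theorem linearEquation_mem_polyPiece {φ : Fin r → ℛ} {e : ℤ} (hφ : ∀ i, φ i ∈ polyPiece k 2 e) :
    linearEquation φ ∈ polyPiece (MvPolynomial (Fin r) k) 2 e :=
  sum_mem fun i _ => mul_mem_polyPiece' (map_C_mem_polyPiece (hφ i)) (C_mem_polyPiece _) (add_zero e)

/-- The substitution `T_i ↦ f_i`. -/
def substitute (f : Fin r → ℛ) : 𝔓 →+* ℛ :=
  eval₂Hom ((aeval f : 𝔸 →ₐ[k] ℛ) : 𝔸 →+* ℛ) X

/-- Where `X s` is invertible, the syzygy module is a direct summand. -/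
theorem IsParametrization.exists_splitting (hf : IsParametrization f d)
    (Φ : Module.Basis (Fin (r - 1)) ℛ (syzygies f)) :
    ∃ N : ℕ, ∀ s : Fin 2, ∃ (u : Fin r → ℛ) (l : Fin r → Fin (r - 1) → ℛ),
      (∀ i i', (if i = i' then X s ^ N else 0) = f i * u i' + ∑ j, l i j * (Φ j : Fin r → ℛ) i') ∧
      ∀ j j', ∑ i, (Φ j : Fin r → ℛ) i * l i j' = if j = j' then X s ^ N else 0 := by
  obtain ⟨E, hE⟩ := hf.exists_eq_sum_of_large
  refine ⟨E.toNat, fun s => ?_⟩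
  obtain ⟨u, -, hu⟩ := hE E.toNat (by omega) _ (X_pow_mem_polyPiece s E.toNat)
  set N := E.toNat
  -- As X_s^N = ∑ u_i f_i, the map 1 ↦ u splits R^r → (f) up to X_s^N. The complementary projection
  -- goes into the syzygies, and its coordinates are the `l`.
  have h1 : ∀ i, (fun i' => (if i = i' then X s ^ N else 0) - f i * u i') ∈ syzygies f := fun i => by
    rw [mem_syzygies]
    simp only [sub_mul, ite_mul, zero_mul, Finset.sum_sub_distrib, Finset.sum_ite_eq,
      Finset.mem_univ, if_true, mul_assoc, ← Finset.mul_sum, hu]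
    ring
  have h2 : ∀ i i', (if i = i' then X s ^ N else 0) - f i * u i' =
      ∑ j, Φ.repr ⟨_, h1 i⟩ j * (Φ j : Fin r → ℛ) i' := fun i i' => by
    have h3 := congrFun (congrArg Subtype.val (Φ.sum_repr ⟨_, h1 i⟩)) i'
    simp only [AddSubmonoidClass.coe_finsetSum, Finset.sum_apply, SetLike.val_smul, Pi.smul_apply,
      smul_eq_mul] at h3
    exact h3.symm
  refine ⟨u, fun i j => Φ.repr ⟨_, h1 i⟩ j, fun i i' => by rw [← h2]; ring, fun j j' => ?_⟩
  have h4 : ∑ j', (∑ i, (Φ j : Fin r → ℛ) i * Φ.repr ⟨_, h1 i⟩ j' - if j = j' then X s ^ N else 0) •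
      Φ j' = 0 := by
    ext1
    funext i'
    simp only [AddSubmonoidClass.coe_finsetSum, Finset.sum_apply, SetLike.val_smul, Pi.smul_apply,
      smul_eq_mul, sub_mul, Finset.sum_sub_distrib, ite_mul, zero_mul, Finset.sum_ite_eq,
      Finset.mem_univ, if_true, Finset.sum_mul]
    rw [Finset.sum_comm]
    simp only [mul_assoc, ← Finset.mul_sum, ← h2]
    have h5 := mem_syzygies.mp (Φ j).2
    simp only [mul_sub, mul_ite, mul_zero, Finset.sum_sub_distrib, Finset.sum_ite_eq',
      Finset.mem_univ, if_true, ← mul_assoc, ← Finset.sum_mul, h5]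
    simp [mul_comm]
  exact sub_eq_zero.mp (Fintype.linearIndependent_iff.mp Φ.linearIndependent _ h4 j')

variable (Φ : Module.Basis (Fin (r - 1)) (MvPolynomial (Fin 2) k) (syzygies f))
  {s : Fin 2} {N : ℕ} {u : Fin r → MvPolynomial (Fin 2) k}
  {l : Fin r → Fin (r - 1) → MvPolynomial (Fin 2) k}

include Φ in
-- A change of coordinates: where X_s is invertible, the linear forms of the basis syzygies together
-- with that of `u` can replace T_1, …, T_r.
theorem map_splitting
    (h₁ : ∀ i i', (if i = i' then X s ^ N else 0) =
      f i * u i' + ∑ j, l i j * (Φ j : Fin r → ℛ) i') (i : Fin r) :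
    (X s ^ N * C (X i) : 𝔓) = MvPolynomial.map C (f i) * linearEquation u +
      ∑ j, MvPolynomial.map C (l i j) * linearEquation (Φ j : Fin r → ℛ) := by
  have h2 : ∀ i', (MvPolynomial.map C (if i = i' then X s ^ N else 0) : 𝔓) = _ := fun i' =>
    congrArg _ (h₁ i i')
  have h3 : ∑ i', MvPolynomial.map C (if i = i' then X s ^ N else 0) * C (X i') =
      (X s ^ N * C (X i) : 𝔓) := by
    simp [apply_ite (MvPolynomial.map (σ := Fin 2) (C : k →+* 𝔸))]
  rw [← h3]
  simp only [h2, linearEquation, map_add, map_mul, map_sum, add_mul, Finset.sum_add_distrib,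
    Finset.mul_sum, Finset.sum_mul, mul_assoc]
  rw [Finset.sum_comm]

/-- Up to powers of the variables, the relations are combinations of the linear ones. -/
theorem exists_pow_mul_eq_sum
    (h₁ : ∀ i i', (if i = i' then X s ^ N else 0) =
      f i * u i' + ∑ j, l i j * (Φ j : Fin r → ℛ) i') {t : ℤ} {z : 𝔓} (hz : z ∈ coeffPiece k r 2 t)
    (hz0 : substitute f z = 0) :
    ∃ a : Fin (r - 1) → 𝔓, X s ^ (N * t.toNat) * z = ∑ j, a j * linearEquation (Φ j : Fin r → ℛ) := by
  let I : Ideal 𝔓 := Ideal.span (Set.range fun j => linearEquation (Φ j : Fin r → ℛ))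
  have h2 : X s ^ (N * t.toNat) * z ∈ I := by
    rw [← Ideal.Quotient.eq_zero_iff_mem]
    -- Modulo the linear equations, X_s^N T_i becomes f_i times a common factor. By homogeneity in
    -- T, X_s^(Nt) z becomes a power of that factor times z(f) = 0.
    have h3 : ∀ i, Ideal.Quotient.mk I (X s ^ N * C (X i)) =
        Ideal.Quotient.mk I (linearEquation u * MvPolynomial.map C (f i)) := fun i => by
      rw [map_splitting Φ h₁, Ideal.Quotient.mk_eq_mk_iff_sub_mem, mul_comm (linearEquation u),
        add_sub_cancel_left]
      exact sum_mem fun j _ => Ideal.mul_mem_left _ _ (Ideal.subset_span ⟨j, rfl⟩)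
    have h4 := eval₂Hom_aeval_mul_of_mem hz (Ideal.Quotient.mk I (X s ^ N))
      (fun i => Ideal.Quotient.mk I (C (X i))) (fun i => Ideal.Quotient.mk I (X i))
    have h5 := eval₂Hom_aeval_mul_of_mem hz (Ideal.Quotient.mk I (linearEquation u))
      (fun i => Ideal.Quotient.mk I (MvPolynomial.map C (f i))) (fun i => Ideal.Quotient.mk I (X i))
    simp only [← map_mul, h3] at h4 h5
    rw [h5] at h4
    have h6 : eval₂Hom ((aeval fun i => Ideal.Quotient.mk I (C (X i)) : 𝔸 →ₐ[k] 𝔓 ⧸ I) : 𝔸 →+* 𝔓 ⧸ I)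
        (fun i => Ideal.Quotient.mk I (X i)) = Ideal.Quotient.mk I := by
      refine ringHom_ext' (ringHom_ext' ?_ fun i => by simp) fun i => by simp
      ext c
      simp
      rfl
    have h7 : eval₂Hom ((aeval fun i => Ideal.Quotient.mk I (MvPolynomial.map C (f i)) : 𝔸 →ₐ[k] 𝔓 ⧸ I) : 𝔸 →+* 𝔓 ⧸ I)
        (fun i => Ideal.Quotient.mk I (X i)) = ((Ideal.Quotient.mk I).comp (MvPolynomial.map C)).comp (substitute f) := by
      refine ringHom_ext' (ringHom_ext' ?_ fun i => by simp [substitute]) fun i => by simp [substitute]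
      ext c
      simp [substitute]
      rfl
    rw [h6, h7, RingHom.comp_apply, hz0, map_zero, mul_zero, ← map_pow, ← map_mul, ← pow_mul] at h4
    exact h4.symm
  obtain ⟨a, ha⟩ := Ideal.mem_span_range_iff_exists_fun.mp h2
  exact ⟨a, ha.symm⟩

/-- Up to powers of the variables, the relations between the linear equations are generated by
the Koszul relations. -/
theorem exists_pow_mul_eq_koszul
    (h₁ : ∀ i i', (if i = i' then X s ^ N else 0) =
      f i * u i' + ∑ j, l i j * (Φ j : Fin r → ℛ) i')
    (h₂ : ∀ j j', ∑ i, (Φ j : Fin r → ℛ) i * l i j' = if j = j' then X s ^ N else 0)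
    {t : ℤ} {c : Fin (r - 1) → 𝔓} (hc : ∀ j, c j ∈ coeffPiece k r 2 t)
    (hc0 : ∑ j, c j * linearEquation (Φ j : Fin r → ℛ) = 0) :
    ∃ δ : Fin (r - 1) → Fin (r - 1) → 𝔓, ∀ j, X s ^ (N * t.toNat) * c j =
      ∑ i, (δ i j - δ j i) * linearEquation (Φ i : Fin r → ℛ) := by
  classical
  -- `Ξ` passes to the coordinates of the splitting: it sends the linear equations to X_s^N times
  -- variables. `Θ` goes back, and the composite multiplies forms of degree t in T by X_s^(Nt).
  -- Relations between the linear equations thus become relations between variables, which are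
  -- Koszul.
  let Ξ : 𝔓 →+* MvPolynomial (Option (Fin (r - 1))) ℛ :=
    eval₂Hom ((aeval fun i => C (f i) * X none + ∑ j, C (l i j) * X (some j) :
      𝔸 →ₐ[k] MvPolynomial (Option (Fin (r - 1))) ℛ) : 𝔸 →+* _) fun s => C (X s)
  let Θ : MvPolynomial (Option (Fin (r - 1))) ℛ →+* 𝔓 :=
    eval₂Hom (MvPolynomial.map C) fun o => o.elim (linearEquation u) fun j => linearEquation (Φ j : Fin r → ℛ)
  have hΞ : ∀ F : ℛ, Ξ (MvPolynomial.map C F) = C F := fun F => by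
    have : Ξ.comp (MvPolynomial.map C) = C := by
      refine ringHom_ext' ?_ fun i => by simp [Ξ]
      ext a
      simp [Ξ]
    exact RingHom.congr_fun this F
  have hΞg : ∀ j, Ξ (linearEquation (Φ j : Fin r → ℛ)) = C (X s ^ N) * X (some j) := fun j => by
    have h3 : ∀ i, Ξ (C (X i)) = C (f i) * X none + ∑ j, C (l i j) * X (some j) := fun i => by simp [Ξ]
    have h4 := mem_syzygies.mp (Φ j).2
    simp only [linearEquation, map_sum, map_mul Ξ, hΞ, h3, mul_add, Finset.sum_add_distrib,
      Finset.mul_sum, ← mul_assoc]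
    rw [Finset.sum_comm]
    simp only [← Finset.sum_mul, ← map_mul, ← map_sum, h₂, h4]
    rw [map_zero, zero_mul, zero_add, Finset.sum_eq_single j (fun j' _ h => by
      rw [if_neg h.symm, map_zero, zero_mul]) (fun h => absurd (Finset.mem_univ j) h), if_pos rfl]
  have hΘΞ : ∀ j, Θ (Ξ (c j)) = X s ^ (N * t.toNat) * c j := fun j => by
    have h3 := eval₂Hom_aeval_mul_of_mem (hc j) (X s ^ N : 𝔓) (fun i => C (X i)) X
    have h4 : Θ.comp Ξ = eval₂Hom ((aeval fun i => X s ^ N * C (X i) : 𝔸 →ₐ[k] 𝔓) : 𝔸 →+* 𝔓) X := by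
      refine ringHom_ext' (ringHom_ext' ?_ fun i => ?_) fun i => by simp [Ξ, Θ]
      · ext a
        simp [Ξ, Θ]
      · simp [Ξ, Θ, map_splitting Φ h₁]
    have h6 : eval₂Hom ((aeval fun i => C (X i) : 𝔸 →ₐ[k] 𝔓) : 𝔸 →+* 𝔓) X = RingHom.id 𝔓 := by
      refine ringHom_ext' (ringHom_ext' ?_ fun i => by simp) fun i => by simp
      ext c
      simp
    rw [← RingHom.comp_apply, h4, h3, h6, ← pow_mul, RingHom.id_apply]
  have h3 : ∑ j, Ξ (c j) * X (some j) = 0 := by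
    have h4 := congrArg Ξ hc0
    simp only [map_sum, map_mul, hΞg, map_zero] at h4
    have h5 : C (X s ^ N) * ∑ j, Ξ (c j) * X (some j) = 0 := by
      rw [← h4, Finset.mul_sum]
      exact Finset.sum_congr rfl fun j _ => by ring
    refine (mul_eq_zero.mp h5).resolve_left fun h6 => ?_
    rw [C_eq_zero] at h6
    exact pow_ne_zero _ (X_ne_zero s) h6
  obtain ⟨δ, hδ⟩ := exists_koszul_relation (R := ℛ) (Finset.univ.map Function.Embedding.some)
    (fun o => o.elim 0 fun j => Ξ (c j)) (by simpa using h3)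
  refine ⟨fun i j => Θ (δ (some i) (some j)), fun j => ?_⟩
  have h7 := congrArg Θ (hδ (some j) (by simp))
  rw [Finset.sum_map] at h7
  simp only [Option.elim, hΘΞ, Function.Embedding.some_apply, map_sum, map_mul, map_sub] at h7
  rw [h7]
  simp [Θ]

end Rees

/-! ### Linearity of the Rees equations in large degree -/

section Rees

/-- A monomial x^i y^j with i < K and j < M has degree at most K + M - 2. This is the vanishing of
the second local cohomology of R[x, y] in degrees at least -1. -/
theorem exists_eq_X_pow_mul_add {R : Type*} [CommRing R] {e : ℤ} {K M : ℕ}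
    (he : (K : ℤ) + M - 1 ≤ e) {F : MvPolynomial (Fin 2) R} (hF : F ∈ polyPiece R 2 e) :
    ∃ p q, F = X 0 ^ K * p + X 1 ^ M * q := by
  have h1 : ∀ m : Fin 2 →₀ ℕ, ∃ p q, monomial m (coeff m F) = X 0 ^ K * p + X 1 ^ M * q := fun m => by
    have h2 : ∀ (i : Fin 2) (a : ℕ), a ≤ m i →
        monomial m (coeff m F) = X i ^ a * monomial (m - Finsupp.single i a) (coeff m F) :=
      fun i a hi => by
        rw [X_pow_eq_monomial, monomial_mul, one_mul, add_tsub_cancel_of_le (by simpa using hi)]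
    by_cases h0 : coeff m F = 0
    · exact ⟨0, 0, by simp [h0]⟩
    have h3 := hF m h0
    rw [Finsupp.degree_eq_sum, Fin.sum_univ_two] at h3
    by_cases h4 : K ≤ m 0
    · exact ⟨monomial (m - Finsupp.single 0 K) (coeff m F), 0, by
        rw [mul_zero, add_zero]; exact h2 0 K h4⟩
    · exact ⟨0, monomial (m - Finsupp.single 1 M) (coeff m F), by
        rw [mul_zero, zero_add]; exact h2 1 M (by omega)⟩
  choose p q hpq using h1
  refine ⟨∑ m ∈ F.support, p m, ∑ m ∈ F.support, q m, ?_⟩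
  rw [Finset.mul_sum, Finset.mul_sum, ← Finset.sum_add_distrib]
  conv_lhs => rw [F.as_sum]
  exact Finset.sum_congr rfl fun m _ => hpq m

theorem sum_sub_mul_mul_eq_zero {R ι : Type*} [CommRing R] [Fintype ι] (q : ι → ι → R) (g : ι → R) :
    ∑ j, (∑ i, (q i j - q j i) * g i) * g j = 0 := by
  simp only [Finset.sum_mul, sub_mul, Finset.sum_sub_distrib]
  rw [sub_eq_zero, Finset.sum_comm]
  exact Finset.sum_congr rfl fun i _ => Finset.sum_congr rfl fun j _ => by ring

variable {k : Type*} [Field k] {r d : ℕ} {f : Fin r → MvPolynomial (Fin 2) k} {μ : Fin (r - 1) → ℕ}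

local notation "𝔸" => MvPolynomial (Fin r) k
local notation "ℛ" => MvPolynomial (Fin 2) k
local notation "𝔓" => MvPolynomial (Fin 2) (MvPolynomial (Fin r) k)

/-- In large degree with respect to `x, y`, the equations of the Rees algebra are linear. -/
theorem IsParametrization.exists_eq_sum_linearEquation (hf : IsParametrization f d)
    (Φ : Module.Basis (Fin (r - 1)) ℛ (syzygies f))
    (hΦ : ∀ j i, ((Φ j : Fin r → ℛ) i).IsHomogeneous (μ j)) {b t : ℤ}
    (hb : ∀ i j, i ≠ j → (μ i : ℤ) + μ j ≤ b + 1) {z : 𝔓} (hz : z ∈ polyPiece 𝔸 2 b)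
    (hzt : z ∈ coeffPiece k r 2 t) (hz0 : substitute f z = 0) :
    ∃ ρ : Fin (r - 1) → 𝔓, (∀ j, ρ j ∈ polyPiece 𝔸 2 (b - μ j)) ∧
      (∀ j, ρ j ∈ coeffPiece k r 2 (t - 1)) ∧ z = ∑ j, ρ j * linearEquation (Φ j : Fin r → ℛ) := by
  classical
  set g : Fin (r - 1) → 𝔓 := fun j => linearEquation (Φ j : Fin r → ℛ) with hg
  have hgR : ∀ j, g j ∈ polyPiece 𝔸 2 (μ j) := fun j =>
    linearEquation_mem_polyPiece fun i => mem_polyPiece_iff.mpr (hΦ j i)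
  have hgA : ∀ j, g j ∈ coeffPiece k r 2 1 := fun j => linearEquation_mem_coeffPiece _
  obtain ⟨N, hN⟩ := hf.exists_splitting Φ
  set M := N * t.toNat
  set M' := N * (t - 1).toNat
  have h1 : ∀ s : Fin 2, ∃ a : Fin (r - 1) → 𝔓, (∀ j, a j ∈ polyPiece 𝔸 2 (M + b - μ j)) ∧
      (∀ j, a j ∈ coeffPiece k r 2 (t - 1)) ∧ X s ^ M * z = ∑ j, a j * g j := fun s => by
    obtain ⟨u, l, h₁, -⟩ := hN s
    obtain ⟨a, ha⟩ := exists_pow_mul_eq_sum Φ h₁ hzt hz0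
    exact exists_bihomogeneous hgR hgA (mul_mem_polyPiece (X_pow_mem_polyPiece s M) hz)
      (mul_mem_coeffPiece (X_pow_mem_coeffPiece s M) hzt (zero_add t)) ha
  obtain ⟨a, haR, haA, ha⟩ := h1 0
  obtain ⟨b', hbR, hbA, hb'⟩ := h1 1
  obtain ⟨u, l, h₁, h₂⟩ := hN 0
  -- The representations of z on the two charts differ on the overlap by a relation between the g_j,
  -- which is Koszul up to a power of X_0.
  obtain ⟨δ, hδ⟩ := exists_pow_mul_eq_koszul Φ h₁ h₂ (t := t - 1)
    (c := fun j => X 1 ^ M * a j - X 0 ^ M * b' j)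
    (fun j => sub_mem (mul_mem_coeffPiece (X_pow_mem_coeffPiece 1 M) (haA j) (zero_add _))
      (mul_mem_coeffPiece (X_pow_mem_coeffPiece 0 M) (hbA j) (zero_add _))) (by
    simp only [sub_mul, Finset.sum_sub_distrib, mul_assoc, ← Finset.mul_sum]
    rw [← ha, ← hb']
    ring)
  set n : ℤ := M' + 2 * M + b with hn
  -- The diagonal entries cancel in δ_ij - δ_ji and are set to zero, because the degree bound is
  -- available only for i ≠ j.
  set δ' : Fin (r - 1) → Fin (r - 1) → 𝔓 := fun i j =>
    if i = j then 0 else component 𝔸 2 (n - μ i - μ j) (δ i j)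
  have hδ' : ∀ j, X 0 ^ M' * (X 1 ^ M * a j - X 0 ^ M * b' j) = ∑ i, (δ' i j - δ' j i) * g i :=
    fun j => by
    have h3 : X 0 ^ M' * (X 1 ^ M * a j - X 0 ^ M * b' j) ∈ polyPiece 𝔸 2 (n - μ j) :=
      mul_mem_polyPiece' (X_pow_mem_polyPiece 0 M') (sub_mem
        (mul_mem_polyPiece (X_pow_mem_polyPiece 1 M) (haR j))
        (mul_mem_polyPiece (X_pow_mem_polyPiece 0 M) (hbR j))) (by rw [hn]; ring)
    rw [← component_of_mem h3, hδ j, component_sum_mul fun i _ => hgR i]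
    refine Finset.sum_congr rfl fun i _ => ?_
    by_cases h4 : i = j
    · simp [δ', h4]
    · simp only [δ', if_neg h4, if_neg (Ne.symm h4), map_sub]
      rw [sub_right_comm n (μ j : ℤ)]
  -- The degree M' + 2M + b - μ_i - μ_j is at least (M' + M) + M - 1 precisely because μ_i + μ_j ≤ b
  -- + 1.
  have h5 : ∀ i j, ∃ p q, δ' i j = X 0 ^ (M' + M) * p + X 1 ^ M * q := fun i j => by
    by_cases h4 : i = j
    · exact ⟨0, 0, by simp [δ', h4]⟩
    · simp only [δ', if_neg h4]
      refine exists_eq_X_pow_mul_add ?_ (component_mem _ _)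
      have := hb i j h4
      push_cast
      omega
  choose p q hpq using h5
  -- The two parts of δ' are absorbed by the two charts. The corrected coefficients on the first
  -- chart become divisible by the power of X_0, and the Koszul correction does not change ∑ a_j
  -- g_j.
  have h6 : ∀ j, ∃ ρ, X 0 ^ M' * a j - ∑ i, (q i j - q j i) * g i = X 0 ^ (M' + M) * ρ := fun j => by
    refine Prime.pow_dvd_of_dvd_mul_left (a := X 1 ^ M) (X_prime) _ (fun h => ?_) ⟨b' j + ∑ i, (p i j - p j i) * g i, ?_⟩
    · have := (X_prime (i := (0 : Fin 2)) (R := 𝔸)).dvd_of_dvd_pow h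
      rw [X_dvd_X] at this
      simp at this
    · have h7 := hδ' j
      simp only [hpq] at h7
      have h8 : ∑ i, (X 0 ^ (M' + M) * p i j + X 1 ^ M * q i j -
          (X 0 ^ (M' + M) * p j i + X 1 ^ M * q j i)) * g i =
          X 0 ^ (M' + M) * ∑ i, (p i j - p j i) * g i + X 1 ^ M * ∑ i, (q i j - q j i) * g i := by
        rw [Finset.mul_sum, Finset.mul_sum, ← Finset.sum_add_distrib]
        exact Finset.sum_congr rfl fun i _ => by ring
      rw [h8] at h7
      linear_combination h7
  choose ρ hρ using h6
  refine exists_bihomogeneous hgR hgA hz hzt (a := ρ) ?_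
  have h9 : (X 0 ^ (M' + M) : 𝔓) ≠ 0 := pow_ne_zero _ (X_ne_zero 0)
  refine mul_left_cancel₀ h9 ?_
  have h10 : ∀ j, X 0 ^ (M' + M) * (ρ j * g j) =
      X 0 ^ M' * (a j * g j) - (∑ i, (q i j - q j i) * g i) * g j := fun j => by
    rw [← mul_assoc, ← hρ]; ring
  rw [Finset.mul_sum, Finset.sum_congr rfl fun j _ => h10 j, Finset.sum_sub_distrib,
    sum_sub_mul_mul_eq_zero, ← Finset.mul_sum, ← ha, pow_add]
  ring

end Rees

/-! ### The graded modules `⨁ R_(b + d j)` over `k[T_1, …, T_r]` -/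

section Target

variable {k : Type*} [Field k] {r d : ℕ} {f : Fin r → MvPolynomial (Fin 2) k}

local notation "𝔸" => MvPolynomial (Fin r) k
local notation "ℛ" => MvPolynomial (Fin 2) k

/-- The ring `k[x, y]` as an algebra over `k[T_1, …, T_r]` by `T_i ↦ f_i`. -/
def Target (_f : Fin r → MvPolynomial (Fin 2) k) : Type _ := MvPolynomial (Fin 2) k

instance : CommRing (Target f) := inferInstanceAs (CommRing (MvPolynomial (Fin 2) k))
instance : Algebra (MvPolynomial (Fin r) k) (Target f) :=
  (show MvPolynomial (Fin r) k →+* Target f from (aeval f : 𝔸 →ₐ[k] ℛ).toRingHom).toAlgebra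

theorem target_smul_def (F : 𝔸) (x : Target f) : F • x = @HMul.hMul ℛ ℛ ℛ _ (aeval f F) x := rfl

/-- The forms of degree `b + d * n`. -/
def targetPiece (f : Fin r → MvPolynomial (Fin 2) k) (d : ℕ) (b n : ℤ) : AddSubgroup (Target f) := polyPiece k 2 (b + d * n)

theorem mem_targetPiece_of_eq {b n e : ℤ} {x : ℛ} (hx : x ∈ polyPiece k 2 e) (he : e = b + d * n) :
    (show Target f from x) ∈ targetPiece f d b n := by
  subst he
  exact hx

theorem mem_targetPiece {b n : ℤ} {x : Target f} :
    x ∈ targetPiece f d b n ↔ (x : ℛ) ∈ polyPiece k 2 (b + d * n) := Iff.rfl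

theorem IsParametrization.targetPiece_graded (hf : IsParametrization f d) (b : ℤ) :
    IsGradedFamily k r (targetPiece f d b) := fun F e n x hF hx => by
  rw [target_smul_def]
  exact mul_mem_polyPiece' (hf.aeval_mem (mem_polyPiece_iff.mpr hF)) hx (by ring)

theorem mem_targetPiece_of_mul {F : 𝔸} {e : ℕ} (hf : IsParametrization f d) (hF : F.IsHomogeneous e)
    (hF0 : aeval f F ≠ 0) {b n m : ℤ} {x : Target f} (h : F • x ∈ targetPiece f d b m)
    (hm : n + e = m) : x ∈ targetPiece f d b n := by
  have h1 : @HMul.hMul ℛ ℛ ℛ _ x (aeval f F) ∈ polyPiece k 2 (b + d * m) := by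
    rw [@mul_comm ℛ _ x]; exact h
  exact mem_targetPiece_of_eq (mem_polyPiece_of_mul (hf.aeval_mem (mem_polyPiece_iff.mpr hF)) hF0 h1)
    (by rw [← hm]; ring)

/-- Two coprime forms ℓ₁, ℓ₂ give primitives s₁, s₂ of ℓ₁u, ℓ₂u, and s with ds = ℓ₁s₂ - ℓ₂s₁. If s =
ℓ₁w₁ + ℓ₂w₂, then ℓ₁ divides s₁ + dw₂ and the quotient is a primitive of u. For p < 2 there is no
condition because s = 0. -/
theorem IsParametrization.exists_koszulD_eq (hf : IsParametrization f d) {b p j : ℤ} {a : ℕ}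
    {u : Finset (Fin r) → Target f} (hu : u ∈ koszulCochain (targetPiece f d b) p j a)
    (hdu : koszulD k r (Target f) a u = 0) (h : p < 2 ∨ -1 ≤ b + d * (j + a * (p - 2))) :
    ∃ v ∈ koszulCochain (targetPiece f d b) (p - 1) j a, koszulD k r (Target f) a v = u := by
  have hZ := hf.targetPiece_graded b
  obtain ⟨E, hE⟩ := hf.exists_coprime_pair
  obtain ⟨ℓ₁, ℓ₂, hℓ₁, hℓ₂, h₁0, h₂0, hrel⟩ := hE (max E (r * a + a + 1)) (le_max_left _ _)
  set D := max E (r * a + a + 1)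
  have hD : r * a + a + 1 ≤ D := le_max_right _ _
  obtain ⟨γ₁, hγ₁, hg₁⟩ := exists_eq_sum_mul_X_pow (a := a) (δ := D - a) hℓ₁ (by omega) (by omega)
  obtain ⟨γ₂, hγ₂, hg₂⟩ := exists_eq_sum_mul_X_pow (a := a) (δ := D - a) hℓ₂ (by omega) (by omega)
  have hs : ∀ {γ : Fin r → 𝔸} (_ : ∀ i, (γ i).IsHomogeneous (D - a)) {w : Finset (Fin r) → Target f} {p q j j' : ℤ}
      (_ : w ∈ koszulCochain (targetPiece f d b) p j a) (_ : q + 1 = p) (_ : j + D = j'),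
      ∑ i, γ i • contr 𝔸 (Target f) i w ∈ koszulCochain (targetPiece f d b) q j' a :=
    fun hγ w p q j j' hw hq hj => sum_mem fun i _ => smul_mem_koszulCochain hZ (hγ i)
      (contr_mem hw i hq rfl) (by rw [← hj]; omega)
  obtain ⟨s₁, hs₁⟩ : ∃ s, s = ∑ i, γ₁ i • contr 𝔸 (Target f) i u := ⟨_, rfl⟩
  obtain ⟨s₂, hs₂⟩ : ∃ s, s = ∑ i, γ₂ i • contr 𝔸 (Target f) i u := ⟨_, rfl⟩
  obtain ⟨s, hs'⟩ : ∃ s, s = ∑ i, γ₁ i • contr 𝔸 (Target f) i s₂ := ⟨_, rfl⟩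
  have hm₁ : s₁ ∈ koszulCochain (targetPiece f d b) (p - 1) (j + D) a := hs₁ ▸ hs hγ₁ hu (by ring) rfl
  have hm₂ : s₂ ∈ koszulCochain (targetPiece f d b) (p - 1) (j + D) a := hs₂ ▸ hs hγ₂ hu (by ring) rfl
  have hm : s ∈ koszulCochain (targetPiece f d b) (p - 2) (j + 2 * D) a := hs' ▸ hs hγ₁ hm₂ (by ring) (by ring)
  have hd₁ : koszulD k r (Target f) a s₁ = ℓ₁ • u := by
    rw [hs₁, koszulD_sum_contr, ← hg₁, hdu]; simp
  have hd₂ : koszulD k r (Target f) a s₂ = ℓ₂ • u := by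
    rw [hs₂, koszulD_sum_contr, ← hg₂, hdu]; simp
  have hd : koszulD k r (Target f) a s = ℓ₁ • s₂ - ℓ₂ • s₁ := by
    have h1 : ∑ i, γ₁ i • contr 𝔸 (Target f) i (ℓ₂ • u) = ℓ₂ • s₁ := by
      rw [hs₁, Finset.smul_sum]
      exact Finset.sum_congr rfl fun i _ => by rw [map_smul, smul_comm]
    rw [hs', koszulD_sum_contr, ← hg₁, hd₂, h1]
  obtain ⟨w₁, hw₁, w₂, hw₂, hw⟩ : ∃ w₁ ∈ koszulCochain (targetPiece f d b) (p - 2) (j + D) a,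
      ∃ w₂ ∈ koszulCochain (targetPiece f d b) (p - 2) (j + D) a, s = ℓ₁ • w₁ + ℓ₂ • w₂ := by
    have key : ∀ σ, ∃ x y : Target f, ((σ.card : ℤ) ≠ p - 2 → x = 0 ∧ y = 0) ∧
        x ∈ targetPiece f d b (j + D + a * σ.card) ∧ y ∈ targetPiece f d b (j + D + a * σ.card) ∧
        s σ = ℓ₁ • x + ℓ₂ • y := fun σ => by
      by_cases hσ : (σ.card : ℤ) = p - 2
      · obtain ⟨x, hx, y, hy, hxy⟩ := exists_eq_add_of_isRelPrime
          (hf.aeval_mem (mem_polyPiece_iff.mpr hℓ₁)) (hf.aeval_mem (mem_polyPiece_iff.mpr hℓ₂)) h₁0 h₂0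
          hrel (by
            rcases h with h | h
            · omega
            · rw [hσ]
              linarith) (mem_targetPiece.mp (hm σ).2)
        refine ⟨x, y, fun h => absurd hσ h, mem_targetPiece_of_eq hx (by ring),
          mem_targetPiece_of_eq hy (by ring), hxy.trans ?_⟩
        rw [mul_comm x, mul_comm y]
        rfl
      · exact ⟨0, 0, fun _ => ⟨rfl, rfl⟩, zero_mem _, zero_mem _, by
          rw [(hm σ).1 hσ, smul_zero, smul_zero, add_zero]⟩
    choose x y h0 hx hy hxy using key
    exact ⟨x, fun σ => ⟨fun h => (h0 σ h).1, hx σ⟩, y, fun σ => ⟨fun h => (h0 σ h).2, hy σ⟩, _root_.funext hxy⟩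
  have hdw : ℓ₁ • (s₂ - koszulD k r (Target f) a w₁) = ℓ₂ • (s₁ + koszulD k r (Target f) a w₂) := by
    have h1 := hd
    rw [hw, map_add, map_smul, map_smul] at h1
    rw [smul_sub, smul_add, sub_eq_iff_eq_add]
    have h2 := sub_eq_iff_eq_add.mp h1.symm
    rw [h2]
    abel
  have hmem : s₁ + koszulD k r (Target f) a w₂ ∈ koszulCochain (targetPiece f d b) (p - 1) (j + D) a :=
    add_mem hm₁ (koszulD_mem hZ hw₂ (by ring))
  have hdvd : ∀ σ, ∃ v : Target f, (s₁ + koszulD k r (Target f) a w₂) σ = ℓ₁ • v := fun σ => by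
    have h1 : @HMul.hMul ℛ ℛ ℛ _ (aeval f ℓ₁) ((s₂ - koszulD k r (Target f) a w₁) σ) =
        @HMul.hMul ℛ ℛ ℛ _ (aeval f ℓ₂) ((s₁ + koszulD k r (Target f) a w₂) σ) := congrFun hdw σ
    obtain ⟨v, hv⟩ := hrel.dvd_of_dvd_mul_left (Dvd.intro _ h1)
    exact ⟨v, hv⟩
  choose v hv using hdvd
  have hcancel : ∀ x y : Target f, ℓ₁ • x = ℓ₁ • y → x = y := fun x y h =>
    mul_left_cancel₀ (M₀ := ℛ) h₁0 h
  refine ⟨v, fun σ => ⟨fun h => hcancel _ _ ?_, ?_⟩, ?_⟩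
  · rw [← hv, (hmem σ).1 h, smul_zero]
  · refine mem_targetPiece_of_mul hf hℓ₁ h₁0 (hv σ ▸ (hmem σ).2) (by ring)
  · have h1 : ℓ₁ • v = s₁ + koszulD k r (Target f) a w₂ := _root_.funext fun σ => (hv σ).symm
    have h2 : ℓ₁ • koszulD k r (Target f) a v = ℓ₁ • u := by
      rw [← map_smul, h1, map_add, koszulD_koszulD, add_zero, hd₁]
    exact _root_.funext fun σ => hcancel _ _ (congrFun h2 σ)

/-- The local cohomology of the modules `⨁ R_(b + d j)`. -/
theorem IsParametrization.cohomologyVanishes_targetPiece (hf : IsParametrization f d) {b p j : ℤ}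
    (h : p = 2 → -1 ≤ b + d * j) :
    CohomologyVanishes k r p j (targetPiece f d b) (fun _ => ⊥) := by
  intro a u hu hdu
  have hdu0 : koszulD k r (Target f) a u = 0 := _root_.funext fun σ => (hdu σ).2
  have hZ := hf.targetPiece_graded b
  -- For p > 2 the degrees at sets with p - 2 elements grow with the exponent, so this shift brings
  -- them above -1. For p = 2 the degree does not depend on the exponent.
  set c := (|b| + d * |j|).toNat
  obtain ⟨v, hv, hvu⟩ := hf.exists_koszulD_eq (koszulShift_mem (b := c) hZ hu) (by
    rw [koszulD_koszulShift, hdu0, map_zero]) (by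
    rcases lt_trichotomy p 2 with h1 | h1 | h1
    · exact Or.inl h1
    · exact Or.inr (by rw [h1]; simpa using h h1)
    · refine Or.inr ?_
      have h2 : |b| + d * |j| ≤ c := Int.self_le_toNat _
      have h3 := neg_abs_le b
      have h4 := neg_abs_le j
      have h5 := abs_nonneg j
      have h6 : (1 : ℤ) ≤ d := by exact_mod_cast hf.one_le
      have h7 : (c : ℤ) ≤ (a + c : ℕ) * (p - 2) := by
        push_cast; nlinarith
      nlinarith [abs_nonneg b])
  exact ⟨c, v, hv, by rw [hvu, sub_self]; exact zero_mem _⟩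

end Target

/-! ### The linear presentation of the cokernel of `B → ⨁ R_(b + d j)` -/

section Presentation

theorem eq_sum_monomial_binaryExponent {R : Type*} [CommRing R] {n : ℕ} {F : MvPolynomial (Fin 2) R}
    (hF : F ∈ polyPiece R 2 n) :
    F = ∑ i : Fin (n + 1), monomial (binaryExponent n i) (coeff (binaryExponent n i) F) := by
  ext m
  rw [coeff_sum]
  simp only [coeff_monomial]
  by_cases hm : m.degree = n
  · have h1 := eq_binaryExponent hm
    have h2 := le_of_degree hm
    rw [Finset.sum_eq_single (⟨m 0, by omega⟩ : Fin (n + 1))]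
    · rw [if_pos h1.symm, ← h1]
    · intro i _ hi
      rw [if_neg]
      intro h3
      refine hi (Fin.ext ?_)
      have := DFunLike.congr_fun h3 0
      simpa [binaryExponent] using this
    · simp
  · rw [Finset.sum_eq_zero]
    · by_contra h
      exact hm (by exact_mod_cast hF m h)
    · intro i _
      rw [if_neg]
      rintro rfl
      exact hm (binaryExponent_degree (by omega))

theorem coeff_monomial_binaryExponent {R : Type*} [CommRing R] {n i i' : ℕ} (a : R) :
    coeff (binaryExponent n i) (monomial (binaryExponent n i') a) = if i' = i then a else 0 := by
  rw [coeff_monomial]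
  refine if_congr ⟨fun h => ?_, fun h => by rw [h]⟩ rfl rfl
  have := DFunLike.congr_fun h 0
  simpa [binaryExponent] using this

theorem monomial_binaryExponent_mem {R : Type*} [CommRing R] {n i : ℕ} (h : i ≤ n) (a : R) :
    monomial (binaryExponent n i) a ∈ polyPiece R 2 n :=
  mem_polyPiece_iff.mpr (isHomogeneous_monomial _ (binaryExponent_degree h))

variable {k : Type*} [Field k] {r d : ℕ} {f : Fin r → MvPolynomial (Fin 2) k} {μ : Fin (r - 1) → ℕ}

local notation "𝔸" => MvPolynomial (Fin r) k
local notation "ℛ" => MvPolynomial (Fin 2) k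
local notation "𝔓" => MvPolynomial (Fin 2) (MvPolynomial (Fin r) k)

variable (f) in
/-- The multiples of `y ^ b` in the graded pieces of the image of `k[T_1, …, T_r]` in `R`. -/
def subPiece (b : ℕ) (n : ℤ) : AddSubgroup (Target f) :=
  (polyPiece k r n).map (AddMonoidHom.comp
    (AddMonoidHom.mulRight (X 1 ^ b : ℛ)) (aeval f : 𝔸 →ₐ[k] ℛ).toRingHom.toAddMonoidHom)

theorem mem_subPiece {b : ℕ} {n : ℤ} {x : Target f} :
    x ∈ subPiece f b n ↔ ∃ F ∈ polyPiece k r n, (aeval f F * X 1 ^ b : ℛ) = x := Iff.rfl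

variable (f) in
/-- The map from a free module which sends the basis to the monomials of degree `b`, except
`y ^ b`. -/
def presentationMap (b : ℕ) : (Fin b → 𝔸) →ₗ[𝔸] Target f :=
  Fintype.linearCombination 𝔸 fun l : Fin b =>
    (show Target f from monomial (binaryExponent b (l + 1)) (1 : k))

theorem presentationMap_apply (b : ℕ) (x : Fin b → 𝔸) : presentationMap f b x =
    (∑ l : Fin b, aeval f (x l) * monomial (binaryExponent b (l + 1)) (1 : k) : ℛ) := rfl

theorem substitute_monomial (m : Fin 2 →₀ ℕ) (F : 𝔸) :
    substitute f (monomial m F) = aeval f F * monomial m 1 := by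
  rw [substitute, eval₂Hom_monomial, monomial_eq (a := (1 : k)), C_1, one_mul]
  rfl

theorem binaryExponent_zero (b : ℕ) : (monomial (binaryExponent b 0) (1 : k) : ℛ) = X 1 ^ b := by
  rw [X_pow_eq_monomial, binaryExponent]; simp

theorem presentationMap_coeff {b : ℕ} {w : 𝔓} (hw : w ∈ polyPiece 𝔸 2 b) :
    (presentationMap f b fun l => coeff (binaryExponent b (l + 1)) w) =
      (substitute f w - aeval f (coeff (binaryExponent b 0) w) * X 1 ^ b : ℛ) := by
  have h := congrArg (substitute f) (eq_sum_monomial_binaryExponent hw)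
  rw [map_sum, Fin.sum_univ_succ] at h
  simp only [substitute_monomial, Fin.val_zero, Fin.val_succ, binaryExponent_zero] at h
  rw [presentationMap_apply, h]
  exact (add_sub_cancel_left _ _).symm

/-- The multiples of bidegree `(b, 1)` of linear equations. -/
def equationMultiple (g : Fin (r - 1) → 𝔓) (μ : Fin (r - 1) → ℕ) (b : ℕ)
    (c : Fin (r - 1) × Fin (b + 1)) : 𝔓 :=
  if c.2 + μ c.1 ≤ b then monomial (binaryExponent (b - μ c.1) c.2) 1 * g c.1 else 0

/-! ### The multiples of the linear equations in bidegree (b, 1) -/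

section Multiples

variable {g : Fin (r - 1) → MvPolynomial (Fin 2) (MvPolynomial (Fin r) k)} {b : ℕ}

theorem equationMultiple_mem_polyPiece (hg : ∀ j, g j ∈ polyPiece 𝔸 2 (μ j)) (c) :
    equationMultiple g μ b c ∈ polyPiece 𝔸 2 b := by
  unfold equationMultiple
  split_ifs with h
  · exact mul_mem_polyPiece' (monomial_binaryExponent_mem (by omega) _) (hg c.1) (by omega)
  · exact zero_mem _

theorem equationMultiple_mem_coeffPiece (hg : ∀ j, g j ∈ coeffPiece k r 2 1) (c) :
    equationMultiple g μ b c ∈ coeffPiece k r 2 1 := by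
  unfold equationMultiple
  split_ifs with h
  · refine mul_mem_coeffPiece (a := 0) (fun m => ?_) (hg c.1) (zero_add 1)
    rw [coeff_monomial]
    split_ifs
    · exact C_mem_polyPiece 1
    · exact zero_mem _
  · exact zero_mem _

theorem substitute_equationMultiple (hg : ∀ j, substitute f (g j) = 0) (c) :
    substitute f (equationMultiple g μ b c) = 0 := by
  unfold equationMultiple
  split_ifs
  · rw [map_mul, hg, mul_zero]
  · exact map_zero _

theorem exists_eq_sum_equationMultiple {ρ : Fin (r - 1) → 𝔓}
    (hρ : ∀ j, ρ j ∈ polyPiece 𝔸 2 ((b : ℤ) - μ j)) {t : ℤ} (hρ' : ∀ j, ρ j ∈ coeffPiece k r 2 t) :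
    ∃ y : Fin (r - 1) × Fin (b + 1) → 𝔸, (∀ c, y c ∈ polyPiece k r t) ∧
      ∑ j, ρ j * g j = ∑ c, C (y c) * equationMultiple g μ b c := by
  refine ⟨fun c => coeff (binaryExponent (b - μ c.1) c.2) (ρ c.1), fun c => hρ' _ _, ?_⟩
  rw [Fintype.sum_prod_type]
  refine Finset.sum_congr rfl fun j _ => ?_
  rcases lt_or_ge b (μ j) with h | h
  · rw [polyPiece_of_neg (by omega) (hρ j), zero_mul]
    refine (Finset.sum_eq_zero fun i _ => ?_).symm
    rw [equationMultiple, if_neg (by simp only; omega), mul_zero]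
  · have h1 : ρ j ∈ polyPiece 𝔸 2 ((b - μ j : ℕ) : ℤ) := by rw [Nat.cast_sub h]; exact hρ j
    conv_lhs => rw [eq_sum_monomial_binaryExponent h1, Finset.sum_mul]
    change _ = ∑ i : Fin (b + 1), C (coeff (binaryExponent (b - μ j) i) (ρ j)) *
      if (i : ℕ) + μ j ≤ b then monomial (binaryExponent (b - μ j) i) 1 * g j else 0
    rw [Fin.sum_univ_eq_sum_range (fun i => monomial (binaryExponent (b - μ j) i)
      (coeff (binaryExponent (b - μ j) i) (ρ j)) * g j), 
      Fin.sum_univ_eq_sum_range (fun i => C (coeff (binaryExponent (b - μ j) i) (ρ j)) *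
        if i + μ j ≤ b then monomial (binaryExponent (b - μ j) i) 1 * g j else 0)]
    refine Finset.sum_subset_zero_on_sdiff (fun i hi => ?_) (fun i hi => ?_) fun i hi => ?_
    · simp only [Finset.mem_range] at hi ⊢; omega
    · simp only [Finset.mem_sdiff, Finset.mem_range] at hi
      rw [if_neg (by omega), mul_zero]
    · rw [Finset.mem_range] at hi
      rw [if_pos (by omega), ← mul_assoc, C_mul_monomial, mul_one]

end Multiples

theorem substitute_linearEquation {φ : Fin r → ℛ} (hφ : φ ∈ syzygies f) :
    substitute f (linearEquation φ) = 0 := by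
  rw [← mem_syzygies.mp hφ, linearEquation, map_sum]
  refine Finset.sum_congr rfl fun i _ => ?_
  have h : (substitute f).comp (MvPolynomial.map C) = RingHom.id ℛ := by
    refine ringHom_ext' ?_ fun i => by simp [substitute]
    ext c
    simp [substitute]
  rw [map_mul]
  congr 1
  · exact RingHom.congr_fun h _
  · simp [substitute]

/-- The pieces `R_(b + d n)` are generated by the monomials of degree `b`. -/
theorem IsSyzygyDegrees.exists_eq_sum_monomial (hf : IsParametrization f d) (hμ : IsSyzygyDegrees f μ)
    {b : ℕ} (hb : ∀ j, μ j ≤ b + 1) (n : ℕ) {F : ℛ} (hF : F ∈ polyPiece k 2 (b + d * n : ℕ)) :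
    ∃ w : 𝔓, w ∈ polyPiece 𝔸 2 b ∧ w ∈ coeffPiece k r 2 n ∧ substitute f w = F := by
  induction n generalizing F with
  | zero =>
    refine ⟨MvPolynomial.map C F, map_C_mem_polyPiece (by simpa using hF), map_C_mem_coeffPiece F, ?_⟩
    have h : (substitute f).comp (MvPolynomial.map C) = RingHom.id ℛ := by
      refine ringHom_ext' ?_ fun i => by simp [substitute]
      ext c
      simp [substitute]
    exact RingHom.congr_fun h _
  | succ n ih =>
    -- Each step from n to n + 1 writes a form as ∑ a_i f_i, which is possible from degree b + d on
    -- because μ_j ≤ b + 1.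
    obtain ⟨a, ha, hF'⟩ := hμ.exists_eq_sum hf (m := b + d * n) (e := b + d * (n + 1)) (fun j => by
      have := hb j; nlinarith [Nat.zero_le (d * n)]) (by ring) hF
    choose w hw hw' hwa using fun i => ih (ha i)
    refine ⟨∑ i, w i * C (X i), sum_mem fun i _ => mul_mem_polyPiece' (hw i) (C_mem_polyPiece _) (add_zero _),
      sum_mem fun i _ => mul_mem_coeffPiece (hw' i) (C_mem_coeffPiece (X_mem_polyPiece i)) (by push_cast; ring), ?_⟩
    rw [← hF', map_sum]
    refine Finset.sum_congr rfl fun i _ => ?_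
    rw [map_mul, hwa]
    simp [substitute]

/-- Relations among the monomials of degree b are Rees equations of degree b in x, y, hence
combinations of the linear ones. Reading off their coefficients except that of y^b presents the
quotient by the multiples of y^b. -/
theorem IsSyzygyDegrees.exists_presentation (hf : IsParametrization f d) (hμ : IsSyzygyDegrees f μ)
    {b : ℕ} (hb : ∀ i j, i ≠ j → μ i + μ j ≤ b + 1) (hb' : ∀ j, μ j ≤ b + 1) (hbd : b < d) :
    ∃ (m : ℕ) (κ : Fin m → Fin b → 𝔸), (∀ c l, κ c l ∈ polyPiece k r 1) ∧
      InducesIso (presentationMap f b) (freePiece k r b) (spanPiece κ) (targetPiece f d b)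
        (subPiece f b) := by
  have hμ' := hμ
  obtain ⟨Φ, hΦ⟩ := hμ
  set g : Fin (r - 1) → 𝔓 := fun j => linearEquation (Φ j : Fin r → ℛ)
  have hgR : ∀ j, g j ∈ polyPiece 𝔸 2 (μ j) := fun j =>
    linearEquation_mem_polyPiece fun i => mem_polyPiece_iff.mpr (hΦ j i)
  have hgA : ∀ j, g j ∈ coeffPiece k r 2 1 := fun j => linearEquation_mem_coeffPiece _
  have hg0 : ∀ j, substitute f (g j) = 0 := fun j => substitute_linearEquation (Φ j).2
  have hWR := equationMultiple_mem_polyPiece (b := b) hgR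
  have hWA := equationMultiple_mem_coeffPiece (μ := μ) (b := b) hgA
  have hW0 := substitute_equationMultiple (μ := μ) (b := b) hg0
  let e := (finProdFinEquiv : Fin (r - 1) × Fin (b + 1) ≃ _)
  refine ⟨_, fun c l => coeff (binaryExponent b (l + 1)) (equationMultiple g μ b (e.symm c)),
    fun c l => hWA _ _, ⟨fun n x hx => ?_, fun n x hx => ?_, fun n x hx => ?_, fun n x hx hgx => ?_⟩⟩
  · have h1 : (∑ l : Fin b, aeval f (x l) * monomial (binaryExponent b (l + 1)) (1 : k) : ℛ) ∈
        polyPiece k 2 (b + d * n) :=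
      sum_mem fun l _ => mul_mem_polyPiece' (hf.aeval_mem (hx l))
        (monomial_binaryExponent_mem (by omega) _) (by ring)
    exact mem_targetPiece_of_eq h1 rfl
  · obtain ⟨y, hy, rfl⟩ := hx
    set w : 𝔓 := ∑ c, C (y c) * equationMultiple g μ b (e.symm c) with hw
    have hwR : w ∈ polyPiece 𝔸 2 b := sum_mem fun c _ =>
      mul_mem_polyPiece' (C_mem_polyPiece _) (hWR _) (zero_add _)
    have hwA : w ∈ coeffPiece k r 2 n := sum_mem fun c _ =>
      mul_mem_coeffPiece (C_mem_coeffPiece (hy c)) (hWA _) (by ring)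
    have h1 : (∑ c, y c • fun l : Fin b => coeff (binaryExponent b (l + 1))
        (equationMultiple g μ b (e.symm c))) = fun l : Fin b => coeff (binaryExponent b (l + 1)) w := by
      ext1 l
      rw [hw, coeff_sum, Finset.sum_apply]
      simp only [coeff_C_mul, Pi.smul_apply, smul_eq_mul]
    have h2 : substitute f w = 0 := by
      rw [hw, map_sum]
      exact Finset.sum_eq_zero fun c _ => by rw [map_mul, hW0, mul_zero]
    rw [h1, presentationMap_coeff hwR, h2]
    refine mem_subPiece.mpr ⟨- coeff (binaryExponent b 0) w, neg_mem (hwA _), ?_⟩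
    rw [map_neg]
    ring
  · rcases lt_or_ge n 0 with hn | hn
    -- Because b < d, the module has no elements in negative degrees, so the generators in degree 0
    -- suffice.
    · have h1 : b + d * n < 0 := by nlinarith
      rw [show x = 0 from polyPiece_of_neg h1 hx]
      exact ⟨0, zero_mem _, by rw [map_zero, sub_zero]; exact zero_mem _⟩
    · lift n to ℕ using hn
      obtain ⟨w, hwR, hwA, hwx⟩ := hμ'.exists_eq_sum_monomial hf hb' n (F := x) (by
        push_cast; exact hx)
      refine ⟨fun l => coeff (binaryExponent b (l + 1)) w, fun l => hwA _, ?_⟩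
      rw [presentationMap_coeff hwR]
      refine mem_subPiece.mpr ⟨coeff (binaryExponent b 0) w, hwA _, ?_⟩
      rw [← hwx]
      exact (sub_sub_cancel _ _).symm
  · obtain ⟨F, hF, hFx⟩ := mem_subPiece.mp hgx
    -- The coefficient -F at y^b turns a relation modulo the multiples of y^b into an equation of
    -- the Rees algebra.
    set w : 𝔓 := ∑ i : Fin (b + 1), monomial (binaryExponent b i)
      ((Fin.cons (-F) x : Fin (b + 1) → 𝔸) i) with hw
    have hwR : w ∈ polyPiece 𝔸 2 b := sum_mem fun i _ => monomial_binaryExponent_mem (by omega) _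
    have hwA : w ∈ coeffPiece k r 2 n := sum_mem fun i _ m => by
      rw [coeff_monomial]
      split_ifs
      · refine Fin.cases ?_ (fun l => ?_) i
        · exact neg_mem hF
        · exact hx l
      · exact zero_mem _
    have hwc : ∀ i : Fin (b + 1), coeff (binaryExponent b i) w =
        (Fin.cons (-F) x : Fin (b + 1) → 𝔸) i := fun i => by
      rw [hw, coeff_sum]
      simp only [coeff_monomial_binaryExponent, Fin.val_inj]
      simp
    have hwx : (fun l : Fin b => coeff (binaryExponent b (l + 1)) w) = x := _root_.funext fun l =>
      hwc l.succ
    have hw0 : coeff (binaryExponent b 0) w = -F := hwc 0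
    have h1 : substitute f w = 0 := by
      have h2 := presentationMap_coeff (f := f) hwR
      rw [hwx, hw0, map_neg] at h2
      have h3 := hFx.trans h2
      have h4 : (aeval f F * X 1 ^ b : ℛ) = substitute f w - -(aeval f F) * X 1 ^ b := h3
      linear_combination -h4
    obtain ⟨ρ, hρR, hρA, hρ⟩ := hf.exists_eq_sum_linearEquation Φ hΦ
      (fun i j h => by exact_mod_cast hb i j h) hwR hwA h1
    obtain ⟨y, hy, hyw⟩ := exists_eq_sum_equationMultiple (g := g) hρR hρA
    refine ⟨fun c => y (e.symm c), fun c => hy _, ?_⟩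
    rw [← hwx]
    ext1 l
    rw [hρ, hyw, coeff_sum, Finset.sum_apply, ← e.symm.sum_comp]
    simp only [coeff_C_mul, Pi.smul_apply, smul_eq_mul]

end Presentation

/-! ### Consequences of birationality -/

section Conductor

variable {k : Type*} [Field k] {r d : ℕ} {f : Fin r → MvPolynomial (Fin 2) k} {μ : Fin (r - 1) → ℕ}

local notation "𝔸" => MvPolynomial (Fin r) k
local notation "ℛ" => MvPolynomial (Fin 2) k
local notation "𝔓" => MvPolynomial (Fin 2) (MvPolynomial (Fin r) k)

theorem IsBirationalOntoImage.exists_mul_eq (hbir : IsBirationalOntoImage f) {n : ℕ} {p q : ℛ}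
    (hp : p.IsHomogeneous n) (hq : q.IsHomogeneous n) (hq0 : q ≠ 0) :
    ∃ (m : ℕ) (F G : 𝔸), F.IsHomogeneous m ∧ G.IsHomogeneous m ∧ aeval f G ≠ 0 ∧
      aeval f G * p = aeval f F * q := by
  obtain ⟨m, F, G, hF, hG, hG0, h⟩ := hbir n p q hp hq hq0
  refine ⟨m, F, G, hF, hG, hG0, ?_⟩
  have h1 : ∀ {x : ℛ}, x ≠ 0 → algebraMap ℛ (FractionRing ℛ) x ≠ 0 := fun hx =>
    (map_ne_zero_iff _ (IsFractionRing.injective _ _)).mpr hx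
  rw [div_eq_div_iff (h1 hq0) (h1 hG0), ← map_mul, ← map_mul] at h
  rw [mul_comm]
  exact IsFractionRing.injective _ _ h

/-- A form which multiplies `R_(b + d n)` into the multiples of `y ^ b` in the image of
`k[T_1, …, T_r]`. -/
theorem IsSyzygyDegrees.exists_conductor (hf : IsParametrization f d) (hμ : IsSyzygyDegrees f μ)
    (hbir : IsBirationalOntoImage f) {b : ℕ} (hb : ∀ j, μ j ≤ b + 1) :
    ∃ (e : ℕ) (c : 𝔸), c.IsHomogeneous e ∧ aeval f c ≠ 0 ∧
      ∀ n : ℕ, ∀ x ∈ polyPiece k 2 (b + d * n : ℕ), ∃ G ∈ polyPiece k r (n + e : ℕ),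
        aeval f c * x = aeval f G * X 1 ^ b := by
  classical
  -- Birationality writes each x^i y^(b-i) / y^b as a fraction of forms in f. The product of the
  -- denominators is the conductor.
  have h1 : ∀ i : Fin (b + 1), ∃ (m : ℕ) (F G : 𝔸), F.IsHomogeneous m ∧ G.IsHomogeneous m ∧
      aeval f G ≠ 0 ∧ aeval f G * monomial (binaryExponent b i) 1 = aeval f F * X 1 ^ b := fun i =>
    hbir.exists_mul_eq (isHomogeneous_monomial _ (binaryExponent_degree (by omega)))
      (isHomogeneous_X_pow 1 b) (pow_ne_zero _ (X_ne_zero 1))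
  choose m F G hF hG hG0 hFG using h1
  refine ⟨∑ i, m i, ∏ i, G i, IsHomogeneous.prod _ _ _ fun i _ => hG i, ?_, fun n x hx => ?_⟩
  · rw [map_prod]
    exact Finset.prod_ne_zero_iff.mpr fun i _ => hG0 i
  obtain ⟨w, hwR, hwA, rfl⟩ := hμ.exists_eq_sum_monomial hf hb n hx
  refine ⟨∑ i : Fin (b + 1), coeff (binaryExponent b i) w * (F i * ∏ l ∈ Finset.univ.erase i, G l),
    sum_mem fun i _ => mul_mem_polyPiece' (hwA _) (mem_polyPiece_iff.mpr ((hF i).mul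
      (IsHomogeneous.prod _ _ _ fun l _ => hG l))) ?_, ?_⟩
  · rw [Finset.add_sum_erase _ _ (Finset.mem_univ i)]
    push_cast
    rfl
  · conv_lhs => rw [eq_sum_monomial_binaryExponent hwR]
    rw [map_sum, map_sum, Finset.mul_sum, Finset.sum_mul]
    refine Finset.sum_congr rfl fun i _ => ?_
    rw [substitute_monomial, ← Finset.mul_prod_erase _ _ (Finset.mem_univ i), map_mul, map_mul, map_mul]
    linear_combination (aeval f (∏ l ∈ Finset.univ.erase i, G l)) * (aeval f (coeff (binaryExponent b i) w)) * hFG i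

theorem IsParametrization.aeval_component (hf : IsParametrization f d) (n : ℤ) (F : 𝔸) :
    aeval f (component k r n F) = component k 2 (d * n) (aeval f F) := by
  conv_lhs => rw [← sum_component F]
  conv_rhs => rw [← sum_component F]
  simp only [map_sum]
  refine Finset.sum_congr rfl fun i _ => ?_
  have h1 := component_mem (i : ℤ) F
  by_cases h : (i : ℤ) = n
  · subst h
    rw [component_of_mem h1, component_of_mem (hf.aeval_mem h1)]
  · rw [component_of_mem_of_ne h1 h, component_of_mem_of_ne (hf.aeval_mem h1), map_zero]
    have := hf.one_le
    intro h2
    exact h (mul_left_cancel₀ (by omega) h2)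

/-- Powers of the variables lie in the ideal generated by two forms without common zero on the
curve. -/
theorem IsSyzygyDegrees.exists_parameter (hf : IsParametrization f d) (hμ : IsSyzygyDegrees f μ)
    {ec e : ℕ} {c ℓ : 𝔸} (hc : c.IsHomogeneous ec) (hℓ : ℓ.IsHomogeneous e) (hc0 : aeval f c ≠ 0)
    (hℓ0 : aeval f ℓ ≠ 0) (hrel : IsRelPrime (aeval f ℓ) (aeval f c)) :
    ∃ N : ℕ, e ≤ N ∧ ec ≤ N ∧ ∀ i, ∃ β γ : 𝔸, β ∈ polyPiece k r (N - e) ∧ γ ∈ polyPiece k r (N - ec) ∧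
      f i ^ N = aeval f β * aeval f ℓ + aeval f γ * aeval f c := by
  classical
  obtain ⟨b, hb⟩ : ∃ b : ℕ, ∀ j, μ j ≤ b + 1 := ⟨∑ j, μ j, fun j =>
    (Finset.single_le_sum (fun _ _ => Nat.zero_le _) (Finset.mem_univ j)).trans (Nat.le_succ _)⟩
  -- Then b + dE exceeds the bound for the coprime forms of degrees de and d·ec, and the cofactors
  -- have degrees b + d(ec + 1) and b + d(e + 1), so they are again combinations of the monomials of
  -- degree b.
  set E := ec + e + 1 with hE
  refine ⟨E * (b + 1), by nlinarith, by nlinarith, fun i => ?_⟩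
  have hd := hf.one_le
  set v : Fin (b + 1) → ℛ := fun l => monomial (binaryExponent b l) 1 with hv
  have h1 : ∀ j, ∃ α α' : Fin (b + 1) → 𝔸, f i ^ E * v j =
      (∑ l, aeval f (α l) * v l) * aeval f ℓ + (∑ l, aeval f (α' l) * v l) * aeval f c := fun j => by
    obtain ⟨x, hx, x', hx', h2⟩ := exists_eq_add_of_isRelPrime (e := b + d * E)
      (hf.aeval_mem (mem_polyPiece_iff.mpr hℓ)) (hf.aeval_mem (mem_polyPiece_iff.mpr hc)) hℓ0 hc0
      hrel (by rw [hE]; push_cast; nlinarith) (F := f i ^ E * v j)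
      (mul_mem_polyPiece' (mem_polyPiece_iff.mpr ((hf.isHomogeneous i).pow E))
        (monomial_binaryExponent_mem (by omega) _) (by push_cast; ring))
    have h3 : ∀ {x : ℛ} {n : ℕ}, x ∈ polyPiece k 2 (b + d * n : ℕ) → ∃ α : Fin (b + 1) → 𝔸,
        x = ∑ l, aeval f (α l) * v l := fun {x n} hx => by
      obtain ⟨w, hwR, -, rfl⟩ := hμ.exists_eq_sum_monomial hf hb n hx
      refine ⟨fun l => coeff (binaryExponent b l) w, ?_⟩
      conv_lhs => rw [eq_sum_monomial_binaryExponent hwR]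
      simp only [map_sum, substitute_monomial, hv]
    obtain ⟨α, rfl⟩ := h3 (n := ec + 1) (x := x) (by
      convert hx using 2; rw [hE]; push_cast; ring)
    obtain ⟨α', rfl⟩ := h3 (n := e + 1) (x := x') (by
      convert hx' using 2; rw [hE]; push_cast; ring)
    exact ⟨α, α', h2⟩
  choose α α' hα using h1
  -- The determinant trick: on the curve `Q` kills the nonzero vector of monomials, so its
  -- determinant vanishes there. Modulo (ℓ, c) that determinant is X_i^(E(b+1)).
  obtain ⟨Q, hQe⟩ : ∃ Q : Matrix (Fin (b + 1)) (Fin (b + 1)) 𝔸, ∀ j l,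
      Q j l = (if j = l then X i ^ E else 0) - (α j l * ℓ + α' j l * c) :=
    ⟨Matrix.of fun j l => (if j = l then X i ^ E else 0) - (α j l * ℓ + α' j l * c), fun _ _ => rfl⟩
  have hQ : aeval f Q.det = 0 := by
    rw [AlgHom.map_det]
    refine Matrix.exists_mulVec_eq_zero_iff.mp ⟨v, fun h => ?_, _root_.funext fun j => ?_⟩
    · have := congrFun h 0
      simp [hv] at this
    · have h4 := hα j
      simp only [Finset.sum_mul] at h4
      simp only [Matrix.mulVec, dotProduct, AlgHom.mapMatrix_apply, Matrix.map_apply, hQe,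
        map_sub, sub_mul, Finset.sum_sub_distrib, map_add, map_mul, add_mul, Finset.sum_add_distrib,
        Pi.zero_apply]
      rw [Finset.sum_eq_single j (fun l _ hl => by rw [if_neg hl.symm, map_zero, zero_mul]) (by simp),
        if_pos rfl, map_pow, aeval_X, h4, sub_eq_zero]
      refine congrArg₂ (· + ·) (Finset.sum_congr rfl fun l _ => ?_)
        (Finset.sum_congr rfl fun l _ => ?_) <;> ring
  obtain ⟨x, y, hxy⟩ : ∃ x y, X i ^ (E * (b + 1)) - Q.det = x * ℓ + y * c := by
    have h5 : X i ^ (E * (b + 1)) - Q.det ∈ Ideal.span {ℓ, c} := by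
      rw [← Ideal.Quotient.eq_zero_iff_mem, map_sub, RingHom.map_det, sub_eq_zero]
      have h6 : (Ideal.Quotient.mk (Ideal.span {ℓ, c})).mapMatrix Q =
          Matrix.scalar _ (Ideal.Quotient.mk (Ideal.span {ℓ, c}) (X i ^ E)) := by
        ext j l
        have h7 : Ideal.Quotient.mk (Ideal.span {ℓ, c}) (α j l * ℓ + α' j l * c) = 0 :=
          Ideal.Quotient.eq_zero_iff_mem.mpr (Ideal.mem_span_pair.mpr ⟨_, _, rfl⟩)
        rw [RingHom.mapMatrix_apply, Matrix.map_apply, hQe, map_sub, h7, sub_zero,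
          Matrix.scalar_apply, Matrix.diagonal_apply]
        split_ifs <;> simp
      rw [h6]
      simp [pow_mul]
    obtain ⟨x, y, h⟩ := Ideal.mem_span_pair.mp h5
    exact ⟨x, y, h.symm⟩
  refine ⟨component k r ((E * (b + 1) : ℕ) - e) x, component k r ((E * (b + 1) : ℕ) - ec) y,
    component_mem _ _, component_mem _ _, ?_⟩
  have h8 := congrArg (aeval f ∘ component k r (E * (b + 1) : ℕ)) hxy
  simp only [Function.comp_apply, map_sub, map_add] at h8
  rw [component_mul (mem_polyPiece_iff.mpr hℓ), component_mul (mem_polyPiece_iff.mpr hc),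
    component_of_mem (X_pow_mem_polyPiece i _), hf.aeval_component _ Q.det, hQ, map_zero, sub_zero,
    map_pow, aeval_X, map_mul, map_mul] at h8
  exact h8

end Conductor

/-! ### Local cohomology of the coordinate ring of the curve -/

section Vanishing

variable {k : Type*} [Field k] {r d : ℕ} {f : Fin r → MvPolynomial (Fin 2) k} {μ : Fin (r - 1) → ℕ}

local notation "𝔸" => MvPolynomial (Fin r) k
local notation "ℛ" => MvPolynomial (Fin 2) k

theorem subPiece_graded (b : ℕ) : IsGradedFamily k r (subPiece f b) := fun F e n x hF hx => by
  obtain ⟨G, hG, rfl⟩ := mem_subPiece.mp hx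
  exact mem_subPiece.mpr ⟨F * G, mul_mem_polyPiece' (mem_polyPiece_iff.mpr hF) hG (add_comm _ _), by
    exact (congrArg (· * (X 1 ^ b : ℛ)) (map_mul (aeval f) F G)).trans (mul_assoc _ _ _)⟩

theorem IsParametrization.subPiece_le (hf : IsParametrization f d) (b : ℕ) (n : ℤ) :
    subPiece f b n ≤ targetPiece f d b n := fun x hx => by
  obtain ⟨G, hG, rfl⟩ := mem_subPiece.mp hx
  exact mem_targetPiece_of_eq (mul_mem_polyPiece (hf.aeval_mem hG) (X_pow_mem_polyPiece 1 b))
    (add_comm _ _)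

theorem inducesIso_toSpanSingleton (b : ℕ) :
    InducesIso (LinearMap.toSpanSingleton 𝔸 (Target f) (show Target f from (X 1 ^ b : ℛ)))
      (polyPiece k r) (idealFamily (imageIdeal f)) (subPiece f b) (fun _ => ⊥) where
  map_mem n F hF := mem_subPiece.mpr ⟨F, hF, rfl⟩
  map_mem_sub n F hF := by
    have h1 : aeval f F = 0 := hF.2
    rw [AddSubgroup.mem_bot, LinearMap.toSpanSingleton_apply, target_smul_def, h1]
    exact zero_mul _
  surj n x hx := by
    obtain ⟨F, hF, rfl⟩ := mem_subPiece.mp hx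
    exact ⟨F, hF, sub_self _⟩
  inj n F hF h := by
    refine ⟨hF, ?_⟩
    have h1 : (aeval f F * X 1 ^ b : ℛ) = 0 := h
    exact (mul_eq_zero.mp h1).resolve_right (pow_ne_zero _ (X_ne_zero 1))

/-- The linear presentation supplies the generators and relations, and the conductor the bound on
the dimension. On the curve X_i^N - ℓβ_i is a multiple of the conductor, so it kills the cokernel.
-/
theorem IsSyzygyDegrees.cohomologyVanishes_cokernel (hf : IsParametrization f d)
    (hμ : IsSyzygyDegrees f μ) (hbir : IsBirationalOntoImage f) {b : ℕ}
    (hb : ∀ i j, i ≠ j → μ i + μ j ≤ b + 1) (hb' : ∀ j, μ j ≤ b + 1) (hbd : b < d) {p j : ℤ}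
    (hj : p < 2 → b - p ≤ j) :
    CohomologyVanishes k r p j (targetPiece f d b) (subPiece f b) := by
  obtain ⟨m, κ, hκ, hiso⟩ := hμ.exists_presentation hf hb hb' hbd
  obtain ⟨ec, c, hc, hc0, hcon⟩ := hμ.exists_conductor hf hbir hb'
  obtain ⟨E, hE⟩ := hf.exists_isRelPrime hc0
  obtain ⟨ℓ, hℓ, hℓ0, hrel⟩ := hE (E + 1) (Nat.le_succ E)
  obtain ⟨N, hN, hN', hβγ⟩ := hμ.exists_parameter hf hc hℓ hc0 hℓ0 hrel
  choose β γ hβ hγ h using hβγ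
  refine hiso.vanishes' (subPiece_graded b) (fun F e n x hF hx l =>
    mul_mem_polyPiece' (mem_polyPiece_iff.mpr hF) (hx l) (by ring)) ?_
  refine cohomologyVanishes_of_linear_presentation hκ hℓ (Nat.le_add_left 1 E) (β := β)
    (e' := N - (E + 1)) (fun i => mem_polyPiece_iff.mp (by rw [Nat.cast_sub hN]; exact hβ i)) (N := N)
    (by omega) (fun i l => hiso.inj N _ (fun l' => ?_) ?_) hj
  · rw [Pi.single_apply]
    split_ifs
    · exact sub_mem (X_pow_mem_polyPiece i N) (mul_mem_polyPiece' (mem_polyPiece_iff.mpr hℓ) (hβ i) (by ring))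
    · exact zero_mem _
  · obtain ⟨G, hG, hG'⟩ := hcon (N - ec) (aeval f (γ i) * monomial (binaryExponent b (l + 1)) 1)
      (mul_mem_polyPiece' (hf.aeval_mem (hγ i)) (monomial_binaryExponent_mem (by omega) _) (by
        push_cast [Nat.cast_sub hN']; ring))
    refine mem_subPiece.mpr ⟨G, by rwa [Nat.sub_add_cancel hN'] at hG, ?_⟩
    rw [← hG', presentationMap_apply, Finset.sum_eq_single l (fun l' _ hl => by
      rw [Pi.single_eq_of_ne hl, map_zero, zero_mul]) (fun h => absurd (Finset.mem_univ l) h),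
      Pi.single_eq_same, map_sub, map_pow, aeval_X, map_mul, h i]
    ring

/-- The local cohomology of the coordinate ring of the curve. -/
theorem IsSyzygyDegrees.cohomologyVanishes_image (hf : IsParametrization f d)
    (hμ : IsSyzygyDegrees f μ) (hbir : IsBirationalOntoImage f) {b : ℕ}
    (hb : ∀ i j, i ≠ j → μ i + μ j ≤ b + 1) (hb' : ∀ j, μ j ≤ b + 1) (hbd : b < d)
    (hb0 : b = 0 → d = 1) {p j : ℤ} (h : b < j + p) :
    CohomologyVanishes k r p j (polyPiece k r) (idealFamily (imageIdeal f)) := by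
  refine (inducesIso_toSpanSingleton b).vanishes isGradedFamily_bot polyPiece_graded ?_
  refine CohomologyVanishes.sub isGradedFamily_bot (subPiece_graded b) (fun _ => bot_le)
    (hf.subPiece_le b) (hμ.cohomologyVanishes_cokernel hf hbir hb hb' hbd fun hp => by omega)
    (hf.cohomologyVanishes_targetPiece fun hp => ?_)
  subst hp
  -- The degree j = -1 occurs only for b = 0. There b + dj ≥ -1 holds because d = 1.
  rcases Nat.eq_zero_or_pos b with h0 | h0
  · have h1 : (-1 : ℤ) ≤ j := by omega
    rw [h0, hb0 h0]
    push_cast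
    linarith
  · have h1 : 0 ≤ j := by omega
    have : 0 ≤ (d : ℤ) * j := mul_nonneg (by omega) h1
    omega

/-- The local cohomology of the defining ideal of the curve. -/
theorem IsSyzygyDegrees.cohomologyVanishes_ideal (hf : IsParametrization f d)
    (hμ : IsSyzygyDegrees f μ) (hbir : IsBirationalOntoImage f) {b : ℕ}
    (hb : ∀ i j, i ≠ j → μ i + μ j ≤ b + 1) (hb' : ∀ j, μ j ≤ b + 1) (hbd : b < d)
    (hb0 : b = 0 → d = 1) {p j : ℤ} (h : b + 1 < j + p) :
    CohomologyVanishes k r p j (idealFamily (imageIdeal f)) (fun _ => ⊥) := by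
  -- From 0 → I → A → A/I → 0: the connecting map raises the bound by one, and A itself has only
  -- H^r, in degrees at most -r.
  refine CohomologyVanishes.sub isGradedFamily_bot (idealFamily_graded _) (fun _ => bot_le)
    (idealFamily_le _) (hμ.cohomologyVanishes_image hf hbir hb hb' hbd hb0 (by omega)) ?_
  rcases lt_or_ge (r : ℤ) p with hp | hp
  · exact cohomologyVanishes_of_gt hp _ _
  refine cohomologyVanishes_of_division polyPiece_graded
    (fun a l => { toFun := fun F => F.divMonomial (Finsupp.single l a)
                  map_zero' := zero_divMonomial _
                  map_add' := fun F G => add_divMonomial _ _ _ })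
    (fun a l F => divMonomial_X_pow_mul l a F) (fun a l i F hil => divMonomial_X_pow_mul_of_ne hil a F)
    (fun a l i F => ?_) (fun a l n F hF => divMonomial_mem hF l a) ?_
  · change (F.divMonomial _).divMonomial _ = (F.divMonomial _).divMonomial _
    rw [← divMonomial_add, ← divMonomial_add, add_comm]
  · rcases lt_or_eq_of_le hp with hp | rfl
    · exact Or.inl hp
    · exact Or.inr fun a F hF h0 => eq_zero_of_divMonomial_eq_zero hF h0 (by linarith)

end Vanishing

/-! ### The dimension of the curve -/

section KrullDimension

/-- Going up: every prime strictly above the contraction of Q is the contraction of a prime strictly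
above Q. -/
theorem coheight_comap_le {R S : Type*} [CommRing R] [CommRing S] [Algebra R S]
    [Algebra.IsIntegral R S] (n : ℕ) (Q : PrimeSpectrum S) (h : Order.coheight Q ≤ n) :
    Order.coheight (PrimeSpectrum.comap (algebraMap R S) Q) ≤ n := by
  induction n generalizing Q with
  | zero =>
    rw [Order.coheight_le_coe_iff] at h ⊢
    intro P hP
    obtain ⟨Q', hQ', hp, hc⟩ := Ideal.exists_ideal_over_prime_of_isIntegral P.asIdeal Q.asIdeal hP.le
    have h1 : Q < ⟨Q', hp⟩ := lt_of_le_of_ne hQ' fun h2 => hP.ne (by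
      rw [h2]; exact PrimeSpectrum.ext hc)
    have := h _ h1
    simp at this
  | succ n ih =>
    rw [Order.coheight_le_coe_iff] at h ⊢
    intro P hP
    obtain ⟨Q', hQ', hp, hc⟩ := Ideal.exists_ideal_over_prime_of_isIntegral P.asIdeal Q.asIdeal hP.le
    have h1 : Q < ⟨Q', hp⟩ := lt_of_le_of_ne hQ' fun h2 => hP.ne (by
      rw [h2]; exact PrimeSpectrum.ext hc)
    have h2 := h _ h1
    have h3 := ih _ (Order.le_of_lt_add_one (by exact_mod_cast h2))
    rw [show P = PrimeSpectrum.comap (algebraMap R S) ⟨Q', hp⟩ from (PrimeSpectrum.ext hc).symm]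
    exact lt_of_le_of_lt h3 (by exact_mod_cast Nat.lt_succ_self n)

/-- Integral extensions preserve the Krull dimension. -/
theorem ringKrullDim_eq_of_isIntegral {R S : Type*} [CommRing R] [CommRing S] [Algebra R S]
    [Algebra.IsIntegral R S] (hinj : Function.Injective (algebraMap R S)) :
    ringKrullDim R = ringKrullDim S := by
  refine le_antisymm ?_ (Order.krullDim_le_of_strictMono (PrimeSpectrum.comap (algebraMap R S))
    fun P Q h => Ideal.IsIntegral.comap_lt_comap h)
  unfold ringKrullDim
  rw [Order.krullDim_eq_iSup_coheight]
  refine iSup_le fun P => ?_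
  obtain ⟨Q, -, hp, hc⟩ := Ideal.exists_ideal_over_prime_of_isIntegral (S := S) P.asIdeal ⊥ (by
    rw [← RingHom.ker_eq_comap_bot, (RingHom.injective_iff_ker_eq_bot _).mp hinj]; exact bot_le)
  rw [show P = PrimeSpectrum.comap (algebraMap R S) ⟨Q, hp⟩ from (PrimeSpectrum.ext hc).symm]
  refine le_trans ?_ (Order.coheight_le_krullDim (⟨Q, hp⟩ : PrimeSpectrum S))
  refine WithBot.coe_le_coe.mpr (ENat.forall_natCast_le_iff_le.mp fun m hm => ?_)
  by_contra hlt
  rw [not_le] at hlt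
  obtain ⟨n, hn⟩ := ENat.ne_top_iff_exists.mp (ne_top_of_lt hlt)
  have h1 := coheight_comap_le (R := R) n ⟨Q, hp⟩ hn.ge
  exact absurd (hm.trans h1) (not_le.mpr (hn ▸ hlt))

end KrullDimension

/-! ### The curve has dimension one -/

section Curve

variable {k : Type*} [Field k] {r d : ℕ} {f : Fin r → MvPolynomial (Fin 2) k}

local notation "𝔸" => MvPolynomial (Fin r) k
local notation "ℛ" => MvPolynomial (Fin 2) k

/-- A binary form of large degree is ∑ a_i f_i with a_i of smaller degree, so the monomials of
bounded degree generate. -/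
theorem IsParametrization.finite_target (hf : IsParametrization f d) : Module.Finite 𝔸 (Target f) := by
  obtain ⟨E, hE⟩ := hf.exists_eq_sum_of_large
  set e := E.toNat
  let v : Fin e × Fin e → Target f := fun c => (monomial (binaryExponent c.1 c.2) (1 : k) : ℛ)
  have h1 : ∀ (n : ℕ) (F : ℛ), F ∈ polyPiece k 2 n →
      (show Target f from F) ∈ Submodule.span 𝔸 (Set.range v) := by
    intro n
    induction n using Nat.strong_induction_on with | _ n ih =>
    intro F hF
    rcases lt_or_ge n e with hn | hn
    · rw [eq_sum_monomial_binaryExponent hF]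
      refine Submodule.sum_mem (M := Target f) _ fun i _ => ?_
      have h2 : (monomial (binaryExponent n i) (coeff (binaryExponent n i) F) : ℛ) =
          C (coeff (binaryExponent n i) F) * monomial (binaryExponent n i) (1 : k) := by
        rw [C_mul_monomial, mul_one]
      have h3 : (C (coeff (binaryExponent n i) F) : 𝔸) • v (⟨n, hn⟩, ⟨i, by omega⟩) =
          (C (coeff (binaryExponent n i) F) * monomial (binaryExponent n i) (1 : k) : ℛ) := by
        rw [target_smul_def, aeval_C]
        rfl
      have h4 := Submodule.smul_mem (Submodule.span 𝔸 (Set.range v))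
        (C (coeff (binaryExponent n i) F)) (Submodule.subset_span ⟨(⟨n, hn⟩, ⟨i, by omega⟩), rfl⟩)
      rw [h3] at h4
      rw [h2]
      exact h4
    · obtain ⟨a, ha, haF⟩ := hE n (by omega) F hF
      have h2 : (show Target f from F) = ∑ i, (X i : 𝔸) • (show Target f from a i) := by
        rw [← haF]
        refine Finset.sum_congr (M := Target f) rfl fun i _ => ?_
        rw [target_smul_def, aeval_X]
        exact mul_comm (G := ℛ) _ _
      rw [h2]
      refine sum_mem fun i _ => Submodule.smul_mem _ _ ?_
      have hd := hf.one_le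
      rcases lt_or_ge n d with h3 | h3
      · rw [polyPiece_of_neg (by omega) (ha i)]
        exact zero_mem _
      · exact ih (n - d) (by omega) _ (by rw [Nat.cast_sub h3]; exact ha i)
  refine ⟨Submodule.fg_def.mpr ⟨_, Set.finite_range v, eq_top_iff.mpr fun F _ => ?_⟩⟩
  rw [← sum_component (k := k) (r := 2) F]
  exact Submodule.sum_mem (M := Target f) _ fun i _ => h1 i _ (component_mem _ _)

/-- The ring k[x, y] is integral over the coordinate ring, so the two dimensions agree. -/
theorem IsParametrization.ringKrullDim_quotient (hf : IsParametrization f d) :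
    ringKrullDim (𝔸 ⧸ imageIdeal f) = 2 := by
  have h1 := hf.finite_target
  have h2 : ((aeval f : 𝔸 →ₐ[k] ℛ) : 𝔸 →+* ℛ).IsIntegral := fun x =>
    Algebra.IsIntegral.isIntegral (R := 𝔸) (A := Target f) x
  let g : 𝔸 ⧸ imageIdeal f →+* ℛ := RingHom.kerLift ((aeval f : 𝔸 →ₐ[k] ℛ) : 𝔸 →+* ℛ)
  have hg : g.IsIntegral := RingHom.IsIntegral.tower_top (Ideal.Quotient.mk _) g h2
  let := g.toAlgebra
  have : Algebra.IsIntegral (𝔸 ⧸ imageIdeal f) ℛ := ⟨hg⟩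
  rw [ringKrullDim_eq_of_isIntegral (S := ℛ) (RingHom.kerLift_injective _),
    MvPolynomial.ringKrullDim_of_isNoetherianRing, ringKrullDim_eq_zero_of_field]
  simp

theorem IsParametrization.hasProjDim (hf : IsParametrization f d) : HasProjDim (imageIdeal f) 1 :=
  hf.ringKrullDim_quotient

/-- A curve in the projective line is the projective line. -/
theorem IsParametrization.imageIdeal_eq_bot {f : Fin 2 → MvPolynomial (Fin 2) k}
    (hf : IsParametrization f d) : imageIdeal f = ⊥ := by
  by_contra h
  obtain ⟨F, hF, hF0⟩ := Submodule.exists_mem_ne_zero_of_ne_bot h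
  -- A nonzero F in the ideal would lower the dimension of k[T_1, T_2] below 2.
  have h1 := ringKrullDim_quotient_succ_le_of_nonZeroDivisor (mem_nonZeroDivisors_of_ne_zero hF0)
  have h2 : ringKrullDim (ℛ ⧸ imageIdeal f) ≤ ringKrullDim (ℛ ⧸ Ideal.span {F}) :=
    ringKrullDim_le_of_surjective (Ideal.Quotient.factor ((Ideal.span_singleton_le_iff_mem _).mpr hF))
      (Ideal.Quotient.factor_surjective _)
  rw [hf.ringKrullDim_quotient] at h2
  rw [MvPolynomial.ringKrullDim_of_isNoetherianRing, ringKrullDim_eq_zero_of_field] at h1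
  have h3 := (add_le_add_left h2 1).trans h1
  rw [zero_add, Nat.card_fin] at h3
  exact absurd h3 (by decide)

end Curve

/-! ### The degree of the curve -/

section Degree

variable {k : Type*} [Field k] {r d : ℕ} {f : Fin r → MvPolynomial (Fin 2) k} {μ : Fin (r - 1) → ℕ}

local notation "𝔸" => MvPolynomial (Fin r) k
local notation "ℛ" => MvPolynomial (Fin 2) k

/-- If the first local cohomology of the coordinate ring vanishes in degree `t`, then forms of degree
`d * t` which are multiplied into it by powers of the variables belong to it. -/
theorem IsParametrization.exists_eq_aeval (hf : IsParametrization f d) {t : ℤ}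
    (hV : CohomologyVanishes k r 1 t (polyPiece k r) (idealFamily (imageIdeal f))) {N : ℕ} {x : ℛ}
    {w : Fin r → 𝔸} (hw : ∀ i, w i ∈ polyPiece k r (t + N)) (hwx : ∀ i, aeval f (w i) = f i ^ N * x) :
    ∃ G ∈ polyPiece k r t, aeval f G = x := by
  classical
  -- The 1-cochain with value w_i at {i}, a lift of the Koszul boundary of the 0-cochain x. It is
  -- closed modulo the ideal, and a primitive of it gives G; one nonzero f_i suffices to identify
  -- its value with x.
  let u : Finset (Fin r) → 𝔸 := fun σ =>
    ∑ i ∈ σ, if σ.erase i = ∅ then koszulSign 𝔸 σ i • w i else 0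
  have hcard : ∀ {σ : Finset (Fin r)} {i : Fin r}, i ∈ σ → σ.erase i = ∅ → σ.card = 1 := fun hi h => by
    rw [← Finset.card_erase_add_one hi, h, Finset.card_empty]
  have hu : u ∈ koszulCochain (polyPiece k r) 1 t N := fun σ => by
    refine ⟨fun h => Finset.sum_eq_zero fun i hi => if_neg fun h' => h (by
      rw [hcard hi h', Nat.cast_one]), sum_mem fun i hi => ?_⟩
    split_ifs with h
    · rw [hcard hi h, Nat.cast_one, mul_one]
      exact koszulSign_smul_mem k r _ _ _ (hw i)
    · exact zero_mem _
  let g : 𝔸 →ₗ[𝔸] Target f := LinearMap.toSpanSingleton 𝔸 (Target f) 1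
  have hg : ∀ F : 𝔸, g F = aeval f F := fun F => mul_one (M := ℛ) _
  let x' : Target f := x
  have hgw : ∀ i, g (w i) = (X i ^ N : 𝔸) • x' := fun i => by
    have h : aeval f (w i) = aeval f (X i ^ N : 𝔸) * x := by rw [map_pow, aeval_X, hwx]
    exact (hg _).trans h
  have hgu : (fun σ => g (u σ)) = koszulD k r (Target f) N (Pi.single ∅ x') := by
    ext1 σ
    rw [koszulD_apply, map_sum]
    refine Finset.sum_congr rfl fun i _ => ?_
    by_cases h : σ.erase i = ∅
    · rw [if_pos h, h, Pi.single_eq_same, map_smul, hgw, smul_comm]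
    · rw [if_neg h, Pi.single_eq_of_ne h, map_zero, smul_zero, smul_zero]
  have hdu : koszulD k r 𝔸 N u ∈ koszulCochain (idealFamily (imageIdeal f)) (1 + 1) t N := fun σ => by
    have h1 := koszulD_mem (q := 1 + 1) polyPiece_graded hu rfl σ
    refine ⟨h1.1, h1.2, ?_⟩
    have h2 := congrFun (koszulD_map (k := k) g N u) σ
    rw [hgu, koszulD_koszulD] at h2
    exact (hg _).symm.trans h2.symm
  obtain ⟨b, v, hv, hvu⟩ := hV N u hu hdu
  refine ⟨v ∅, by simpa using (hv ∅).2, ?_⟩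
  obtain ⟨i, hi⟩ := hf.exists_ne_zero
  have h3 : aeval f ((koszulD k r 𝔸 (N + b) v - koszulShift k r 𝔸 b u) {i}) = 0 := (hvu {i}).2.2
  have h4 : koszulSign 𝔸 {i} i = 1 := by simp [koszulSign, Finset.filter_singleton]
  rw [Pi.sub_apply, koszulD_apply, koszulShift_apply, Finset.sum_singleton, Finset.prod_singleton,
    show u {i} = w i by simp [u, h4], h4, one_smul, Finset.erase_singleton, smul_eq_mul, smul_eq_mul, map_sub,
    map_mul, map_mul, hwx, map_pow, map_pow, aeval_X, pow_add] at h3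
  refine mul_left_cancel₀ (pow_ne_zero N hi) (mul_left_cancel₀ (pow_ne_zero b hi) ?_)
  linear_combination h3

variable (f) in
/-- The degree `t` part of the image of `k[T_1, …, T_r]`. -/
def imagePiece (t : ℕ) : Submodule k ℛ :=
  (homogeneousSubmodule (Fin r) k t).map (aeval f : 𝔸 →ₐ[k] ℛ).toLinearMap

theorem mem_imagePiece {t : ℕ} {x : ℛ} : x ∈ imagePiece f t ↔ ∃ F ∈ polyPiece k r t, aeval f F = x := by
  simp only [mem_polyPiece_iff]
  exact Iff.rfl

instance (t : ℕ) : FiniteDimensional k (imagePiece f t) := by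
  have : FiniteDimensional k (homogeneousSubmodule (Fin r) k t) := by
    rw [← formSpace_natCast]; infer_instance
  unfold imagePiece
  infer_instance

theorem finrank_quotientPiece (t : ℕ) :
    Module.finrank k (quotientPiece (imageIdeal f) t) = Module.finrank k (imagePiece f t) := by
  have : FiniteDimensional k (homogeneousSubmodule (Fin r) k t) := by
    rw [← formSpace_natCast]; infer_instance
  have h1 := LinearMap.finrank_range_add_finrank_ker
    ((Ideal.Quotient.mkₐ k (imageIdeal f)).toLinearMap.domRestrict (homogeneousSubmodule (Fin r) k t))
  have h2 := LinearMap.finrank_range_add_finrank_ker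
    ((aeval f : 𝔸 →ₐ[k] ℛ).toLinearMap.domRestrict (homogeneousSubmodule (Fin r) k t))
  have h3 : LinearMap.ker ((Ideal.Quotient.mkₐ k (imageIdeal f)).toLinearMap.domRestrict
      (homogeneousSubmodule (Fin r) k t)) = LinearMap.ker ((aeval f : 𝔸 →ₐ[k] ℛ).toLinearMap.domRestrict
      (homogeneousSubmodule (Fin r) k t)) := by
    ext F
    exact Ideal.Quotient.eq_zero_iff_mem (I := imageIdeal f)
  rw [h3, ← h2, LinearMap.range_domRestrict, LinearMap.range_domRestrict] at h1
  exact Nat.add_right_cancel h1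

theorem IsParametrization.imagePiece_le (hf : IsParametrization f d) (t : ℕ) :
    imagePiece f t ≤ formSpace k 2 (d * t : ℕ) := fun x hx => by
  obtain ⟨F, hF, rfl⟩ := mem_imagePiece.mp hx
  rw [mem_formSpace]
  push_cast
  exact hf.aeval_mem hF

theorem finrank_formSpace_natCast (n : ℕ) : Module.finrank k (formSpace k 2 n) = n + 1 := by
  rw [finrank_formSpace]; omega

theorem finrank_map_mulLeft {G : ℛ} (hG : G ≠ 0) (V : Submodule k ℛ) :
    Module.finrank k (V.map (LinearMap.mulLeft k G)) = Module.finrank k V :=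
  (Submodule.equivMapOfInjective _ (fun _ _ h => mul_left_cancel₀ hG h) V).finrank_eq.symm

/-- The numbers `d * t + 1 - h t`, for the Hilbert function `h` of the curve, are bounded. -/
theorem IsSyzygyDegrees.exists_le_finrank_add (hf : IsParametrization f d) (hμ : IsSyzygyDegrees f μ)
    (hbir : IsBirationalOntoImage f) {b : ℕ} (hb : ∀ j, μ j ≤ b + 1) :
    ∃ e : ℕ, ∀ t, d * t + 1 ≤ Module.finrank k (imagePiece f (t + e)) := by
  obtain ⟨e, c, -, hc0, hcon⟩ := hμ.exists_conductor hf hbir hb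
  refine ⟨e, fun t => ?_⟩
  rw [← finrank_formSpace_natCast (k := k), ← finrank_map_mulLeft hc0]
  refine Submodule.finrank_mono ?_
  rintro _ ⟨x, hx, rfl⟩
  -- Multiplication by y^b puts x in a degree covered by the conductor, and it cancels afterwards.
  obtain ⟨G, hG, h⟩ := hcon t (X 1 ^ b * x) (by
    push_cast
    exact mul_mem_polyPiece' (X_pow_mem_polyPiece 1 b) hx (by push_cast; ring))
  refine mem_imagePiece.mpr ⟨G, hG, ?_⟩
  refine mul_right_cancel₀ (pow_ne_zero b (X_ne_zero 1)) (h.symm.trans ?_)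
  rw [LinearMap.mulLeft_apply]
  ring

/-- The numbers `d * t + 1 - h t`, for the Hilbert function `h` of the curve, do not decrease. -/
theorem IsSyzygyDegrees.exists_finrank_add_le (hf : IsParametrization f d) (hμ : IsSyzygyDegrees f μ)
    (hbir : IsBirationalOntoImage f) {b : ℕ} (hb : ∀ j, μ j ≤ b + 1) :
    ∃ E : ℕ, ∀ e, E ≤ e → ∀ t : ℕ,
      CohomologyVanishes k r 1 t (polyPiece k r) (idealFamily (imageIdeal f)) →
      d * t + 1 + Module.finrank k (imagePiece f (t + e)) ≤
        d * (t + e) + 1 + Module.finrank k (imagePiece f t) := by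
  obtain ⟨ec, c, hc, hc0, hcon⟩ := hμ.exists_conductor hf hbir hb
  obtain ⟨E, hE⟩ := hf.exists_isRelPrime hc0
  refine ⟨E, fun e he t hV => ?_⟩
  obtain ⟨ℓ, hℓ, hℓ0, hrel⟩ := hE e he
  obtain ⟨N, hN, hN', hβγ⟩ := hμ.exists_parameter hf hc hℓ hc0 hℓ0 hrel
  choose β γ hβ hγ h using hβγ
  set L := (formSpace k 2 (d * t : ℕ)).map (LinearMap.mulLeft k (aeval f ℓ)) with hL
  have h1 := Submodule.finrank_sup_add_finrank_inf_eq L (imagePiece f (t + e))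
  have h2 : Module.finrank k L = d * t + 1 := by
    rw [hL, finrank_map_mulLeft hℓ0, finrank_formSpace_natCast]
  have h3 : Module.finrank k (L ⊔ imagePiece f (t + e) : Submodule k ℛ) ≤ d * (t + e) + 1 := by
    rw [← finrank_formSpace_natCast (k := k)]
    refine Submodule.finrank_mono (sup_le ?_ (hf.imagePiece_le _))
    rintro _ ⟨x, hx, rfl⟩
    exact mul_mem_polyPiece' (hf.aeval_mem (mem_polyPiece_iff.mpr hℓ)) hx (by push_cast; ring)
  -- Multiplication by ℓ is injective on R_(dt) modulo the coordinate ring. If ℓx belongs to this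
  -- ring, so does f_i^N x, since f_i^N is a combination of ℓ and the conductor. Then x belongs to
  -- it by the vanishing of the first local cohomology.
  have h4 : Module.finrank k (L ⊓ imagePiece f (t + e) : Submodule k ℛ) ≤
      Module.finrank k (imagePiece f t) := by
    rw [← finrank_map_mulLeft hℓ0 (imagePiece f t)]
    refine Submodule.finrank_mono ?_
    rintro _ ⟨⟨x, hx, rfl⟩, hx'⟩
    refine ⟨x, ?_, rfl⟩
    obtain ⟨w, hw, hwx⟩ := mem_imagePiece.mp hx'
    obtain ⟨w', hw', hwx'⟩ := hcon t (X 1 ^ b * x)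
      (mul_mem_polyPiece' (X_pow_mem_polyPiece 1 b) hx (by push_cast; ring))
    have h5 : aeval f w' = aeval f c * x := by
      refine mul_right_cancel₀ (pow_ne_zero b (X_ne_zero 1)) (hwx'.symm.trans ?_)
      ring
    refine mem_imagePiece.mpr (hf.exists_eq_aeval hV (N := N) (w := fun i => β i * w + γ i * w')
      (fun i => add_mem (mul_mem_polyPiece' (hβ i) hw (by push_cast; ring))
        (mul_mem_polyPiece' (hγ i) hw' (by push_cast; ring))) fun i => ?_)
    rw [map_add, map_mul, map_mul, hwx, h5, h, LinearMap.mulLeft_apply]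
    ring
  omega

/-- Only jumps of length at least E are controlled. Beyond E steps after a maximum of q on t ≥ t₀,
no value can be smaller or larger than it. -/
theorem eventually_const_of_bounded {q : ℕ → ℕ} {E t₀ K : ℕ} (hK : ∀ t, q t ≤ K)
    (hq : ∀ t, t₀ ≤ t → ∀ e, E ≤ e → q t ≤ q (t + e)) :
    ∃ Q, ∀ᶠ t in Filter.atTop, q t = Q := by
  classical
  have h1 : ∃ m, ∃ t, t₀ ≤ t ∧ K - q t = m := ⟨_, t₀, le_rfl, rfl⟩
  obtain ⟨t₁, ht₁, h2⟩ := Nat.find_spec h1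
  refine ⟨q t₁, Filter.eventually_atTop.mpr ⟨t₁ + E, fun t ht => ?_⟩⟩
  have h3 := hq t₁ ht₁ (t - t₁) (by omega)
  rw [Nat.add_sub_cancel' (by omega)] at h3
  have h4 : Nat.find h1 ≤ K - q t := Nat.find_min' h1 ⟨t, by omega, rfl⟩
  have h5 := hK t
  have h6 := hK t₁
  omega

/-- The degree of the curve is the degree of its parametrization. -/
theorem IsSyzygyDegrees.hasProjDegree (hf : IsParametrization f d) (hμ : IsSyzygyDegrees f μ)
    (hbir : IsBirationalOntoImage f) {b : ℕ} (hb : ∀ j, μ j ≤ b + 1) {t₀ : ℕ}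
    (hV : ∀ t : ℕ, t₀ ≤ t →
      CohomologyVanishes k r 1 t (polyPiece k r) (idealFamily (imageIdeal f))) :
    HasProjDegree (imageIdeal f) d := by
  have hd := hf.one_le
  obtain ⟨e, he⟩ := hμ.exists_le_finrank_add hf hbir hb
  obtain ⟨E, hE⟩ := hμ.exists_finrank_add_le hf hbir hb
  have hle : ∀ t, Module.finrank k (imagePiece f t) ≤ d * t + 1 := fun t => by
    rw [← finrank_formSpace_natCast (k := k)]
    exact Submodule.finrank_mono (hf.imagePiece_le t)
  obtain ⟨Q, hQ⟩ := eventually_const_of_bounded (E := E) (t₀ := t₀) (K := d * e + 1)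
    (q := fun t => d * t + 1 - Module.finrank k (imagePiece f t)) (fun t => by
      rcases lt_or_ge t e with h | h
      · have := Nat.mul_le_mul_left d h.le
        omega
      · obtain ⟨s, rfl⟩ := Nat.exists_eq_add_of_le' h
        have := he s
        rw [mul_add]
        omega) (fun t ht e' he' => by
      have h1 := hE e' he' t (hV t ht)
      have h2 := hle t
      have h3 := hle (t + e')
      omega)
  refine ⟨Polynomial.C (d : ℚ) * Polynomial.X + Polynomial.C (1 - Q : ℚ), ?_, ?_⟩
  · filter_upwards [hQ] with t ht
    have h1 := hle t
    rw [finrank_quotientPiece]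
    have h2 : (Module.finrank k (imagePiece f t) : ℚ) + Q = d * t + 1 := by
      rw [← ht]; push_cast [Nat.cast_sub h1]; ring
    simp only [Polynomial.eval_add, Polynomial.eval_mul, Polynomial.eval_C, Polynomial.eval_X]
    linarith
  · have h0 : (d : ℚ) ≠ 0 := by exact_mod_cast (by omega : d ≠ 0)
    rw [Polynomial.leadingCoeff_linear h0, Polynomial.natDegree_linear h0]
    simp

end Degree

/-! ### The regularity of the curve -/

section Regularity

variable {k : Type*} [Field k] {r d : ℕ} {f : Fin r → MvPolynomial (Fin 2) k} {μ : Fin (r - 1) → ℕ}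

theorem add_le_sum {ι : Type*} [Fintype ι] [DecidableEq ι] (μ : ι → ℕ) {i j : ι} (h : i ≠ j) :
    μ i + μ j ≤ ∑ l, μ l := by
  rw [← Finset.sum_pair h]
  exact Finset.sum_le_univ_sum_of_nonneg fun _ => Nat.zero_le _

/-- The bound `b = max (μ_i + μ_j) - 1`. -/
theorem IsSyzygyDegrees.exists_max (hf : IsParametrization f d) (hμ : IsSyzygyDegrees f μ)
    (hr : 3 ≤ r) : ∃ (b : ℕ) (i j : Fin (r - 1)), i ≠ j ∧ μ i + μ j = b + 1 ∧
      (∀ i j, i ≠ j → μ i + μ j ≤ b + 1) ∧ (∀ j, μ j ≤ b + 1) ∧ b < d ∧ (b = 0 → d = 1) := by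
  classical
  have hsum := hμ.sum_eq hf
  have hd := hf.one_le
  let S : Finset (Fin (r - 1) × Fin (r - 1)) := Finset.univ.filter fun c => c.1 ≠ c.2
  have hS : S.Nonempty := ⟨(⟨0, by omega⟩, ⟨1, by omega⟩), by simp [S]⟩
  obtain ⟨⟨i, j⟩, hij, hmax⟩ := S.exists_max_image (fun c => μ c.1 + μ c.2) hS
  have hij' : i ≠ j := (Finset.mem_filter.mp hij).2
  have h1 : ∀ i' j', i' ≠ j' → μ i' + μ j' ≤ μ i + μ j := fun i' j' h =>
    hmax (i', j') (Finset.mem_filter.mpr ⟨Finset.mem_univ _, h⟩)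
  -- Since r ≥ 3, every index has a partner, so each single μ_j is also at most the maximal pair
  -- sum.
  have h2 : ∀ j', ∃ i', i' ≠ j' := fun j' => by
    by_cases h : j' = i
    · exact ⟨j, by rw [h]; exact hij'.symm⟩
    · exact ⟨i, Ne.symm h⟩
  have h3 : ∀ j', μ j' ≤ μ i + μ j := fun j' => by
    obtain ⟨i', hi'⟩ := h2 j'
    have := h1 i' j' hi'
    omega
  -- Some μ_l is positive because ∑ μ_j = d ≥ 1, so subtracting 1 from the maximum does not
  -- truncate. If the maximum is 1, all other μ_j vanish and d = μ_l = 1.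
  obtain ⟨l, hl⟩ : ∃ l, μ l ≠ 0 := by
    by_contra! h
    simp [h] at hsum
    omega
  have h4 := h3 l
  have h5 := add_le_sum μ hij'
  refine ⟨μ i + μ j - 1, i, j, hij', by omega, fun i' j' h => by have := h1 i' j' h; omega,
    fun j' => by have := h3 j'; omega, by omega, fun hb => ?_⟩
  rw [← hsum, Finset.sum_eq_single l (fun j' _ hj' => by have := h1 j' l hj'; omega) (by simp)]
  omega

theorem IsSyzygyDegrees.regIdeal_imageIdeal_le (hf : IsParametrization f d)
    (hμ : IsSyzygyDegrees f μ) (hbir : IsBirationalOntoImage f) :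
    regIdeal (imageIdeal f) ≤
      ⨆ (i : Fin (r - 1)) (j : Fin (r - 1)) (_ : i ≠ j), (((μ i + μ j : ℕ) : ℝ) : EReal) := by
  rcases lt_or_ge r 3 with hr | hr
  · obtain rfl : r = 2 := le_antisymm (by omega) hf.two_le
    have : Subsingleton (imageIdeal f) := by
      rw [hf.imageIdeal_eq_bot]; infer_instance
    rw [regIdeal, regularity_eq_bot]
    exact bot_le
  · obtain ⟨b, i, j, hij, hb, h1, h2, h3, h4⟩ := hμ.exists_max hf hr
    refine le_trans (regIdeal_le (c := b + 1) fun p j hj =>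
      hμ.cohomologyVanishes_ideal hf hbir h1 h2 h3 h4 hj) ?_
    refine le_trans (le_of_eq ?_) (le_iSup₂_of_le i j (le_iSup_of_le hij le_rfl))
    rw [hb]
    push_cast
    rfl

/-- If `f_1, …, f_r` are linearly independent, then there are no syzygies of degree `0`. -/
theorem IsSyzygyDegrees.one_le (hμ : IsSyzygyDegrees f μ) (hli : LinearIndependent k f)
    (j : Fin (r - 1)) : 1 ≤ μ j := by
  obtain ⟨Φ, hΦ⟩ := hμ
  by_contra h
  have h0 : μ j = 0 := by omega
  have h1 : ∀ i, ∃ c, (Φ j : Fin r → MvPolynomial (Fin 2) k) i = C c := fun i =>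
    mem_polyPiece_zero (by
      have := mem_polyPiece_iff.mpr (hΦ j i)
      rwa [h0] at this)
  choose c hc using h1
  have h2 := mem_syzygies.mp (Φ j).2
  have h3 : ∑ i, c i • f i = 0 := by
    rw [← h2]
    exact Finset.sum_congr rfl fun i _ => by rw [hc, smul_eq_C_mul]
  have h4 := Fintype.linearIndependent_iff.mp hli c h3
  exact Φ.ne_zero j (Subtype.ext (_root_.funext fun i => by rw [hc, h4, C_0]; rfl))

/-- The n - 2 remaining terms contribute at least 1 each. -/
theorem add_add_le_sum {n : ℕ} {μ : Fin n → ℕ} (hμ : ∀ j, 1 ≤ μ j) {i j : Fin n} (h : i ≠ j) :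
    μ i + μ j + n ≤ ∑ l, μ l + 2 := by
  have h1 := add_le_sum (fun l => μ l - 1) h
  have h2 : ∑ l, μ l = ∑ l, (μ l - 1) + n := by
    rw [Finset.sum_congr rfl fun l _ => (Nat.sub_add_cancel (hμ l)).symm, Finset.sum_add_distrib]
    simp
  have h3 := hμ i
  have h4 := hμ j
  omega

theorem IsSyzygyDegrees.regQuotient_imageIdeal_le (hf : IsParametrization f d)
    (hμ : IsSyzygyDegrees f μ) (hbir : IsBirationalOntoImage f) (hli : LinearIndependent k f) :
    ∃ δ e : ℕ, HasProjDim (imageIdeal f) δ ∧ HasProjDegree (imageIdeal f) e ∧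
      regQuotient (imageIdeal f) ≤ ((((e : ℤ) - (((r : ℤ) - 1) - (δ : ℤ)) : ℤ) : ℝ) : EReal) := by
  obtain ⟨b, h1, h2, h3, h4, h5⟩ : ∃ b : ℕ, (∀ i j, i ≠ j → μ i + μ j ≤ b + 1) ∧ (∀ j, μ j ≤ b + 1) ∧
      b < d ∧ (b = 0 → d = 1) ∧ b + r ≤ d + 2 := by
    have hd := hf.one_le
    rcases lt_or_ge r 3 with hr | hr
    · obtain rfl : r = 2 := le_antisymm (by omega) hf.two_le
      have hsum := hμ.sum_eq hf
      -- For r = 2 there are no pairs of syzygy degrees; the single degree is d, and b = d - 1 is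
      -- the least value with μ_j ≤ b + 1.
      refine ⟨d - 1, fun i j h => absurd (Fin.ext (by omega)) h, fun j => ?_, by omega, by omega, by omega⟩
      have := Finset.single_le_sum (f := μ) (fun _ _ => Nat.zero_le _) (Finset.mem_univ j)
      omega
    · obtain ⟨b, i, j, hij, hb, h1, h2, h3, h4⟩ := hμ.exists_max hf hr
      refine ⟨b, h1, h2, h3, h4, ?_⟩
      have h5 := add_add_le_sum (hμ.one_le hli) hij
      rw [hμ.sum_eq hf] at h5
      omega
  refine ⟨1, d, hf.hasProjDim, hμ.hasProjDegree hf hbir h2 (t₀ := b) fun t ht =>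
    hμ.cohomologyVanishes_image hf hbir h1 h2 h3 h4 (by omega), ?_⟩
  refine le_trans (regQuotient_le (c := b) fun p j hj =>
    hμ.cohomologyVanishes_image hf hbir h1 h2 h3 h4 hj) ?_
  rw [EReal.coe_le_coe_iff]
  exact_mod_cast (by push_cast; omega : (b : ℤ) ≤ (d : ℤ) - (((r : ℤ) - 1) - ((1 : ℕ) : ℤ)))

end Regularity

end

end RationalCurve

theorem theorem4p5 {k : Type*} [Field k] {r d : ℕ} (f : Fin r → MvPolynomial (Fin 2) k)
    (hf : RationalCurve.IsParametrization f d) (hbir : RationalCurve.IsBirationalOntoImage f) :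
    (∃ μ : Fin (r - 1) → ℕ, RationalCurve.IsSyzygyDegrees f μ) ∧
    (∀ μ : Fin (r - 1) → ℕ, RationalCurve.IsSyzygyDegrees f μ →
      ∑ i, μ i = d ∧
      RationalCurve.regIdeal (RationalCurve.imageIdeal f) ≤
        ⨆ (i : Fin (r - 1)) (j : Fin (r - 1)) (_ : i ≠ j), (((μ i + μ j : ℕ) : ℝ) : EReal)) ∧
    (LinearIndependent k f →
      ∃ δ e : ℕ, RationalCurve.HasProjDim (RationalCurve.imageIdeal f) δ ∧
        RationalCurve.HasProjDegree (RationalCurve.imageIdeal f) e ∧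
        RationalCurve.regQuotient (RationalCurve.imageIdeal f) ≤
          ((((e : ℤ) - (((r : ℤ) - 1) - (δ : ℤ)) : ℤ) : ℝ) : EReal)) := by
  obtain ⟨μ, hμ⟩ := hf.exists_isSyzygyDegrees
  exact ⟨⟨μ, hμ⟩, fun μ hμ => ⟨hμ.sum_eq hf, hμ.regIdeal_imageIdeal_le hf hbir⟩,
    fun hli => hμ.regQuotient_imageIdeal_le hf hbir hli⟩
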